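/- Let $q:G'\to G$ be an epimorphism of (discrete) groups with finite kernel $\Gamma$. Let $W$ be a closed connected oriented surface of positive genus, obtained (as every such surface can be) by gluing finitely many oriented triangles along their sides in pairs. Let $\pi=\pi_1(W)$ and let $[W]\in H_2(W;\mathbb Z)=H_2(\pi;\mathbb Z)$ be its fundamental class. Let $g:\pi\to G$ be a group homomorphism and let $\mathrm{Hom}_g(\pi,G')$ be the set of homomorphisms $g':\pi\to G'$ with $qg'=g$. Let $\mathrm{Irr}(\Gamma)$ be the set of equivalence classes of irreducible representations $\rho:\Gamma\to GL_n(\mathbb C)$, $n=\dim\rho\ge 1$. For such $\rho$ let $G_\rho\subset G$ be the stabilizer of its class: the subgroup of all $\alpha\in G$ such that, for some $\widetilde\alpha\in q^{-1}(\alpha)$, the representation $h\mapsto\rho(\widetilde\alpha^{-1}h\,\widetilde\alpha)$ of $\Gamma$ is equivalent to $\rho$. For each $\alpha\in G_\rho$ choose such an $\widetilde\alpha\in q^{-1}(\alpha)$ and a matrix $M_\alpha\in GL_n(\mathbb C)$ with $\rho(\widetilde\alpha^{-1}h\,\widetilde\alpha)=M_\alpha^{-1}\rho(h)M_\alpha$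 for all $h\in\Gamma$; let $\zeta_\rho\in H^2(G_\rho;\mathbb C^*)$ (trivial action) be the class of the 2-cocycle $(\zeta_{\alpha,\beta})$ determined by $$\zeta_{\alpha,\beta}\,M_\alpha M_\beta=M_{\alpha\beta}\,\rho\big(\widetilde{\alpha\beta}^{\,-1}\,\widetilde\alpha\,\widetilde\beta\big),\qquad \alpha,\beta\in G_\rho .$$ Then $\mathrm{Irr}(\Gamma)$ and $\mathrm{Hom}_g(\pi,G')$ are finite, and $$|\mathrm{Hom}_g(\pi,G')|=|\Gamma|\sum_{\rho\in\mathrm{Irr}(\Gamma),\ G_\rho\supset g(\pi)}\left(\frac{|\Gamma|}{\dim\rho}\right)^{-\chi(W)} g^*(\zeta_\rho)([W]),$$ where $\chi(W)$ is the Euler characteristic, $g^*(\zeta_\rho)([W])\in\mathbb C^*$ is the evaluation of $g^*(\zeta_\rho)\in H^2(\pi;\mathbb C^*)$ on $[W]$, and the addition is that of $\mathbb C$. -/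

import Mathlib

noncomputable section

namespace LiftCount

/-! ### Second homology and cohomology of a group (bar complex, trivial action) -/

section GroupHomology

variable {Q R : Type*} [Group Q] [Group R]

/-- `Z²(Q; ℂ^*)` for the trivial action, written additively: functions `c` with
`c(h,k) - c(gh,k) + c(g,hk) - c(g,h) = 0`. -/
def cocycles (Q : Type*) [Group Q] : AddSubgroup (Q × Q → Additive ℂˣ) where
  carrier := {c | ∀ x y z : Q, c (y, z) + c (x, y * z) = c (x * y, z) + c (x, y)}
  zero_mem' := by intro x y z; simp
  add_mem' := by
    intro a b ha hb x y z
    simp only [Pi.add_apply]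
    rw [add_add_add_comm, ha x y z, hb x y z, add_add_add_comm]
  neg_mem' := by
    intro a ha x y z
    simp only [Pi.neg_apply]
    rw [← neg_add, ha x y z, neg_add]

/-- The coboundary `(δf)(x,y) = f(y) - f(xy) + f(x)`. -/
def coboundaryMap (Q : Type*) [Group Q] : (Q → Additive ℂˣ) →+ (Q × Q → Additive ℂˣ) where
  toFun f p := f p.2 - f (p.1 * p.2) + f p.1
  map_zero' := by ext; simp
  map_add' f f' := by
    funext p
    simp only [Pi.add_apply]
    abel

/-- `H²(Q; ℂ^*)`, written additively. -/
abbrev Cohomology (Q : Type*) [Group Q] : Type _ :=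
  cocycles Q ⧸ ((coboundaryMap Q).range.addSubgroupOf (cocycles Q))

/-- The class of a cocycle. -/
def cohomologyClass (c : cocycles Q) : Cohomology Q := QuotientAddGroup.mk c

/-- Pull-back of cocycles along a group homomorphism. -/
def cocyclesPullback (f : R →* Q) : cocycles Q →+ cocycles R where
  toFun c := ⟨fun p => c.1 (f p.1, f p.2), fun x y z => by
    have := c.2 (f x) (f y) (f z)
    simpa only [map_mul] using this⟩
  map_zero' := rfl
  map_add' _ _ := rfl

/-- The induced homomorphism `f^* : H²(Q; ℂ^*) → H²(R; ℂ^*)`. -/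
def pullback (f : R →* Q) : Cohomology Q →+ Cohomology R :=
  QuotientAddGroup.map _ _ (cocyclesPullback f) (by
    rintro ⟨c, hc⟩ ⟨u, hu⟩
    refine ⟨u ∘ f, ?_⟩
    funext p
    have h := congrFun hu (f p.1, f p.2)
    simpa [coboundaryMap, cocyclesPullback] using h)

/-- The boundary `∂[x|y] = [y] - [xy] + [x]`. -/
def bdry₂ (Q : Type*) [Group Q] : (Q × Q →₀ ℤ) →+ (Q →₀ ℤ) :=
  Finsupp.liftAddHom fun p => (zmultiplesHom _)
    (Finsupp.single p.2 1 - Finsupp.single (p.1 * p.2) 1 + Finsupp.single p.1 1)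

/-- The boundary `∂[x|y|z] = [y|z] - [xy|z] + [x|yz] - [x|y]`. -/
def bdry₃ (Q : Type*) [Group Q] : (Q × Q × Q →₀ ℤ) →+ (Q × Q →₀ ℤ) :=
  Finsupp.liftAddHom fun p => (zmultiplesHom _)
    (Finsupp.single (p.2.1, p.2.2) 1 - Finsupp.single (p.1 * p.2.1, p.2.2) 1
      + Finsupp.single (p.1, p.2.1 * p.2.2) 1 - Finsupp.single (p.1, p.2.1) 1)

/-- `H₂(Q; ℤ)`. -/
abbrev Homology (Q : Type*) [Group Q] : Type _ :=
  (bdry₂ Q).ker ⧸ ((bdry₃ Q).range.addSubgroupOf (bdry₂ Q).ker)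

/-- The class of a cycle. -/
def homologyClass (z : (bdry₂ Q).ker) : Homology Q := QuotientAddGroup.mk z

/-- Evaluation of a 2-cochain on a 2-chain: `∑ nᵢ [xᵢ|yᵢ] ↦ ∏ c(xᵢ,yᵢ)^{nᵢ}`,
written additively. -/
def evalChain (Q : Type*) : (Q × Q → Additive ℂˣ) →+ (Q × Q →₀ ℤ) →+ Additive ℂˣ where
  toFun c := Finsupp.liftAddHom fun p => (zmultiplesHom _) (c p)
  map_zero' := by ext; simp
  map_add' _ _ := by
    refine Finsupp.addHom_ext fun p n => ?_
    simp [zsmul_add]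

theorem evalChain_single {Q : Type*} (c : Q × Q → Additive ℂˣ) (p : Q × Q) (n : ℤ) :
    evalChain Q c (Finsupp.single p n) = n • c p := by
  simp [evalChain]

theorem evalChain_bdry₃ (c : cocycles Q) (w : Q × Q × Q →₀ ℤ) :
    evalChain Q c.1 (bdry₃ Q w) = 0 := by
  induction w using Finsupp.induction_linear with
  | zero => simp
  | add a b ha hb => rw [map_add, map_add, ha, hb, add_zero]
  | single p n =>
    have h := c.2 p.1 p.2.1 p.2.2
    simp only [bdry₃, Finsupp.liftAddHom_apply_single, zmultiplesHom_apply, map_zsmul, map_add,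
      map_sub, evalChain_single, one_smul]
    have h' : c.1 (p.2.1, p.2.2) - c.1 (p.1 * p.2.1, p.2.2) + c.1 (p.1, p.2.1 * p.2.2)
        - c.1 (p.1, p.2.1) = 0 := by
      rw [sub_add_eq_add_sub, h]; abel
    rw [h', smul_zero]

theorem evalChain_coboundary (u : Q → Additive ℂˣ) (z : Q × Q →₀ ℤ) :
    evalChain Q (coboundaryMap Q u) z
      = Finsupp.liftAddHom (fun x => (zmultiplesHom _) (u x)) (bdry₂ Q z) := by
  induction z using Finsupp.induction_linear with
  | zero => simp
  | add a b ha hb => rw [map_add, map_add, map_add, ha, hb]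
  | single p n =>
    rw [evalChain_single]
    simp only [bdry₂, Finsupp.liftAddHom_apply_single, zmultiplesHom_apply, map_zsmul, map_add,
      map_sub, one_smul]
    rfl

/-- The evaluation pairing `H²(Q; ℂ^*) × H₂(Q; ℤ) → ℂ^*`, written additively. -/
def pairing : Cohomology Q →+ Homology Q →+ Additive ℂˣ :=
  QuotientAddGroup.lift _
    { toFun := fun c => QuotientAddGroup.lift _
        ((evalChain Q c.1).comp (bdry₂ Q).ker.subtype) (by
          rintro ⟨z, hz⟩ ⟨w, hw⟩
          change evalChain Q c.1 z = 0
          have hw' : bdry₃ Q w = z := hw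
          rw [← hw', evalChain_bdry₃])
      map_zero' := by
        ext z
        simp
      map_add' := fun a b => by
        ext z
        simp }
    (by
      rintro ⟨c, hc⟩ ⟨u, hu⟩
      have hu' : coboundaryMap Q u = c := hu
      refine QuotientAddGroup.addMonoidHom_ext _ (AddMonoidHom.ext fun z => ?_)
      change evalChain Q c z.1 = 0
      rw [← hu', evalChain_coboundary, show bdry₂ Q z.1 = 0 from z.2, map_zero])

theorem pairing_mk (c : cocycles Q) (z : (bdry₂ Q).ker) :
    pairing (cohomologyClass c) (homologyClass z) = evalChain Q c.1 z.1 := rfl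

end GroupHomology

/-! ### Irreducible matrix representations and their obstruction classes -/

section Representations

/-- An irreducible representation `Γ → GL_n(ℂ)`, `n ≥ 1`. -/
structure IrrRep (Γ : Type*) [Group Γ] where
  dim : ℕ
  dim_pos : 0 < dim
  toHom : Γ →* GL (Fin dim) ℂ
  irreducible : ∀ V : Submodule ℂ (Fin dim → ℂ),
    (∀ h : Γ, ∀ v ∈ V, (toHom h).1.mulVec v ∈ V) → V = ⊥ ∨ V = ⊤

/-- `σ` and `ρ : Γ → GL_n(ℂ)` are equivalent: `σ(h) = M⁻¹ ρ(h) M` for some `M ∈ GL_n(ℂ)`. -/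
def MatEquiv {Γ : Type*} [Group Γ] {n : ℕ} (σ ρ : Γ →* GL (Fin n) ℂ) : Prop :=
  ∃ M : GL (Fin n) ℂ, ∀ h : Γ, σ h = M⁻¹ * ρ h * M

/-- Equivalence of irreducible representations, of possibly different dimensions. -/
def IrrRep.Equivalent {Γ : Type*} [Group Γ] (σ ρ : IrrRep Γ) : Prop :=
  ∃ e : σ.dim = ρ.dim, MatEquiv (e ▸ σ.toHom) ρ.toHom

theorem MatEquiv.refl {Γ : Type*} [Group Γ] {n : ℕ} (σ : Γ →* GL (Fin n) ℂ) : MatEquiv σ σ :=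
  ⟨1, fun h => by simp⟩

theorem MatEquiv.symm {Γ : Type*} [Group Γ] {n : ℕ} {σ ρ : Γ →* GL (Fin n) ℂ}
    (h : MatEquiv σ ρ) : MatEquiv ρ σ := by
  obtain ⟨M, hM⟩ := h
  exact ⟨M⁻¹, fun h => by rw [hM]; group⟩

theorem MatEquiv.trans {Γ : Type*} [Group Γ] {n : ℕ} {σ ρ τ : Γ →* GL (Fin n) ℂ}
    (h : MatEquiv σ ρ) (h' : MatEquiv ρ τ) : MatEquiv σ τ := by
  obtain ⟨M, hM⟩ := h
  obtain ⟨N, hN⟩ := h'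
  exact ⟨N * M, fun h => by rw [hM, hN]; group⟩

/-- Equivalence of irreducible representations as a setoid. -/
def irrSetoid (Γ : Type*) [Group Γ] : Setoid (IrrRep Γ) where
  r := IrrRep.Equivalent
  iseqv := by
    refine ⟨fun σ => ⟨rfl, MatEquiv.refl _⟩, ?_, ?_⟩
    · rintro ⟨n, hn, σ, hσ⟩ ⟨m, hm, ρ, hρ⟩ ⟨e, h⟩
      dsimp only at e
      subst e
      exact ⟨rfl, MatEquiv.symm h⟩
    · rintro ⟨n, hn, σ, hσ⟩ ⟨m, hm, ρ, hρ⟩ ⟨k, hk, τ, hτ⟩ ⟨e, h⟩ ⟨e', h'⟩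
      dsimp only at e e'
      subst e e'
      exact ⟨rfl, MatEquiv.trans h h'⟩

/-- `Irr(Γ)`: equivalence classes of irreducible complex representations. -/
def Irr (Γ : Type*) [Group Γ] : Type _ := Quotient (irrSetoid Γ)

/-- A representative of a class in `Irr(Γ)`. -/
def Irr.rep {Γ : Type*} [Group Γ] (c : Irr Γ) : IrrRep Γ := Quotient.out c

/-- Schur's lemma. -/
theorem schur {Γ : Type*} [Group Γ] (ρ : IrrRep Γ) (N : GL (Fin ρ.dim) ℂ)
    (hN : ∀ h, N * ρ.toHom h = ρ.toHom h * N) :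
    ∃ z : ℂˣ, N.1 = (z : ℂ) • (1 : Matrix (Fin ρ.dim) (Fin ρ.dim) ℂ) := by
  have : Nonempty (Fin ρ.dim) := ⟨⟨0, ρ.dim_pos⟩⟩
  obtain ⟨μ, hμ⟩ := Module.End.exists_eigenvalue (Matrix.toLin' N.1)
  have hV := ρ.irreducible (Module.End.eigenspace (Matrix.toLin' N.1) μ) (by
    intro h v hv
    rw [Module.End.mem_eigenspace_iff, Matrix.toLin'_apply] at hv ⊢
    have h1 : N.1 * (ρ.toHom h).1 = (ρ.toHom h).1 * N.1 := congrArg Units.val (hN h)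
    rw [Matrix.mulVec_mulVec, h1, ← Matrix.mulVec_mulVec, hv, Matrix.mulVec_smul])
  have htop := hV.resolve_left hμ
  have hNμ : N.1 = μ • (1 : Matrix (Fin ρ.dim) (Fin ρ.dim) ℂ) := by
    apply Matrix.toLin'.injective
    refine LinearMap.ext fun v => ?_
    have hv : v ∈ Module.End.eigenspace (Matrix.toLin' N.1) μ := by rw [htop]; trivial
    rw [Module.End.mem_eigenspace_iff] at hv
    rw [hv]
    simp
  have hμ0 : μ ≠ 0 := by
    rintro rfl
    rw [zero_smul] at hNμ
    exact N.ne_zero hNμ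
  exact ⟨Units.mk0 μ hμ0, hNμ⟩

variable {G G' : Type*} [Group G] [Group G']

/-- The representation `h ↦ ρ(x⁻¹ h x)` of `Γ = Ker q`, for `x ∈ G'`. -/
def twist (q : G' →* G) {n : ℕ} (ρ : q.ker →* GL (Fin n) ℂ) (x : G') :
    q.ker →* GL (Fin n) ℂ :=
  ρ.comp (MulAut.conjNormal (x⁻¹)).toMonoidHom

theorem twist_twist (q : G' →* G) {n : ℕ} (ρ : q.ker →* GL (Fin n) ℂ) (x y : G') :
    twist q (twist q ρ y) x = twist q ρ (x * y) := by
  ext h : 1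
  simp [twist, mul_inv_rev]

theorem MatEquiv.twist {q : G' →* G} {n : ℕ} {σ ρ : q.ker →* GL (Fin n) ℂ}
    (h : MatEquiv σ ρ) (x : G') : MatEquiv (twist q σ x) (twist q ρ x) := by
  obtain ⟨M, hM⟩ := h
  exact ⟨M, fun h => hM _⟩

/-- The stabilizer `G_ρ ⊆ G` of the equivalence class of `ρ`: all `α ∈ G` such that, for some
`x ∈ q⁻¹(α)`, the representation `h ↦ ρ(x⁻¹ h x)` is equivalent to `ρ`. -/
def stab (q : G' →* G) (ρ : IrrRep q.ker) : Subgroup G where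
  carrier := {α | ∃ x : G', q x = α ∧ MatEquiv (twist q ρ.toHom x) ρ.toHom}
  one_mem' := ⟨1, map_one q, 1, fun h => by simp [twist]⟩
  mul_mem' := by
    rintro α β ⟨x, rfl, hx⟩ ⟨y, rfl, hy⟩
    exact ⟨x * y, map_mul q x y, twist_twist q ρ.toHom x y ▸ (hy.twist x).trans hx⟩
  inv_mem' := by
    rintro α ⟨x, rfl, hx⟩
    refine ⟨x⁻¹, map_inv q x, ?_⟩
    have h := (hx.twist x⁻¹).symm
    rw [twist_twist, inv_mul_cancel] at h
    have h1 : twist q ρ.toHom 1 = ρ.toHom := by ext h : 1; simp [twist]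
    rwa [h1] at h

variable (q : G' →* G) (ρ : IrrRep q.ker)

/-- A choice of lifts `α̃ ∈ q⁻¹(α)`, `α ∈ G_ρ`. -/
def lift (α : stab q ρ) : G' := α.2.choose

theorem q_lift (α : stab q ρ) : q (lift q ρ α) = α := α.2.choose_spec.1

/-- A choice of matrices `M_α`, `α ∈ G_ρ`, with `ρ(α̃⁻¹ h α̃) = M_α⁻¹ ρ(h) M_α`. -/
def mat (α : stab q ρ) : GL (Fin ρ.dim) ℂ := α.2.choose_spec.2.choose

theorem mat_spec (α : stab q ρ) (h : q.ker) :
    ρ.toHom (MulAut.conjNormal (lift q ρ α)⁻¹ h)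
      = (mat q ρ α)⁻¹ * ρ.toHom h * mat q ρ α :=
  α.2.choose_spec.2.choose_spec h

/-- The element `(αβ)~⁻¹ α̃ β̃ ∈ Γ`. -/
def defect (α β : stab q ρ) : q.ker :=
  ⟨(lift q ρ (α * β))⁻¹ * lift q ρ α * lift q ρ β, by
    simp [MonoidHom.mem_ker, q_lift, mul_assoc]⟩

/-- There is `z ∈ ℂ^*` with `z M_α M_β = M_{αβ} ρ((αβ)~⁻¹ α̃ β̃)`. -/
theorem exists_obstruction (α β : stab q ρ) : ∃ z : ℂˣ,
    (z : ℂ) • (mat q ρ α * mat q ρ β).1 = (mat q ρ (α * β) * ρ.toHom (defect q ρ α β)).1 := by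
  set A := mat q ρ α
  set B := mat q ρ β
  set C := mat q ρ (α * β)
  set D := ρ.toHom (defect q ρ α β)
  have key : ∀ h, (A * B)⁻¹ * ρ.toHom h * (A * B) = (C * D)⁻¹ * ρ.toHom h * (C * D) := by
    intro h
    have e1 : (A * B)⁻¹ * ρ.toHom h * (A * B) = B⁻¹ * (A⁻¹ * ρ.toHom h * A) * B := by group
    have e2 : (C * D)⁻¹ * ρ.toHom h * (C * D) = D⁻¹ * (C⁻¹ * ρ.toHom h * C) * D := by group
    rw [e1, e2, ← mat_spec, ← mat_spec, ← mat_spec, ← map_inv, ← map_mul, ← map_mul]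
    congr 1
    ext
    simp [defect, mul_assoc]
  obtain ⟨z, hz⟩ := schur ρ (C * D * (A * B)⁻¹) (by
    intro h
    have := key h
    calc C * D * (A * B)⁻¹ * ρ.toHom h
        = C * D * ((A * B)⁻¹ * ρ.toHom h * (A * B)) * (A * B)⁻¹ := by group
      _ = C * D * ((C * D)⁻¹ * ρ.toHom h * (C * D)) * (A * B)⁻¹ := by rw [this]
      _ = ρ.toHom h * (C * D * (A * B)⁻¹) := by group)
  refine ⟨z, ?_⟩
  have : (C * D).1 = (C * D * (A * B)⁻¹).1 * (A * B).1 := by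
    rw [← Units.val_mul, inv_mul_cancel_right]
  rw [this, hz, Matrix.smul_mul, Matrix.one_mul]

/-- The number `ζ_{α,β} ∈ ℂ^*` with `ζ_{α,β} M_α M_β = M_{αβ} ρ((αβ)~⁻¹ α̃ β̃)`. -/
def zeta (α β : stab q ρ) : ℂˣ := (exists_obstruction q ρ α β).choose

theorem zeta_spec (α β : stab q ρ) :
    (zeta q ρ α β : ℂ) • ((mat q ρ α).1 * (mat q ρ β).1)
      = (mat q ρ (α * β)).1 * (ρ.toHom (defect q ρ α β)).1 :=
  (exists_obstruction q ρ α β).choose_spec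

theorem zeta_cocycle (α β γ : stab q ρ) :
    zeta q ρ β γ * zeta q ρ α (β * γ) = zeta q ρ (α * β) γ * zeta q ρ α β := by
  have hA := zeta_spec q ρ α β
  have hB := zeta_spec q ρ (α * β) γ
  have hC := zeta_spec q ρ β γ
  have hD := zeta_spec q ρ α (β * γ)
  -- moving `ρ(k)` past `M_γ`
  have hcomm : (ρ.toHom (defect q ρ α β)).1 * (mat q ρ γ).1
      = (mat q ρ γ).1 *
        (ρ.toHom (MulAut.conjNormal (lift q ρ γ)⁻¹ (defect q ρ α β))).1 := by
    rw [← Units.val_mul, ← Units.val_mul]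
    congr 1
    rw [mat_spec]
    group
  have hdef : defect q ρ (α * β) γ * MulAut.conjNormal (lift q ρ γ)⁻¹ (defect q ρ α β)
      = defect q ρ α (β * γ) * defect q ρ β γ := by
    ext
    simp [defect, mul_assoc]
  have hdef' : (ρ.toHom (defect q ρ (α * β) γ)).1 *
        (ρ.toHom (MulAut.conjNormal (lift q ρ γ)⁻¹ (defect q ρ α β))).1
      = (ρ.toHom (defect q ρ α (β * γ))).1 * (ρ.toHom (defect q ρ β γ)).1 := by
    rw [← Units.val_mul, ← Units.val_mul, ← map_mul, ← map_mul, hdef]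
  have h1 : ((zeta q ρ (α * β) γ : ℂ) * zeta q ρ α β) •
      ((mat q ρ α).1 * (mat q ρ β).1 * (mat q ρ γ).1)
      = (mat q ρ (α * β * γ)).1 * ((ρ.toHom (defect q ρ (α * β) γ)).1 *
        (ρ.toHom (MulAut.conjNormal (lift q ρ γ)⁻¹ (defect q ρ α β))).1) := by
    rw [mul_smul, ← Matrix.smul_mul, hA, Matrix.mul_assoc, hcomm, ← Matrix.mul_assoc,
      ← Matrix.smul_mul, hB, Matrix.mul_assoc]
  have h2 : ((zeta q ρ β γ : ℂ) * zeta q ρ α (β * γ)) •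
      ((mat q ρ α).1 * (mat q ρ β).1 * (mat q ρ γ).1)
      = (mat q ρ (α * β * γ)).1 * ((ρ.toHom (defect q ρ α (β * γ))).1 *
        (ρ.toHom (defect q ρ β γ)).1) := by
    rw [mul_comm, mul_smul, Matrix.mul_assoc, ← Matrix.mul_smul, hC, ← Matrix.mul_assoc,
      ← Matrix.smul_mul, hD, Matrix.mul_assoc, mul_assoc α β γ]
  rw [hdef'] at h1
  have h3 := h2.trans h1.symm
  have hne : (mat q ρ α).1 * (mat q ρ β).1 * (mat q ρ γ).1 ≠ 0 := by
    have : Nonempty (Fin ρ.dim) := ⟨⟨0, ρ.dim_pos⟩⟩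
    rw [← Units.val_mul, ← Units.val_mul]
    exact Units.ne_zero _
  exact Units.ext (by simpa using smul_left_injective ℂ hne h3)

/-- The class `ζ_ρ ∈ H²(G_ρ; ℂ^*)`. -/
def zetaClass : Cohomology (stab q ρ) :=
  cohomologyClass ⟨fun p => Additive.ofMul (zeta q ρ p.1 p.2), fun α β γ =>
    congrArg Additive.ofMul (zeta_cocycle q ρ α β γ)⟩

end Representations

/-! ### Closed oriented surfaces -/

section Surfaces

/-- Gluing data for a closed oriented surface. `T` indexes a set of triangles, copies of the
standard simplex `[v₀,v₁,v₂]`; `sgn t = ±1` compares the orientation of the surface on the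
triangle `t` with the one given by the order of the vertices. The `3·|T|` sides, the side `(t,i)`
being the one opposite to the vertex `i`, are matched in pairs. Matched sides are to be identified
by the order preserving affine map, and the condition `sgn_glue` says that they receive opposite
orientations from the oriented triangles, so that the signed sum of the triangles is a cycle.
As each side is glued to exactly one other side, the link of each vertex is a circle and the result
is a closed surface, oriented by the signed triangles. The triangles may have self-gluings and need
not be determined by their vertices. Conversely every triangulation of a closed oriented surface,
with the vertices listed in any order, is of this form. -/
structure OrientedGluing (T : Type*) where
  sgn : T → ℤˣ
  glue : T × Fin 3 → T × Fin 3
  glue_glue : ∀ s, glue (glue s) = s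
  sgn_glue : ∀ s, sgn (glue s).1 * (-1) ^ ((glue s).2 : ℕ) = -(sgn s.1 * (-1) ^ (s.2 : ℕ))

/-- The `i`-th face `Δ¹ → Δ²` of the standard triangle. -/
def face (i : Fin 3) : C(stdSimplex ℝ (Fin 2), stdSimplex ℝ (Fin 3)) :=
  ⟨stdSimplex.map (Fin.succAbove i), stdSimplex.continuous_map _⟩

namespace OrientedGluing

variable {T : Type*} (K : OrientedGluing T)

/-- Identification of points on matched sides. -/
def rel (a b : T × stdSimplex ℝ (Fin 3)) : Prop :=
  ∃ (s : T × Fin 3) (y : stdSimplex ℝ (Fin 2)),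
    a = (s.1, face s.2 y) ∧ b = ((K.glue s).1, face (K.glue s).2 y)

/-- The set of glued triangles (its topology is that of the quotient of `T × Δ²`, `T` discrete). -/
def Realization : Type _ := Quot K.rel

instance : TopologicalSpace K.Realization :=
  letI : TopologicalSpace T := ⊥
  inferInstanceAs (TopologicalSpace (Quot K.rel))

/-- The characteristic map of the triangle `t`. -/
def charMap (t : T) : C(stdSimplex ℝ (Fin 3), K.Realization) :=
  letI : TopologicalSpace T := ⊥
  ⟨fun x => Quot.mk _ (t, x), continuous_quot_mk.comp (by fun_prop)⟩

/-- Edges: sides of triangles up to gluing. -/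
def Edge : Type _ := Quot fun a b : T × Fin 3 => b = K.glue a

/-- Vertices: corners of triangles up to gluing. -/
def Vertex : Type _ := Quot fun a b : T × Fin 3 => ∃ (s : T × Fin 3) (k : Fin 2),
  a = (s.1, s.2.succAbove k) ∧ b = ((K.glue s).1, (K.glue s).2.succAbove k)

end OrientedGluing

/-- A closed oriented (triangulated) surface structure on a space `W`: a homeomorphism of `W` with
the space obtained from finitely many triangles by an oriented gluing. -/
structure ClosedOrientedSurface (W : Type*) [TopologicalSpace W] where
  T : Type
  [fintype : Fintype T]
  gluing : OrientedGluing T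
  homeo : gluing.Realization ≃ₜ W

attribute [instance] ClosedOrientedSurface.fintype

/-- The standard path from the vertex `0` to the vertex `1` in `Δ¹`. -/
def stdPath : Path (stdSimplex.vertex (S := ℝ) (0 : Fin 2)) (stdSimplex.vertex (1 : Fin 2)) where
  toFun := stdSimplexHomeomorphUnitInterval.symm
  continuous_toFun := stdSimplexHomeomorphUnitInterval.symm.continuous
  source' := by
    rw [Homeomorph.symm_apply_eq]; exact stdSimplexHomeomorphUnitInterval_zero.symm
  target' := by
    rw [Homeomorph.symm_apply_eq]; exact stdSimplexHomeomorphUnitInterval_one.symm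

section Chains

variable {W : Type*} [TopologicalSpace W] [PathConnectedSpace W] (w : W)

/-- The loop at `w` obtained from a path class from `x` to `y` by means of fixed paths `τ_x`, `τ_y`
from `w` to `x` and to `y`. It runs through `τ_y`, the inverse of the given path, and the inverse
of `τ_x`: the product `a * b` in Mathlib's fundamental group is the loop `b` followed by the loop
`a`, so that this makes the construction multiplicative. -/
def loop {x y : W} (p : Path.Homotopic.Quotient x y) : FundamentalGroup W w :=
  (FundamentalGroup.fromPath
    ((Path.Homotopic.Quotient.mk (PathConnectedSpace.somePath w x)).trans
      (p.trans (Path.Homotopic.Quotient.mk (PathConnectedSpace.somePath w y)).symm)))⁻¹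

/-- The element of `π₁(W, w)` attached to a singular 1-simplex. -/
def label (γ : C(stdSimplex ℝ (Fin 2), W)) : FundamentalGroup W w :=
  loop w (Path.Homotopic.Quotient.mk (stdPath.map γ.continuous))

theorem loop_cast {x y x' y' : W} (p : Path.Homotopic.Quotient x y) (hx : x' = x) (hy : y' = y) :
    loop w (p.cast hx hy) = loop w p := by
  subst hx hy
  simp

theorem loop_trans {x y z : W} (p : Path.Homotopic.Quotient x y)
    (r : Path.Homotopic.Quotient y z) : loop w (p.trans r) = loop w p * loop w r := by
  open CategoryTheory in
  have key : ∀ {a b c d : FundamentalGroupoid W} (f : a ⟶ b) (g : b ⟶ c) (h : c ⟶ d)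
      (k : a ⟶ c) (l : a ⟶ d),
      f ≫ (g ≫ h) ≫ Groupoid.inv l
        = (f ≫ g ≫ Groupoid.inv k) ≫ (k ≫ h ≫ Groupoid.inv l) := by
    intros; simp
  unfold loop
  rw [← mul_inv_rev]
  congr 1
  exact key (a := ⟨w⟩) (b := ⟨x⟩) (c := ⟨y⟩) (d := ⟨z⟩)
    (Path.Homotopic.Quotient.mk (PathConnectedSpace.somePath w x)) p r
    (Path.Homotopic.Quotient.mk (PathConnectedSpace.somePath w y))
    (Path.Homotopic.Quotient.mk (PathConnectedSpace.somePath w z))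

theorem label_face (σ : C(stdSimplex ℝ (Fin 3), W)) :
    label w (σ.comp (face 2)) * label w (σ.comp (face 0)) = label w (σ.comp (face 1)) := by
  have : ContractibleSpace (stdSimplex ℝ (Fin 3)) :=
    (convex_stdSimplex ℝ (Fin 3)).contractibleSpace ⟨_, single_mem_stdSimplex ℝ 0⟩
  -- the edge `i → j` of the standard triangle
  have h : ∀ (i j k : Fin 3) (hi : face k (stdSimplex.vertex 0) = stdSimplex.vertex i)
      (hj : face k (stdSimplex.vertex 1) = stdSimplex.vertex j),
      label w (σ.comp (face k)) = loop w (Path.Homotopic.Quotient.map (Path.Homotopic.Quotient.mk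
        ((stdPath.map (face k).continuous).cast hi.symm hj.symm)) σ) := by
    intro i j k hi hj
    exact (loop_cast w (Path.Homotopic.Quotient.mk
      (stdPath.map (σ.comp (face k)).continuous))
      (congrArg σ hi.symm) (congrArg σ hj.symm)).symm
  have v : ∀ (i j : Fin 3) (k : Fin 3) (m : Fin 2), k.succAbove m = i →
      face k (stdSimplex.vertex m) = stdSimplex.vertex i := by
    rintro i - k m rfl
    exact stdSimplex.map_vertex _ _
  rw [h 0 1 2 (v 0 0 2 0 rfl) (v 1 0 2 1 rfl), h 1 2 0 (v 1 0 0 0 rfl) (v 2 0 0 1 rfl),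
    h 0 2 1 (v 0 0 1 0 rfl) (v 2 0 1 1 rfl), ← loop_trans]
  congr 1
  rw [← Path.Homotopic.Quotient.mk_map, ← Path.Homotopic.Quotient.mk_map,
    ← Path.Homotopic.Quotient.mk_map, ← Path.Homotopic.Quotient.mk_trans, ← Path.map_trans,
    Path.Homotopic.Quotient.mk_map, Path.Homotopic.Quotient.mk_map]
  congr 1
  exact Subsingleton.elim _ _

/-- The bar 2-chain `[ℓ₀₁|ℓ₁₂]` on `π₁(W, w)` attached to a singular 2-simplex of `W`, where
`ℓᵢⱼ` is the element attached to its edge from the vertex `i` to the vertex `j`. This is the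
standard chain map that induces `H₂(W) → H₂(π₁(W, w))`. -/
def barCell (σ : C(stdSimplex ℝ (Fin 3), W)) :
    FundamentalGroup W w × FundamentalGroup W w →₀ ℤ :=
  Finsupp.single (label w (σ.comp (face 2)), label w (σ.comp (face 0))) 1

theorem bdry₂_barCell (σ : C(stdSimplex ℝ (Fin 3), W)) :
    bdry₂ _ (barCell w σ)
      = ∑ i : Fin 3, ((-1 : ℤ) ^ (i : ℕ)) •
          Finsupp.single (label w (σ.comp (face i))) (1 : ℤ) := by
  simp only [bdry₂, barCell, Finsupp.liftAddHom_apply_single, zmultiplesHom_apply, label_face,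
    Fin.sum_univ_three, one_smul]
  simp [sub_eq_add_neg]

end Chains

namespace ClosedOrientedSurface

variable {W : Type*} [TopologicalSpace W] (S : ClosedOrientedSurface W)

/-- The Euler characteristic `χ(W)`: vertices minus edges plus triangles. -/
def eulerChar : ℤ :=
  (Nat.card S.gluing.Vertex : ℤ) - Nat.card S.gluing.Edge + Fintype.card S.T

/-- The genus of a connected closed oriented surface, determined by `χ = 2 - 2 * genus`. -/
def genus : ℤ := (2 - S.eulerChar) / 2

/-- The triangle `t`, as a singular simplex of `W`. -/
def simplex (t : S.T) : C(stdSimplex ℝ (Fin 3), W) :=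
  (S.homeo : C(S.gluing.Realization, W)).comp (S.gluing.charMap t)

theorem simplex_face (s : S.T × Fin 3) :
    (S.simplex (S.gluing.glue s).1).comp (face (S.gluing.glue s).2)
      = (S.simplex s.1).comp (face s.2) := by
  ext y
  exact congrArg S.homeo (Quot.sound ⟨s, y, rfl, rfl⟩).symm

/-- A connected surface is path connected. -/
theorem pathConnectedSpace (S : ClosedOrientedSurface W) [ConnectedSpace W] :
    PathConnectedSpace W := by
  let _ : TopologicalSpace S.T := ⊥
  have : DiscreteTopology S.T := ⟨rfl⟩
  have hq : Topology.IsQuotientMap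
      (fun a : S.T × stdSimplex ℝ (Fin 3) => S.simplex a.1 a.2) :=
    S.homeo.isQuotientMap.comp isQuotientMap_quot_mk
  have hsurj : ∀ x : W, ∃ t y, S.simplex t y = x := fun x => by
    obtain ⟨⟨t, y⟩, h⟩ := hq.surjective x
    exact ⟨t, y, h⟩
  have hj : ∀ t y y', Joined (S.simplex t y) (S.simplex t y') := fun t y y' =>
    ⟨(PathConnectedSpace.somePath y y').map (S.simplex t).continuous⟩
  have hopen : ∀ x : W, IsOpen (pathComponent x) := by
    intro x
    rw [← hq.isOpen_preimage]
    have : (fun a : S.T × stdSimplex ℝ (Fin 3) => S.simplex a.1 a.2) ⁻¹' pathComponent x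
        = {t | ∃ y, Joined x (S.simplex t y)} ×ˢ Set.univ := by
      ext ⟨t, y⟩
      constructor
      · intro h
        exact ⟨⟨y, h⟩, trivial⟩
      · rintro ⟨⟨y', h⟩, -⟩
        exact Joined.trans h (hj t y' y)
    rw [this]
    exact (isOpen_discrete _).prod isOpen_univ
  have hclosed : ∀ x : W, IsClosed (pathComponent x) := by
    intro x
    rw [← isOpen_compl_iff, isOpen_iff_forall_mem_open]
    intro y hy
    refine ⟨pathComponent y, ?_, hopen y, mem_pathComponent_self y⟩
    intro z hz hz'
    exact hy (Joined.trans hz' (Joined.symm hz))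
  obtain ⟨x⟩ := (inferInstance : Nonempty W)
  refine ⟨⟨x⟩, fun y z => ?_⟩
  have hu : ∀ z, Joined x z := fun z => by
    have : pathComponent x = Set.univ :=
      IsClopen.eq_univ ⟨hclosed x, hopen x⟩ ⟨x, mem_pathComponent_self x⟩
    have hz : z ∈ pathComponent x := this ▸ Set.mem_univ z
    exact hz
  exact (hu y).symm.trans (hu z)

section FundamentalClass

variable [ConnectedSpace W] (w : W)

/-- The image in the bar complex of `π₁(W, w)` of the signed sum of the triangles. -/
def fundamentalChain : FundamentalGroup W w × FundamentalGroup W w →₀ ℤ :=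
  have := S.pathConnectedSpace
  ∑ t : S.T, (S.gluing.sgn t : ℤ) • barCell w (S.simplex t)

theorem bdry₂_fundamentalChain : bdry₂ _ (S.fundamentalChain w) = 0 := by
  have := S.pathConnectedSpace
  have h : bdry₂ _ (S.fundamentalChain w) = ∑ s : S.T × Fin 3,
      ((S.gluing.sgn s.1 : ℤ) * (-1) ^ (s.2 : ℕ)) •
        Finsupp.single (label w ((S.simplex s.1).comp (face s.2))) (1 : ℤ) := by
    rw [fundamentalChain, map_sum, Fintype.sum_prod_type]
    refine Finset.sum_congr rfl fun t _ => ?_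
    rw [map_zsmul, bdry₂_barCell, Finset.smul_sum]
    refine Finset.sum_congr rfl fun i _ => ?_
    rw [mul_smul]
  rw [h]
  have hs : ∀ s : S.T × Fin 3,
      ((S.gluing.sgn (S.gluing.glue s).1 : ℤ) * (-1) ^ ((S.gluing.glue s).2 : ℕ))
        = -((S.gluing.sgn s.1 : ℤ) * (-1) ^ (s.2 : ℕ)) := by
    intro s
    have := congrArg (Units.val) (S.gluing.sgn_glue s)
    push_cast at this
    exact this
  have hne : ∀ s : S.T × Fin 3, (S.gluing.sgn s.1 : ℤ) * (-1) ^ (s.2 : ℕ) ≠ 0 := fun s =>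
    mul_ne_zero (Units.ne_zero _) (pow_ne_zero _ (by norm_num))
  refine Finset.sum_involution (fun s _ => S.gluing.glue s) ?_ ?_ ?_ ?_
  · intro s _
    rw [simplex_face, hs, ← add_smul, add_neg_cancel, zero_smul]
  · intro s _ _ heq
    have h1 := hs s
    rw [heq] at h1
    exact hne s (by linarith)
  · intro s _
    exact Finset.mem_univ _
  · intro s _
    exact S.gluing.glue_glue s

/-- The fundamental class `[W] ∈ H₂(W) = H₂(π)`, `π = π₁(W, w)`. -/
def fundamentalClass : Homology (FundamentalGroup W w) :=
  homologyClass ⟨S.fundamentalChain w, S.bdry₂_fundamentalChain w⟩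

end FundamentalClass

end ClosedOrientedSurface

end Surfaces

/-! ### Lifts -/

/-- `Hom_g(π, G')`: homomorphisms `g' : π → G'` with `q g' = g`. -/
def Lifts {π G G' : Type*} [Group π] [Group G] [Group G'] (q : G' →* G) (g : π →* G) : Type _ :=
  {g' : π →* G' // q.comp g' = g}

/-- For `g(π) ⊆ G_ρ`, the number `g^*(ζ_ρ)(z) ∈ ℂ^*` for `z ∈ H₂(π; ℤ)`. -/
def zetaEval {π G G' : Type*} [Group π] [Group G] [Group G'] (q : G' →* G) (g : π →* G)
    (ρ : IrrRep q.ker) (hρ : g.range ≤ stab q ρ) (z : Homology π) : ℂˣ :=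
  Additive.toMul
    (pairing (pullback (g.codRestrict (stab q ρ) fun x => hρ ⟨x, rfl⟩) (zetaClass q ρ)) z)

end LiftCount

end

noncomputable section
namespace LiftCount

open Topology

/-! ### Stars of points in a glued surface -/

/-! The count is a state sum on the triangulated surface. Write Γ for the kernel of `q`, and V, E, T
for the numbers of vertices, edges and triangles. Each side of a triangle carries an element of π,
and `g` turns these into a labeling of the sides by elements of G. It is flat: labels agree on glued
sides and multiply correctly around each triangle. The proof compares lifts of `g` with flat lifts
of this labeling to G', then counts flat lifts by the representation theory of Γ.

Topology enters through two facts. By `exists_fixed_of_corners`, data at the corners that is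
transported correctly along the edges comes from a single element fixed by π; this rests on the
contractible stars of points in the surface. By `exists_hom_of_isFlat`, a flat labeling is gauge
equivalent to the labeling of a homomorphism, namely the monodromy of a covering glued from copies
of the triangles. Together they give `gaugeLabel_bijective`: a lift and a Γ-valued function on the
vertices amount to a flat lift and one element of Γ. Hence |Lifts| |Γ|^V = |FlatLifts| |Γ|.

For the algebra, let G' act projectively by matrices P(x), with inverses Q(x), on the sum of all
irreducible representations of Γ. The action extends that of Γ and permutes the summands as G
permutes their classes. On a summand fixed by both factors, the scalar by which P(xy) differs from
P(x)P(y) is exactly ζ (`scalar_eq_zeta`). The regular character expresses |Γ| times the indicator of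
flatness on a triangle as a sum, over colorings of its corners by basis vectors, of products of
entries of P and Q on its sides (`sum_triangle`).

Glued sides have opposite signs, so each edge contributes one entry of P and one of Q at the same
element. Summing over the coset of possible labels, Schur orthogonality (`sum_P_mul_Q`) gives
|Γ|/dim, forces the colors to match across the edge, and forces the label to carry one class to the
other. By the first topological fact only constant classes ρ fixed by g(π) survive, with one free
basis vector at each vertex. Such a ρ contributes dim^V · dim^T · (|Γ|/dim)^E times the product of
the values ζ^{±1} on the triangles, which is the evaluation on [W]. Collecting powers gives the
exponent -χ(W). -/

theorem face_self (i : Fin 3) (z : stdSimplex ℝ (Fin 2)) : face i z i = 0 := by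
  change FunOnFinite.linearMap ℝ ℝ (Fin.succAbove i) z i = 0
  rw [FunOnFinite.linearMap_apply_apply]
  exact Finset.sum_eq_zero fun k hk => absurd (Finset.mem_filter.1 hk).2 (Fin.succAbove_ne i k)

theorem face_succAbove (i : Fin 3) (z : stdSimplex ℝ (Fin 2)) (k : Fin 2) :
    face i z (i.succAbove k) = z k := by
  change FunOnFinite.linearMap ℝ ℝ (Fin.succAbove i) z (i.succAbove k) = z k
  rw [FunOnFinite.linearMap_apply_apply]
  simp [Finset.filter_eq']

theorem exists_face_eq {y : stdSimplex ℝ (Fin 3)} {i : Fin 3} (h : y i = 0) :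
    ∃ z, face i z = y := by
  refine ⟨⟨fun k => y (i.succAbove k), fun k => y.2.1 _, ?_⟩, ?_⟩
  · have := y.2.2
    rw [Fin.sum_univ_succAbove _ i] at this
    change y i + _ = 1 at this
    rw [h, zero_add] at this
    exact this
  · refine stdSimplex.ext (funext fun j => ?_)
    rcases Fin.eq_self_or_eq_succAbove i j with rfl | ⟨k, rfl⟩
    · rw [face_self, h]
    · rw [face_succAbove]; rfl

/-- The point dividing the segment from `x` to `y` in the ratio `l : 1 - l`. -/
def segmentPoint {n : ℕ} (x y : stdSimplex ℝ (Fin n)) (l : unitInterval) : stdSimplex ℝ (Fin n) :=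
  ⟨(1 - (l : ℝ)) • x.1 + (l : ℝ) • y.1,
    convex_stdSimplex ℝ _ x.2 y.2 (sub_nonneg.2 l.2.2) l.2.1 (by ring)⟩

theorem segmentPoint_apply {n : ℕ} (x y : stdSimplex ℝ (Fin n)) (l : unitInterval) (i : Fin n) :
    segmentPoint x y l i = (1 - (l : ℝ)) * x i + (l : ℝ) * y i := rfl

theorem segmentPoint_zero {n : ℕ} (x y : stdSimplex ℝ (Fin n)) : segmentPoint x y 0 = x :=
  stdSimplex.ext (funext fun i => by simp [segmentPoint_apply])

theorem segmentPoint_one {n : ℕ} (x y : stdSimplex ℝ (Fin n)) : segmentPoint x y 1 = y :=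
  stdSimplex.ext (funext fun i => by simp [segmentPoint_apply])

theorem segmentPoint_self {n : ℕ} (x : stdSimplex ℝ (Fin n)) (l : unitInterval) :
    segmentPoint x x l = x :=
  stdSimplex.ext (funext fun i => by rw [segmentPoint_apply]; ring)

theorem continuous_segmentPoint {n : ℕ} (x : stdSimplex ℝ (Fin n)) :
    Continuous fun p : stdSimplex ℝ (Fin n) × unitInterval => segmentPoint x p.1 p.2 := by
  unfold segmentPoint
  fun_prop

theorem face_segmentPoint (i : Fin 3) (z z' : stdSimplex ℝ (Fin 2)) (l : unitInterval) :
    face i (segmentPoint z z' l) = segmentPoint (face i z) (face i z') l := by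
  refine stdSimplex.ext (funext fun j => ?_)
  rcases Fin.eq_self_or_eq_succAbove i j with rfl | ⟨k, rfl⟩
  · simp [segmentPoint_apply, face_self]
  · simp [segmentPoint_apply, face_succAbove]

/-- Coordinatewise `ε`-closeness. -/
def Near (ε : ℝ) (x y : stdSimplex ℝ (Fin 3)) : Prop := ∀ i, |x i - y i| < ε

theorem isOpen_near (ε : ℝ) (y : stdSimplex ℝ (Fin 3)) : IsOpen {x | Near ε x y} := by
  have : {x | Near ε x y} = ⋂ i, {x : stdSimplex ℝ (Fin 3) | |x i - y i| < ε} := by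
    ext; simp [Near]
  rw [this]
  refine isOpen_iInter_of_finite fun i => isOpen_lt ?_ continuous_const
  have : Continuous fun x : stdSimplex ℝ (Fin 3) => x i :=
    (continuous_apply i).comp continuous_subtype_val
  exact (this.sub continuous_const).abs

/-- The coordinates of a point of the triangle, together with `0`. -/
def coordValues (y : stdSimplex ℝ (Fin 3)) : Set ℝ := insert 0 (Set.range y)

theorem coordValues_face (i : Fin 3) (z : stdSimplex ℝ (Fin 2)) :
    coordValues (face i z) = insert 0 (Set.range z) := by
  ext u
  simp only [coordValues, Set.mem_insert_iff, Set.mem_range]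
  constructor
  · rintro (h | ⟨j, rfl⟩)
    · exact Or.inl h
    · rcases Fin.eq_self_or_eq_succAbove i j with rfl | ⟨k, rfl⟩
      · exact Or.inl (face_self _ _)
      · exact Or.inr ⟨k, (face_succAbove _ _ _).symm⟩
  · rintro (h | ⟨k, rfl⟩)
    · exact Or.inl h
    · exact Or.inr ⟨i.succAbove k, face_succAbove _ _ _⟩

/-- Distinct coordinates of `y`, and nonzero ones and `0`, are at least `2ε` apart. -/
def IsScale (y : stdSimplex ℝ (Fin 3)) (ε : ℝ) : Prop :=
  0 < ε ∧ ∀ u ∈ coordValues y, ∀ v ∈ coordValues y, u ≠ v → 2 * ε ≤ |u - v|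

theorem exists_isScale (y : stdSimplex ℝ (Fin 3)) : ∃ ε, IsScale y ε := by
  have hf : (coordValues y ×ˢ coordValues y).Finite :=
    ((Set.finite_range y).insert 0).prod ((Set.finite_range y).insert 0)
  have : ∀ s : Finset (ℝ × ℝ), ∃ ε : ℝ, 0 < ε ∧ ∀ p ∈ s, p.1 ≠ p.2 → 2 * ε ≤ |p.1 - p.2| := by
    intro s
    induction s using Finset.induction_on with
    | empty => exact ⟨1, one_pos, by simp⟩
    | insert p s _ ih =>
      obtain ⟨ε, h0, h⟩ := ih
      by_cases hp : p.1 = p.2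
      · refine ⟨ε, h0, fun r hr hne => ?_⟩
        rcases Finset.mem_insert.1 hr with rfl | hr
        · exact absurd hp hne
        · exact h r hr hne
      · have hpos : 0 < |p.1 - p.2| := abs_pos.2 (sub_ne_zero.2 hp)
        refine ⟨min ε (|p.1 - p.2| / 2), lt_min h0 (half_pos hpos), fun r hr hne => ?_⟩
        rcases Finset.mem_insert.1 hr with rfl | hr
        · linarith [min_le_right ε (|r.1 - r.2| / 2)]
        · linarith [min_le_left ε (|p.1 - p.2| / 2), h r hr hne]
  obtain ⟨ε, h0, h⟩ := this hf.toFinset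
  exact ⟨ε, h0, fun u hu v hv hne => h (u, v) (hf.mem_toFinset.2 ⟨hu, hv⟩) hne⟩

namespace OrientedGluing

variable {T : Type*} (K : OrientedGluing T)

theorem rel_symm {a b : T × stdSimplex ℝ (Fin 3)} (h : K.rel a b) : K.rel b a := by
  obtain ⟨s, y, rfl, rfl⟩ := h
  exact ⟨K.glue s, y, rfl, by rw [K.glue_glue]⟩

/-- The point of the glued surface represented by a point of a triangle. -/
def point (a : T × stdSimplex ℝ (Fin 3)) : K.Realization := Quot.mk _ a

theorem point_surjective : Function.Surjective K.point := Quot.mk_surjective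

theorem point_eq_iff {a b : T × stdSimplex ℝ (Fin 3)} :
    K.point a = K.point b ↔ Relation.EqvGen K.rel a b := Quot.eq

/-- Face inclusions only insert a zero coordinate, so the set of coordinate values is an invariant
of the glued point. One scale ε therefore serves all its representatives. -/
theorem coordValues_eq {a b : T × stdSimplex ℝ (Fin 3)} (h : Relation.EqvGen K.rel a b) :
    coordValues a.2 = coordValues b.2 := by
  induction h with
  | rel a b h =>
    obtain ⟨s, y, rfl, rfl⟩ := h
    simp only [coordValues_face]
  | refl => rfl
  | symm _ _ _ h => exact h.symm
  | trans _ _ _ _ _ h h' => exact h.trans h'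

/-- The points of the triangles that are `ε`-close to a point representing `a₀`. -/
def star (a₀ : T × stdSimplex ℝ (Fin 3)) (ε : ℝ) : Set (T × stdSimplex ℝ (Fin 3)) :=
  {a | ∃ y, Relation.EqvGen K.rel a₀ (a.1, y) ∧ Near ε a.2 y}

variable {K} {a₀ : T × stdSimplex ℝ (Fin 3)} {ε : ℝ}

theorem mem_star_self (hε : 0 < ε) : a₀ ∈ K.star a₀ ε :=
  ⟨a₀.2, Relation.EqvGen.refl _, fun i => by simpa using hε⟩

/-- The point representing `a₀` in a given triangle and close to a given point is unique. -/
theorem near_unique (hε : IsScale a₀.2 ε) {t : T} {x y y' : stdSimplex ℝ (Fin 3)}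
    (hy : Relation.EqvGen K.rel a₀ (t, y)) (hy' : Relation.EqvGen K.rel a₀ (t, y'))
    (hx : Near ε x y) (hx' : Near ε x y') : y = y' := by
  refine stdSimplex.ext (funext fun i => ?_)
  by_contra hne
  have h := hε.2 (y i) (K.coordValues_eq hy ▸ Or.inr ⟨i, rfl⟩) (y' i)
    (K.coordValues_eq hy' ▸ Or.inr ⟨i, rfl⟩) hne
  have h1 := abs_lt.1 (hx i)
  have h2 := abs_lt.1 (hx' i)
  rcases le_abs.1 h with h | h <;> linarith

/-- A point of a side that is close to y forces the corresponding coordinate of y below ε, hence to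
be 0 by the choice of scale. So y and the whole segment lie on that side and are carried along by
the gluing. -/
theorem star_step (hε : IsScale a₀.2 ε) {a a' : T × stdSimplex ℝ (Fin 3)} (h : K.rel a a')
    {y : stdSimplex ℝ (Fin 3)} (hy : Relation.EqvGen K.rel a₀ (a.1, y)) (hn : Near ε a.2 y) :
    ∃ y', Relation.EqvGen K.rel a₀ (a'.1, y') ∧ Near ε a'.2 y' ∧
      ∀ l, K.rel (a.1, segmentPoint y a.2 l) (a'.1, segmentPoint y' a'.2 l) := by
  obtain ⟨s, z, rfl, rfl⟩ := h
  have hys : y s.2 = 0 := by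
    by_contra hne
    have h := hε.2 (y s.2) (K.coordValues_eq hy ▸ Or.inr ⟨s.2, rfl⟩) 0 (Or.inl rfl) hne
    have h1 := hn s.2
    rw [face_self, zero_sub, abs_neg] at h1
    rw [sub_zero] at h
    linarith [hε.1]
  obtain ⟨z', rfl⟩ := exists_face_eq hys
  refine ⟨face (K.glue s).2 z', hy.trans _ _ _ (Relation.EqvGen.rel _ _ ⟨s, z', rfl, rfl⟩), ?_, ?_⟩
  · intro j
    rcases Fin.eq_self_or_eq_succAbove (K.glue s).2 j with rfl | ⟨k, rfl⟩
    · simpa [face_self] using hε.1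
    · have := hn (s.2.succAbove k)
      rw [face_succAbove, face_succAbove] at this
      rwa [face_succAbove, face_succAbove]
  · intro l
    exact ⟨s, segmentPoint z' z l, by rw [face_segmentPoint], by rw [face_segmentPoint]⟩

theorem mem_star_iff (hε : IsScale a₀.2 ε) {a a' : T × stdSimplex ℝ (Fin 3)}
    (h : Relation.EqvGen K.rel a a') : a ∈ K.star a₀ ε ↔ a' ∈ K.star a₀ ε := by
  have key : ∀ {a a'}, K.rel a a' → a ∈ K.star a₀ ε → a' ∈ K.star a₀ ε := by
    rintro a a' h ⟨y, hy, hn⟩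
    obtain ⟨y', hy', hn', -⟩ := star_step hε h hy hn
    exact ⟨y', hy', hn'⟩
  induction h with
  | rel a b h => exact ⟨key h, key (K.rel_symm h)⟩
  | refl => rfl
  | symm _ _ _ h => exact h.symm
  | trans _ _ _ _ _ h h' => exact h.trans h'

theorem preimage_image_star (hε : IsScale a₀.2 ε) :
    K.point ⁻¹' (K.point '' K.star a₀ ε) = K.star a₀ ε := by
  refine Set.Subset.antisymm ?_ (Set.subset_preimage_image _ _)
  rintro a ⟨b, hb, h⟩
  exact (mem_star_iff hε (K.point_eq_iff.1 h)).1 hb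

theorem isQuotientMap_point [TopologicalSpace T] [DiscreteTopology T] (K : OrientedGluing T) :
    IsQuotientMap K.point := by
  obtain rfl : ‹TopologicalSpace T› = ⊥ := DiscreteTopology.eq_bot
  let _ : TopologicalSpace T := ⊥
  exact isQuotientMap_quot_mk

theorem isOpen_star [TopologicalSpace T] [DiscreteTopology T] (K : OrientedGluing T)
    (a₀ : T × stdSimplex ℝ (Fin 3)) (ε : ℝ) : IsOpen (K.star a₀ ε) := by
  have : K.star a₀ ε = ⋃ (p : T × stdSimplex ℝ (Fin 3)) (_ : Relation.EqvGen K.rel a₀ p),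
      {p.1} ×ˢ {x | Near ε x p.2} := by
    ext ⟨t, x⟩
    simp only [star, Set.mem_ofPred_eq, Set.mem_iUnion, Set.mem_prod, Set.mem_singleton_iff]
    constructor
    · rintro ⟨y, hy, hn⟩
      exact ⟨(t, y), hy, rfl, hn⟩
    · rintro ⟨⟨t', y⟩, hy, rfl, hn⟩
      exact ⟨y, hy, hn⟩
  rw [this]
  exact isOpen_iUnion fun p => isOpen_iUnion fun _ =>
    (isOpen_discrete _).prod (isOpen_near ε p.2)

theorem isOpen_image_star (hε : IsScale a₀.2 ε) : IsOpen (K.point '' K.star a₀ ε) := by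
  let _ : TopologicalSpace T := ⊥
  have : DiscreteTopology T := ⟨rfl⟩
  rw [← K.isQuotientMap_point.isOpen_preimage, preimage_image_star hε]
  exact K.isOpen_star a₀ ε

end OrientedGluing
end LiftCount
end

noncomputable section
namespace LiftCount

open Topology unitInterval

/-! ### Local systems over a glued surface are determined by their edges -/

section Loops

variable {W : Type*} [TopologicalSpace W] [PathConnectedSpace W] (w : W)

theorem loop_refl (x : W) : loop w (Path.Homotopic.Quotient.refl x) = 1 := by
  have h := loop_trans w (Path.Homotopic.Quotient.refl x) (Path.Homotopic.Quotient.refl x)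
  rw [Path.Homotopic.Quotient.refl_trans] at h
  exact (mul_eq_left.1 h.symm)

/-- Every element of `π₁(W, w)` comes from a loop at a given point. -/
theorem exists_loop_eq (x : W) (a : FundamentalGroup W w) :
    ∃ p : Path.Homotopic.Quotient x x, loop w p = a := by
  let τ := Path.Homotopic.Quotient.mk (PathConnectedSpace.somePath w x)
  refine ⟨τ.symm.trans ((FundamentalGroup.toPath a⁻¹).trans τ), ?_⟩
  have key : τ.trans ((τ.symm.trans ((FundamentalGroup.toPath a⁻¹).trans τ)).trans τ.symm)
      = FundamentalGroup.toPath a⁻¹ := by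
    simp only [Path.Homotopic.Quotient.trans_assoc, Path.Homotopic.Quotient.trans_symm,
      Path.Homotopic.Quotient.trans_refl]
    rw [← Path.Homotopic.Quotient.trans_assoc, Path.Homotopic.Quotient.trans_symm,
      Path.Homotopic.Quotient.refl_trans]
  have : loop w (τ.symm.trans ((FundamentalGroup.toPath a⁻¹).trans τ)) = (a⁻¹)⁻¹ :=
    congrArg (fun b : FundamentalGroup W w => b⁻¹) key
  rw [this, inv_inv]

variable {w} {X : Type*}

/-- A function compatible with transport along short paths is compatible with transport along
all paths. -/
theorem transport_of_local (θ : FundamentalGroup W w →* Equiv.Perm X) (κ : W → X)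
    (h : ∀ p : W, ∃ U ∈ 𝓝 p, ∀ (p' : W) (γ : Path p p'), Set.range γ ⊆ U →
      κ p = θ (loop w (Path.Homotopic.Quotient.mk γ)) (κ p'))
    {x y : W} (p : Path.Homotopic.Quotient x y) : κ x = θ (loop w p) (κ y) := by
  induction p using Path.Homotopic.Quotient.ind with | mk γ => ?_
  -- Value at the moving point of the path, transported back to x. It is locally constant in t, and
  -- its values at the two ends are the two sides of the claim.
  let D : I → X := fun t => θ (loop w (Path.Homotopic.Quotient.mk (γ.subpath 0 t))) (κ (γ t))
  have hD : IsLocallyConstant D := by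
    rw [IsLocallyConstant.iff_eventually_eq]
    intro t₀
    obtain ⟨U, hU, hUγ⟩ := h (γ t₀)
    have hmem : γ ⁻¹' U ∈ 𝓝 t₀ := γ.continuous.continuousAt hU
    have hev : ∀ᶠ t in 𝓝 t₀, Set.uIcc t₀ t ⊆ γ ⁻¹' U := by
      have := (tendsto_const_nhds (x := t₀)).uIcc (Filter.tendsto_id (x := 𝓝 t₀))
      exact this.eventually (Filter.eventually_smallSets.2 ⟨_, hmem, fun _ h => h⟩)
    filter_upwards [hev] with t ht
    have h1 := hUγ (γ t) (γ.subpath t₀ t) (by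
      rw [Path.range_subpath]; exact Set.image_subset_iff.2 ht)
    have h2 : Path.Homotopic.Quotient.mk (γ.subpath 0 t)
        = (Path.Homotopic.Quotient.mk (γ.subpath 0 t₀)).trans
          (Path.Homotopic.Quotient.mk (γ.subpath t₀ t)) := by
      rw [← Path.Homotopic.Quotient.mk_trans]
      exact (Path.Homotopic.Quotient.eq.2 ⟨Path.Homotopy.subpathTransSubpath γ 0 t₀ t⟩).symm
    simp only [D]
    rw [h2, loop_trans, map_mul, Equiv.Perm.mul_apply, ← h1]
  have h01 : D 0 = D 1 := hD.apply_eq_of_isPreconnected isPreconnected_univ trivial trivial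
  have e0 : D 0 = κ x := by
    simp only [D]
    rw [Path.subpath_self, Path.Homotopic.Quotient.mk_refl, loop_refl, map_one, γ.source]
    rfl
  have e1 : D 1 = θ (loop w (Path.Homotopic.Quotient.mk γ)) (κ y) := by
    simp only [D]
    rw [Path.subpath_zero_one, Path.Homotopic.Quotient.mk_cast, loop_cast, γ.target]
  rw [← e0, h01, e1]

end Loops

/-- If `F` contracts `U` to `p` relative to `p`, then any path in `U` starting at `p` is homotopic
to the path described by its end point under the contraction. -/
theorem homotopic_of_contraction {W : Type*} [TopologicalSpace W] {U : Set W} {p p' : W}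
    (F : U × I → W) (hF : Continuous F) (h0 : ∀ u, F (u, 0) = p) (h1 : ∀ u, F (u, 1) = u)
    (hp : ∀ (hp : p ∈ U) l, F (⟨p, hp⟩, l) = p) (γ : Path p p') (hγ : Set.range γ ⊆ U)
    (η : Path p p') (hη : ∀ (h : p' ∈ U) l, η l = F (⟨p', h⟩, l)) : γ.Homotopic η := by
  have hγ' : ∀ t, γ t ∈ U := fun t => hγ ⟨t, rfl⟩
  have hpU : p ∈ U := γ.source ▸ hγ' 0
  have hpU' : p' ∈ U := γ.target ▸ hγ' 1
  let G : I × I → W := fun a => F (⟨γ a.1, hγ' a.1⟩, a.2)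
  have hG : Continuous G := hF.comp (by fun_prop)
  have hG0 : ∀ l, G (0, l) = p := fun l => by
    have : (⟨γ 0, hγ' 0⟩ : U) = ⟨p, hpU⟩ := Subtype.ext γ.source
    simp only [G, this, hp]
  have hG1 : ∀ l, G (1, l) = F (⟨p', hpU'⟩, l) := fun l => by
    have : (⟨γ 1, hγ' 1⟩ : U) = ⟨p', hpU'⟩ := Subtype.ext γ.target
    simp only [G, this]
  -- On the square `G`, γ is the side l = 1 and η the side s = 1, while the other two sides are
  -- constant at p. Both paths are pushed to the diagonal.
  let δ : Path p p' :=
    { toFun := fun s => G (s, s)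
      continuous_toFun := hG.comp (by fun_prop)
      source' := hG0 0
      target' := by rw [hG1, h1] }
  have e1 : γ.Homotopic δ := ⟨{
      toFun := fun a => G (a.2, Set.Icc.convexComb 1 a.2 a.1)
      continuous_toFun := hG.comp (by fun_prop)
      map_zero_left := fun s => by simp [G, h1]
      map_one_left := fun s => by simp [δ]
      prop' := fun t s hs => by
        rcases hs with rfl | rfl
        · simp [hG0]
        · simp [hG1, h1] }⟩
  have e2 : δ.Homotopic η := ⟨{
      toFun := fun a => G (Set.Icc.convexComb a.2 1 a.1, a.2)
      continuous_toFun := hG.comp (by fun_prop)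
      map_zero_left := fun s => by simp [δ]
      map_one_left := fun s => by simp [hη hpU', hG1]
      prop' := fun t s hs => by
        rcases hs with rfl | rfl
        · simp [G, h0]
        · simp [hG1, h1] }⟩
  exact e1.trans e2

namespace ClosedOrientedSurface

variable {W : Type*} [TopologicalSpace W] (S : ClosedOrientedSurface W)

/-- The map from the disjoint union of the triangles onto the surface. -/
def proj (a : S.T × stdSimplex ℝ (Fin 3)) : W := S.simplex a.1 a.2

theorem proj_eq_iff {a b : S.T × stdSimplex ℝ (Fin 3)} :
    S.proj a = S.proj b ↔ Relation.EqvGen S.gluing.rel a b :=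
  S.homeo.injective.eq_iff.trans S.gluing.point_eq_iff

theorem isQuotientMap_proj [TopologicalSpace S.T] [DiscreteTopology S.T] :
    IsQuotientMap S.proj :=
  S.homeo.isQuotientMap.comp S.gluing.isQuotientMap_point

theorem proj_surjective : Function.Surjective S.proj := by
  let _ : TopologicalSpace S.T := ⊥
  have : DiscreteTopology S.T := ⟨rfl⟩
  exact S.isQuotientMap_proj.surjective

/-- Near the point `proj a₀`, every path from that point is homotopic to a straight path
in a triangle. -/
theorem exists_nhds_straight (a₀ : S.T × stdSimplex ℝ (Fin 3)) :
    ∃ U ∈ 𝓝 (S.proj a₀), ∀ (p' : W) (γ : Path (S.proj a₀) p'), Set.range γ ⊆ U →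
      ∃ (t : S.T) (y x : stdSimplex ℝ (Fin 3)) (hy : S.proj a₀ = S.simplex t y)
        (hx : p' = S.simplex t x) (δ : Path y x),
        γ.Homotopic ((δ.map (S.simplex t).continuous).cast hy hx) := by
  let _ : TopologicalSpace S.T := ⊥
  have : DiscreteTopology S.T := ⟨rfl⟩
  obtain ⟨ε, hε⟩ := exists_isScale a₀.2
  set U : Set W := S.proj '' S.gluing.star a₀ ε with hUdef
  have hpre : S.proj ⁻¹' U = S.gluing.star a₀ ε := by
    refine Set.Subset.antisymm ?_ (Set.subset_preimage_image _ _)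
    rintro a ⟨b, hb, h⟩
    exact (OrientedGluing.mem_star_iff hε (S.proj_eq_iff.1 h)).1 hb
  have hU : IsOpen U := by
    rw [← S.isQuotientMap_proj.isOpen_preimage, hpre]
    exact S.gluing.isOpen_star a₀ ε
  have hstar : ∀ a : S.proj ⁻¹' U, a.1 ∈ S.gluing.star a₀ ε := fun a => hpre ▸ a.2
  choose c hc hcn using hstar
  let g : (S.proj ⁻¹' U) × I → W := fun q => S.proj (q.1.1.1, segmentPoint (c q.1) q.1.1.2 q.2)
  have hg : Continuous g := by
    rw [continuous_iff_continuousAt]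
    rintro ⟨a, l⟩
    -- Near `(a, l)` the triangle does not change and the point stays close to the centre `c a`. By
    -- uniqueness of the close centre, `c` is locally constant.
    have hev : ∀ᶠ q : (S.proj ⁻¹' U) × I in 𝓝 (a, l), q.1.1.1 = a.1.1 ∧ Near ε q.1.1.2 (c a) := by
      have ho : IsOpen {q : (S.proj ⁻¹' U) × I | q.1.1.1 = a.1.1 ∧ Near ε q.1.1.2 (c a)} := by
        refine IsOpen.inter ?_ ?_
        · exact (isOpen_discrete {a.1.1}).preimage
            (f := fun q : (S.proj ⁻¹' U) × I => q.1.1.1) (by fun_prop)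
        · exact (isOpen_near ε (c a)).preimage
            (f := fun q : (S.proj ⁻¹' U) × I => q.1.1.2) (by fun_prop)
      exact ho.mem_nhds ⟨rfl, hcn a⟩
    have hcont : Continuous fun q : (S.proj ⁻¹' U) × I =>
        S.simplex a.1.1 (segmentPoint (c a) q.1.1.2 q.2) :=
      (S.simplex a.1.1).continuous.comp ((continuous_segmentPoint (c a)).comp
        (f := fun q : (S.proj ⁻¹' U) × I => (q.1.1.2, q.2)) (by fun_prop))
    refine hcont.continuousAt.congr ?_
    filter_upwards [hev] with q hq
    have h1 : c q.1 = c a := by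
      refine OrientedGluing.near_unique hε (hc q.1) ?_ (hcn q.1) hq.2
      rw [hq.1]
      exact hc a
    simp only [g, proj, h1, hq.1]
  -- The contraction descends to the surface, since gluing carries segments to the centres into
  -- segments to the centres.
  have hgc : ∀ (a a' : S.proj ⁻¹' U), S.proj a.1 = S.proj a'.1 → ∀ l, g (a, l) = g (a', l) := by
    have key : ∀ b b', Relation.EqvGen S.gluing.rel b b' → ∀ (hb : b ∈ S.proj ⁻¹' U)
        (hb' : b' ∈ S.proj ⁻¹' U) l, g (⟨b, hb⟩, l) = g (⟨b', hb'⟩, l) := by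
      intro b b' h
      induction h with
      | rel b b' h =>
        intro hb hb' l
        obtain ⟨y', hy', hn', hl⟩ := OrientedGluing.star_step hε h (hc ⟨b, hb⟩) (hcn ⟨b, hb⟩)
        have : y' = c ⟨b', hb'⟩ :=
          OrientedGluing.near_unique hε hy' (hc ⟨b', hb'⟩) hn' (hcn ⟨b', hb'⟩)
        subst this
        exact S.proj_eq_iff.2 (Relation.EqvGen.rel _ _ (hl l))
      | refl b => intro _ _ _; rfl
      | symm b b' _ ih => intro hb hb' l; exact (ih hb' hb l).symm
      | trans b b' b'' h h' ih ih' =>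
        intro hb hb'' l
        have hb' : b' ∈ S.proj ⁻¹' U := by
          change S.proj b' ∈ U
          rw [← S.proj_eq_iff.2 h]
          exact hb
        exact (ih hb hb' l).trans (ih' hb' hb'' l)
    intro a a' h l
    exact key a.1 a'.1 (S.proj_eq_iff.1 h) a.2 a'.2 l
  have hs : ∀ u : U, ∃ a : S.proj ⁻¹' U, S.proj a.1 = u := fun u => by
    obtain ⟨a, ha⟩ := S.proj_surjective u
    exact ⟨⟨a, by change S.proj a ∈ U; rw [ha]; exact u.2⟩, ha⟩
  choose r hr using hs
  let F : U × I → W := fun q => g (r q.1, q.2)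
  have hF : Continuous F := by
    -- Restricting the quotient map over an open set and multiplying by the locally compact interval
    -- keeps it a quotient map, so continuity can be tested upstairs.
    refine (S.isQuotientMap_proj.restrictPreimage_isOpen hU).continuous_lift_prod_left ?_
    refine hg.congr fun q => ?_
    exact hgc _ _ (hr (U.restrictPreimage S.proj q.1)).symm q.2
  refine ⟨U, hU.mem_nhds ⟨a₀, OrientedGluing.mem_star_self hε.1, rfl⟩, fun p' γ hγ => ?_⟩
  have hpU' : p' ∈ U := hγ ⟨1, γ.target⟩
  set a := r ⟨p', hpU'⟩ with ha
  have hy : S.proj a₀ = S.simplex a.1.1 (c a) := S.proj_eq_iff.2 (hc a)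
  have hx : p' = S.simplex a.1.1 a.1.2 := (hr ⟨p', hpU'⟩).symm
  let δ : Path (c a) a.1.2 :=
    { toFun := fun l => segmentPoint (c a) a.1.2 l
      continuous_toFun := (continuous_segmentPoint (c a)).comp
        (f := fun l : I => (a.1.2, l)) (by fun_prop)
      source' := segmentPoint_zero _ _
      target' := segmentPoint_one _ _ }
  refine ⟨a.1.1, c a, a.1.2, hy, hx, δ, ?_⟩
  refine homotopic_of_contraction F hF ?_ ?_ ?_ γ hγ _ ?_
  · intro u
    simp only [F, g, segmentPoint_zero]
    exact (S.proj_eq_iff.2 (hc _)).symm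
  · intro u
    simp only [F, g, segmentPoint_one]
    exact hr u
  · intro hp l
    have h1 : S.proj (r ⟨S.proj a₀, hp⟩).1 = S.proj a₀ := hr ⟨S.proj a₀, hp⟩
    have h2 := hgc (r ⟨S.proj a₀, hp⟩) ⟨a₀, hp⟩ h1 l
    have h3 : c ⟨a₀, hp⟩ = a₀.2 := OrientedGluing.near_unique hε (hc ⟨a₀, hp⟩)
      (Relation.EqvGen.refl _) (hcn ⟨a₀, hp⟩) (fun i => by simpa using hε.1)
    change g (r ⟨S.proj a₀, hp⟩, l) = _
    rw [h2]
    simp only [g, h3, segmentPoint_self]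
  · intro h l
    rfl

end ClosedOrientedSurface
end LiftCount
end

/-! ### Transport along straight paths in triangles, and fixed elements from corner data -/

noncomputable section
namespace LiftCount

open Topology unitInterval

namespace ClosedOrientedSurface

variable {W : Type*} [TopologicalSpace W] (S : ClosedOrientedSurface W)

theorem subsingleton_pathClass {n : ℕ} [NeZero n] (x y : stdSimplex ℝ (Fin n)) :
    Subsingleton (Path.Homotopic.Quotient x y) := by
  have : ContractibleSpace (stdSimplex ℝ (Fin n)) :=
    (convex_stdSimplex ℝ (Fin n)).contractibleSpace ⟨_, single_mem_stdSimplex ℝ 0⟩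
  infer_instance

/-- The class of the paths from `x` to `y` in the triangle `t`. -/
def lineClass (t : S.T) (x y : stdSimplex ℝ (Fin 3)) :
    Path.Homotopic.Quotient (S.simplex t x) (S.simplex t y) :=
  (Path.Homotopic.Quotient.mk (PathConnectedSpace.somePath x y)).map (S.simplex t)

theorem lineClass_eq (t : S.T) {x y : stdSimplex ℝ (Fin 3)} (p : Path.Homotopic.Quotient x y) :
    p.map (S.simplex t) = S.lineClass t x y := by
  have := subsingleton_pathClass x y
  exact congrArg (fun q : Path.Homotopic.Quotient x y => q.map (S.simplex t))
    (Subsingleton.elim _ _)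

theorem proj_face (s : S.T × Fin 3) (z : stdSimplex ℝ (Fin 2)) :
    S.proj (s.1, face s.2 z) = S.proj ((S.gluing.glue s).1, face (S.gluing.glue s).2 z) :=
  S.proj_eq_iff.2 (Relation.EqvGen.rel _ _ ⟨s, z, rfl, rfl⟩)

theorem face_vertex (i : Fin 3) (k : Fin 2) :
    face i (stdSimplex.vertex k) = stdSimplex.vertex (i.succAbove k) :=
  stdSimplex.map_vertex _ _

section

variable [PathConnectedSpace W] (w : W)

/-- The element of `π₁(W, w)` attached to the straight path from `x` to `y` in the triangle `t`. -/
def lineLoop (t : S.T) (x y : stdSimplex ℝ (Fin 3)) : FundamentalGroup W w :=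
  loop w (S.lineClass t x y)

theorem lineLoop_mul (t : S.T) (x y z : stdSimplex ℝ (Fin 3)) :
    S.lineLoop w t x y * S.lineLoop w t y z = S.lineLoop w t x z := by
  unfold lineLoop
  rw [← loop_trans]
  congr 1
  unfold lineClass
  rw [← Path.Homotopic.Quotient.mk_map, ← Path.Homotopic.Quotient.mk_map,
    ← Path.Homotopic.Quotient.mk_trans, ← Path.map_trans, Path.Homotopic.Quotient.mk_map]
  exact S.lineClass_eq t _

theorem lineLoop_self (t : S.T) (x : stdSimplex ℝ (Fin 3)) : S.lineLoop w t x x = 1 :=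
  mul_eq_left.1 (S.lineLoop_mul w t x x x)

/-- The element of `π₁(W, w)` attached to a side of a triangle. -/
def edgeLabel (s : S.T × Fin 3) : FundamentalGroup W w :=
  label w ((S.simplex s.1).comp (face s.2))

theorem edgeLabel_glue (s : S.T × Fin 3) :
    S.edgeLabel w (S.gluing.glue s) = S.edgeLabel w s := by
  unfold edgeLabel
  rw [S.simplex_face]

theorem edgeLabel_mul (t : S.T) :
    S.edgeLabel w (t, 2) * S.edgeLabel w (t, 0) = S.edgeLabel w (t, 1) :=
  label_face w (S.simplex t)

theorem loop_map_face (s : S.T × Fin 3) {z z' : stdSimplex ℝ (Fin 2)}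
    (p : Path.Homotopic.Quotient z z') :
    loop w (p.map ((S.simplex s.1).comp (face s.2)))
      = S.lineLoop w s.1 (face s.2 z) (face s.2 z') := by
  rw [Path.Homotopic.Quotient.map_comp]
  exact congrArg (loop w) (S.lineClass_eq s.1 (p.map (face s.2)))

/-- Both sides are the loop of one path in `Δ¹`, since the two triangles restrict to the same
singular simplex on the glued side. -/
theorem lineLoop_face (s : S.T × Fin 3) (z z' : stdSimplex ℝ (Fin 2)) :
    S.lineLoop w (S.gluing.glue s).1 (face (S.gluing.glue s).2 z) (face (S.gluing.glue s).2 z')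
      = S.lineLoop w s.1 (face s.2 z) (face s.2 z') := by
  have p : Path.Homotopic.Quotient z z' :=
    Path.Homotopic.Quotient.mk (PathConnectedSpace.somePath z z')
  rw [← S.loop_map_face w _ p, ← S.loop_map_face w _ p]
  have : ∀ f f' : C(stdSimplex ℝ (Fin 2), W), f = f' → loop w (p.map f) = loop w (p.map f') := by
    rintro f _ rfl; rfl
  exact this _ _ (S.simplex_face s)

theorem edgeLabel_eq (s : S.T × Fin 3) :
    S.edgeLabel w s = S.lineLoop w s.1 (stdSimplex.vertex (s.2.succAbove 0))
      (stdSimplex.vertex (s.2.succAbove 1)) := by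
  rw [← face_vertex, ← face_vertex,
    ← S.loop_map_face w s (Path.Homotopic.Quotient.mk stdPath)]
  rfl

end

/-- A family of elements at the corners of the triangles that is compatible with the edges is
constant, with value fixed by `π₁(W, w)`. -/
theorem exists_fixed_of_corners [ConnectedSpace W] [PathConnectedSpace W] (w : W) {X : Type*}
    (θ : FundamentalGroup W w →* Equiv.Perm X) (k : S.T → Fin 3 → X)
    (hglue : ∀ s i, k (S.gluing.glue s).1 ((S.gluing.glue s).2.succAbove i)
      = k s.1 (s.2.succAbove i))
    (hk : ∀ s, k s.1 (s.2.succAbove 0) = θ (S.edgeLabel w s) (k s.1 (s.2.succAbove 1))) :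
    ∃ c : X, (∀ a, θ a c = c) ∧ ∀ t i, k t i = c := by
  have hline : ∀ t i j, k t i
      = θ (S.lineLoop w t (stdSimplex.vertex i) (stdSimplex.vertex j)) (k t j) := by
    intro t
    have h01 := hk (t, 2)
    have h02 := hk (t, 1)
    have h12 := hk (t, 0)
    rw [edgeLabel_eq] at h01 h02 h12
    change k t 0 = θ (S.lineLoop w t (stdSimplex.vertex 0) (stdSimplex.vertex 1)) (k t 1) at h01
    change k t 0 = θ (S.lineLoop w t (stdSimplex.vertex 0) (stdSimplex.vertex 2)) (k t 2) at h02
    change k t 1 = θ (S.lineLoop w t (stdSimplex.vertex 1) (stdSimplex.vertex 2)) (k t 2) at h12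
    have hinv : ∀ i j, k t i
        = θ (S.lineLoop w t (stdSimplex.vertex i) (stdSimplex.vertex j)) (k t j) →
        k t j = θ (S.lineLoop w t (stdSimplex.vertex j) (stdSimplex.vertex i)) (k t i) := by
      intro i j h
      rw [h, ← Equiv.Perm.mul_apply, ← map_mul, lineLoop_mul, lineLoop_self, map_one]
      rfl
    have hself : ∀ i, k t i
        = θ (S.lineLoop w t (stdSimplex.vertex i) (stdSimplex.vertex i)) (k t i) := by
      intro i
      rw [lineLoop_self, map_one]
      rfl
    intro i j
    fin_cases i <;> fin_cases j
    exacts [hself _, h01, h02, hinv _ _ h01, hself _, h12, hinv _ _ h02, hinv _ _ h12, hself _]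
  -- The corner values are spread over each triangle by transport from the vertex 0; any other
  -- vertex would give the same function.
  let κ' : S.T × stdSimplex ℝ (Fin 3) → X := fun a =>
    θ (S.lineLoop w a.1 a.2 (stdSimplex.vertex 0)) (k a.1 0)
  have hκ' : ∀ t x i, κ' (t, x) = θ (S.lineLoop w t x (stdSimplex.vertex i)) (k t i) := by
    intro t x i
    change θ _ (k t 0) = _
    rw [hline t 0 i, ← Equiv.Perm.mul_apply, ← map_mul, lineLoop_mul]
  have hrel : ∀ a b, Relation.EqvGen S.gluing.rel a b → κ' a = κ' b := by
    intro a b h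
    induction h with
    | rel a b h =>
      obtain ⟨s, z, rfl, rfl⟩ := h
      rw [hκ' _ _ (s.2.succAbove 0), hκ' _ _ ((S.gluing.glue s).2.succAbove 0), hglue,
        ← face_vertex, ← face_vertex, lineLoop_face]
    | refl => rfl
    | symm _ _ _ h => exact h.symm
    | trans _ _ _ _ _ h h' => exact h.trans h'
  choose r hr using S.proj_surjective
  let κ : W → X := fun u => κ' (r u)
  have hκ : ∀ a, κ (S.proj a) = κ' a := fun a => hrel _ _ (S.proj_eq_iff.1 (hr _))
  have htri : ∀ t x y, κ (S.simplex t x) = θ (S.lineLoop w t x y) (κ (S.simplex t y)) := by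
    intro t x y
    have h1 := hκ (t, x)
    have h2 := hκ (t, y)
    change κ (S.simplex t x) = _ at h1
    change κ (S.simplex t y) = _ at h2
    rw [h1, h2]
    change _ = θ _ (θ _ _)
    rw [← Equiv.Perm.mul_apply, ← map_mul, lineLoop_mul]
  have htrans : ∀ {x y : W} (p : Path.Homotopic.Quotient x y), κ x = θ (loop w p) (κ y) := by
    refine transport_of_local θ κ fun p => ?_
    obtain ⟨a₀, rfl⟩ := S.proj_surjective p
    obtain ⟨U, hU, h⟩ := S.exists_nhds_straight a₀
    refine ⟨U, hU, fun p' γ hγ => ?_⟩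
    obtain ⟨t, y, x, hy, hx, δ, hδ⟩ := h p' γ hγ
    have e : loop w (Path.Homotopic.Quotient.mk γ) = S.lineLoop w t y x := by
      rw [Path.Homotopic.Quotient.eq.2 hδ, Path.Homotopic.Quotient.mk_cast, loop_cast]
      exact congrArg (loop w) (S.lineClass_eq t (Path.Homotopic.Quotient.mk δ))
    rw [e, hy, hx]
    exact htri t y x
  -- Every element of π₁ is the loop of a closed path at x, so all values are fixed by π₁. Transport
  -- along any path then changes nothing and κ is constant.
  have hfix : ∀ x a, θ a (κ x) = κ x := by
    intro x a
    obtain ⟨p, rfl⟩ := exists_loop_eq w x a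
    exact (htrans p).symm
  refine ⟨κ w, hfix w, fun t i => ?_⟩
  have h1 : κ (S.proj (t, stdSimplex.vertex i)) = k t i := by
    rw [hκ, hκ' _ _ i, lineLoop_self, map_one]
    rfl
  rw [← h1, htrans (Path.Homotopic.Quotient.mk (PathConnectedSpace.somePath _ w)), hfix]

end ClosedOrientedSurface
end LiftCount
end

noncomputable section
namespace LiftCount

open Topology unitInterval

/-! ### Flat edge labelings are realised by homomorphisms -/

namespace OrientedGluing

variable {T H : Type*} [Group H]

/-- An edge labeling with values in a group, multiplicative around each triangle. -/
structure IsFlat (K : OrientedGluing T) (f : T × Fin 3 → H) : Prop where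
  glue : ∀ s, f (K.glue s) = f s
  mul : ∀ t, f (t, 2) * f (t, 0) = f (t, 1)

variable {K : OrientedGluing T} {f : T × Fin 3 → H}

/-- The value of a labeling on the edge from the vertex `0` of a triangle. -/
def fromZero (f : T × Fin 3 → H) (t : T) : Fin 3 → H := ![1, f (t, 2), f (t, 1)]

theorem IsFlat.fromZero_mul (hf : K.IsFlat f) (s : T × Fin 3) :
    fromZero f s.1 (s.2.succAbove 0) * f s = fromZero f s.1 (s.2.succAbove 1) := by
  obtain ⟨t, i⟩ := s
  fin_cases i
  · exact hf.mul t
  · exact one_mul _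
  · exact one_mul _

/-- The label at the vertex `0` of the triangle glued along the side `s` to a triangle
with label `h` at its vertex `0`. -/
def shiftLabel (K : OrientedGluing T) (f : T × Fin 3 → H) (s : T × Fin 3) (h : H) : H :=
  h * fromZero f s.1 (s.2.succAbove 0)
    * (fromZero f (K.glue s).1 ((K.glue s).2.succAbove 0))⁻¹

/-- In the sheet h of a triangle the corner i has label `h * fromZero f t i`. The shift is defined
so that labels match at the first corner of a glued side; flatness makes them match at the second.
-/
theorem shiftLabel_mul_fromZero (hf : K.IsFlat f) (s : T × Fin 3) (h : H) (k : Fin 2) :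
    K.shiftLabel f s h * fromZero f (K.glue s).1 ((K.glue s).2.succAbove k)
      = h * fromZero f s.1 (s.2.succAbove k) := by
  have h0 : K.shiftLabel f s h * fromZero f (K.glue s).1 ((K.glue s).2.succAbove 0)
      = h * fromZero f s.1 (s.2.succAbove 0) := by simp [shiftLabel]
  fin_cases k
  · exact h0
  · change _ * fromZero f _ (Fin.succAbove _ 1) = _ * fromZero f _ (Fin.succAbove _ 1)
    rw [← hf.fromZero_mul, ← hf.fromZero_mul, hf.glue, ← mul_assoc, h0, mul_assoc]

/-- The gluing of the covering associated with a labeling. -/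
def cover (K : OrientedGluing T) (f : T × Fin 3 → H) : OrientedGluing (T × H) where
  sgn p := K.sgn p.1
  glue s := (((K.glue (s.1.1, s.2)).1, K.shiftLabel f (s.1.1, s.2) s.1.2), (K.glue (s.1.1, s.2)).2)
  glue_glue := by
    rintro ⟨⟨t, h⟩, i⟩
    simp only [Prod.mk.eta, K.glue_glue]
    simp [shiftLabel, K.glue_glue]
  sgn_glue := by
    rintro ⟨⟨t, h⟩, i⟩
    exact K.sgn_glue (t, i)

theorem cover_rel_of_rel {a b : T × stdSimplex ℝ (Fin 3)} (hab : K.rel a b) (h : H) :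
    ∃ h', (K.cover f).rel ((a.1, h), a.2) ((b.1, h'), b.2) := by
  obtain ⟨s, z, rfl, rfl⟩ := hab
  exact ⟨_, ((s.1, h), s.2), z, rfl, rfl⟩

theorem rel_of_cover_rel {a b : (T × H) × stdSimplex ℝ (Fin 3)} (hab : (K.cover f).rel a b) :
    K.rel (a.1.1, a.2) (b.1.1, b.2) := by
  obtain ⟨⟨⟨t, h⟩, i⟩, z, rfl, rfl⟩ := hab
  exact ⟨(t, i), z, rfl, rfl⟩

theorem cover_rel_mul {a b : (T × H) × stdSimplex ℝ (Fin 3)} (hab : (K.cover f).rel a b) (g : H) :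
    (K.cover f).rel ((a.1.1, g * a.1.2), a.2) ((b.1.1, g * b.1.2), b.2) := by
  obtain ⟨⟨⟨t, h⟩, i⟩, z, rfl, rfl⟩ := hab
  exact ⟨((t, g * h), i), z, rfl, by simp [cover, shiftLabel, mul_assoc]⟩

/-- The projection of the covering. -/
def coverProj (K : OrientedGluing T) (f : T × Fin 3 → H) : (K.cover f).Realization → K.Realization :=
  Quot.lift (fun a => K.point (a.1.1, a.2)) fun _ _ h => Quot.sound (rel_of_cover_rel h)

theorem coverProj_point (a : (T × H) × stdSimplex ℝ (Fin 3)) :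
    K.coverProj f ((K.cover f).point a) = K.point (a.1.1, a.2) := rfl

instance (K : OrientedGluing T) (f : T × Fin 3 → H) : MulAction H (K.cover f).Realization where
  smul g := Quot.lift (fun a => (K.cover f).point ((a.1.1, g * a.1.2), a.2))
    fun _ _ h => Quot.sound (cover_rel_mul h g)
  one_smul := by
    rintro ⟨⟨⟨t, h⟩, x⟩⟩
    change (K.cover f).point ((t, 1 * h), x) = (K.cover f).point ((t, h), x)
    rw [one_mul]
  mul_smul g g' := by
    rintro ⟨⟨⟨t, h⟩, x⟩⟩
    change (K.cover f).point ((t, g * g' * h), x) = (K.cover f).point ((t, g * (g' * h)), x)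
    rw [mul_assoc]

theorem smul_point (g : H) (a : (T × H) × stdSimplex ℝ (Fin 3)) :
    g • (K.cover f).point a = (K.cover f).point ((a.1.1, g * a.1.2), a.2) := rfl

/-- The first vertex with nonzero coordinate. -/
def firstVertex (x : stdSimplex ℝ (Fin 3)) : Fin 3 :=
  open Classical in if x 0 ≠ 0 then 0 else if x 1 ≠ 0 then 1 else 2

/-- Gluing preserves the order of the vertices of a side, so the first vertex seen with nonzero
coordinate is the same corner from either triangle. This makes the corner label a well-defined
function on the covering. -/
theorem firstVertex_face (i : Fin 3) (z : stdSimplex ℝ (Fin 2)) :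
    firstVertex (face i z) = i.succAbove (open Classical in if z 0 ≠ 0 then 0 else 1) := by
  classical
  have h0 := face_self i z
  have h1 := face_succAbove i z 0
  have h2 := face_succAbove i z 1
  have hz : z 0 = 0 → z 1 ≠ 0 := fun h h' => by
    have := stdSimplex.add_eq_one z
    rw [h, h'] at this
    norm_num at this
  have hs : z 1 ≠ 0 ∨ z 1 = 0 := ne_or_eq _ _
  fin_cases i
  · change face 0 z 0 = 0 at h0
    change face 0 z 1 = z 0 at h1
    simp only [firstVertex, Fin.zero_eta, h0, h1]
    split_ifs <;> simp_all
  · change face 1 z 0 = z 0 at h1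
    change face 1 z 1 = 0 at h0
    simp only [firstVertex, Fin.mk_one, h0, h1]
    split_ifs <;> simp_all
  · change face 2 z 0 = z 0 at h1
    change face 2 z 1 = z 1 at h2
    change firstVertex (face 2 z) = Fin.succAbove 2 _
    simp only [firstVertex, h1, h2]
    split_ifs <;> first | rfl | simp_all

/-- An equivariant function on the covering: the label at the first vertex. -/
def coverLabel (hf : K.IsFlat f) : (K.cover f).Realization → H :=
  Quot.lift (fun a => a.1.2 * fromZero f a.1.1 (firstVertex a.2)) (by
    rintro _ _ ⟨⟨⟨t, h⟩, i⟩, z, rfl, rfl⟩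
    simp only [firstVertex_face]
    exact (shiftLabel_mul_fromZero hf (t, i) h _).symm)

theorem coverLabel_point (hf : K.IsFlat f) (a : (T × H) × stdSimplex ℝ (Fin 3)) :
    coverLabel hf ((K.cover f).point a) = a.1.2 * fromZero f a.1.1 (firstVertex a.2) := rfl

theorem coverLabel_smul (hf : K.IsFlat f) (g : H) (e : (K.cover f).Realization) :
    coverLabel hf (g • e) = g * coverLabel hf e := by
  obtain ⟨a, rfl⟩ := (K.cover f).point_surjective e
  rw [smul_point, coverLabel_point, coverLabel_point, mul_assoc]

/-- Forgetting the sheet has the continuous section h = 1, so it is a quotient map, and so is its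
composite with the gluing map of the base; `coverProj` is the last factor of that composite. -/
theorem isQuotientMap_coverProj (K : OrientedGluing T) (f : T × Fin 3 → H) :
    IsQuotientMap (K.coverProj f) := by
  let _ : TopologicalSpace T := ⊥
  have : DiscreteTopology T := ⟨rfl⟩
  let _ : TopologicalSpace H := ⊥
  have : DiscreteTopology H := ⟨rfl⟩
  have h1 : Continuous fun a : (T × H) × stdSimplex ℝ (Fin 3) => (a.1.1, a.2) := by fun_prop
  have h2 : IsQuotientMap fun a : (T × H) × stdSimplex ℝ (Fin 3) => (a.1.1, a.2) :=
    IsQuotientMap.of_inverse (f := fun b : T × stdSimplex ℝ (Fin 3) => ((b.1, (1 : H)), b.2))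
      (by fun_prop) h1 fun _ => rfl
  have h3 := K.isQuotientMap_point.comp h2
  have h4 : Continuous (K.coverProj f) := by
    rw [(K.cover f).isQuotientMap_point.continuous_iff]
    exact h3.continuous
  exact IsQuotientMap.of_comp (K.cover f).isQuotientMap_point.continuous h4 h3

theorem coverProj_eq_iff {e e' : (K.cover f).Realization} :
    K.coverProj f e = K.coverProj f e' ↔ e ∈ MulAction.orbit H e' := by
  obtain ⟨⟨⟨t, h⟩, x⟩, rfl⟩ := (K.cover f).point_surjective e
  obtain ⟨⟨⟨t', h'⟩, x'⟩, rfl⟩ := (K.cover f).point_surjective e'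
  rw [coverProj_point, coverProj_point, point_eq_iff]
  constructor
  · intro hr
    have key : ∀ a b, Relation.EqvGen K.rel a b → ∀ h : H,
        ∃ h', (K.cover f).point ((a.1, h), a.2) = (K.cover f).point ((b.1, h'), b.2) := by
      intro a b hab
      induction hab with
      | rel a b hab =>
        intro h
        obtain ⟨h', hh⟩ := cover_rel_of_rel (f := f) hab h
        exact ⟨h', Quot.sound hh⟩
      | refl a => exact fun h => ⟨h, rfl⟩
      -- The lift starting at 1 ends at some h'; translating it by `h * h'⁻¹` gives the lift ending
      -- at h.
      | symm a b _ ih =>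
        intro h
        obtain ⟨h', hh⟩ := ih 1
        refine ⟨h * h'⁻¹, ?_⟩
        have := congrArg (fun e => (h * h'⁻¹) • e) hh
        simp only [smul_point, inv_mul_cancel_right, mul_one] at this
        exact this.symm
      | trans a b c _ _ ih ih' =>
        intro h
        obtain ⟨h', hh⟩ := ih h
        obtain ⟨h'', hh'⟩ := ih' h'
        exact ⟨h'', hh.trans hh'⟩
    obtain ⟨h'', hh⟩ := key _ _ hr h
    refine ⟨h'' * h'⁻¹, ?_⟩
    change (h'' * h'⁻¹) • _ = _
    rw [smul_point, hh]
    simp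
  · rintro ⟨g, hg⟩
    change g • _ = _ at hg
    rw [smul_point] at hg
    have := congrArg (K.coverProj f) hg
    rw [coverProj_point, coverProj_point] at this
    exact (K.point_eq_iff.1 this).symm

/-- A star of a point is disjoint from its translates by g ≠ 1, because the equivariant corner label
shows that the action is free. No continuity of that label is needed. -/
theorem isQuotientCoveringMap_coverProj (hf : K.IsFlat f) :
    IsQuotientCoveringMap (K.coverProj f) H where
  __ := K.isQuotientMap_coverProj f
  apply_eq_iff_mem_orbit := coverProj_eq_iff
  continuous_const_smul g := by
    let _ : TopologicalSpace T := ⊥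
    have : DiscreteTopology T := ⟨rfl⟩
    let _ : TopologicalSpace H := ⊥
    have : DiscreteTopology H := ⟨rfl⟩
    rw [(K.cover f).isQuotientMap_point.continuous_iff]
    have : Continuous fun a : (T × H) × stdSimplex ℝ (Fin 3) => ((a.1.1, g * a.1.2), a.2) := by
      have : Continuous fun h : H => g * h := continuous_of_discreteTopology
      fun_prop
    exact (K.cover f).isQuotientMap_point.continuous.comp this
  disjoint e := by
    obtain ⟨a₀, rfl⟩ := (K.cover f).point_surjective e
    obtain ⟨ε, hε⟩ := exists_isScale a₀.2
    refine ⟨_, (isOpen_image_star hε).mem_nhds ⟨a₀, mem_star_self hε.1, rfl⟩, ?_⟩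
    rintro g ⟨_, ⟨_, ⟨a, ⟨y, hy, hn⟩, rfl⟩, rfl⟩, b, hb, hab⟩
    have hb' : ((a.1.1, g * a.1.2), a.2) ∈ (K.cover f).star a₀ ε :=
      (mem_star_iff hε ((K.cover f).point_eq_iff.1 hab)).1 hb
    obtain ⟨y', hy', hn'⟩ := hb'
    -- The two centres lie in different sheets, so `near_unique` does not apply; its estimate does,
    -- as both centres have the coordinate values of a₀.
    have hyy : y = y' := by
      refine stdSimplex.ext (funext fun i => ?_)
      by_contra hne
      have h := hε.2 (y i) ((K.cover f).coordValues_eq hy ▸ Or.inr ⟨i, rfl⟩) (y' i)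
        ((K.cover f).coordValues_eq hy' ▸ Or.inr ⟨i, rfl⟩) hne
      have h1 := abs_lt.1 (hn i)
      have h2 := abs_lt.1 (hn' i)
      rcases le_abs.1 h with h | h <;> linarith
    subst hyy
    have e1 := (K.cover f).point_eq_iff.2 hy
    have e2 := (K.cover f).point_eq_iff.2 hy'
    have e3 := congrArg (coverLabel hf) (e1.symm.trans e2)
    rw [coverLabel_point, coverLabel_point, mul_assoc] at e3
    exact (mul_eq_right.1 e3.symm)

end OrientedGluing
end LiftCount
end

/-! ### Monodromy of the covering of a flat labeling -/

noncomputable section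
namespace LiftCount

open Topology unitInterval

theorem OrientedGluing.firstVertex_vertex (i : Fin 3) :
    OrientedGluing.firstVertex (stdSimplex.vertex i) = i := by
  classical
  have h : ∀ j, (stdSimplex.vertex i : stdSimplex ℝ (Fin 3)) j = if j = i then 1 else 0 := by
    intro j
    change (Pi.single i (1 : ℝ) : Fin 3 → ℝ) j = _
    rw [Pi.single_apply]
  simp only [OrientedGluing.firstVertex, h]
  fin_cases i <;> simp

namespace ClosedOrientedSurface

variable {W : Type*} [TopologicalSpace W] (S : ClosedOrientedSurface W)

/-- The corner `i` of the triangle `t`. -/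
def corner (t : S.T) (i : Fin 3) : W := S.simplex t (stdSimplex.vertex i)

theorem corner_glue (s : S.T × Fin 3) (k : Fin 2) :
    S.corner (S.gluing.glue s).1 ((S.gluing.glue s).2.succAbove k)
      = S.corner s.1 (s.2.succAbove k) := by
  have := S.proj_face s (stdSimplex.vertex k)
  rw [face_vertex, face_vertex] at this
  exact this.symm

/-- A flat labeling of the edges comes from a homomorphism of `π₁(W, w)`, up to a change of
labels at the points. -/
theorem exists_hom_of_isFlat [PathConnectedSpace W] (w : W) {H : Type*} [Group H]
    {f : S.T × Fin 3 → H} (hf : S.gluing.IsFlat f) :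
    ∃ (φ : FundamentalGroup W w →* H) (k : W → H), ∀ s : S.T × Fin 3,
      f s = (k (S.corner s.1 (s.2.succAbove 0)))⁻¹ * φ (S.edgeLabel w s)
        * k (S.corner s.1 (s.2.succAbove 1)) := by
  let p : (S.gluing.cover f).Realization → W := S.homeo ∘ S.gluing.coverProj f
  have hp : IsQuotientCoveringMap p H :=
    (OrientedGluing.isQuotientCoveringMap_coverProj hf).homeomorph_comp S.homeo
  have cov := hp.isCoveringMap
  let lab := OrientedGluing.coverLabel hf
  have hlab : ∀ (g : H) e, lab (g • e) = g * lab e := OrientedGluing.coverLabel_smul hf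
  -- A base point with label 1 in each fibre, obtained by translating any point; the choice need not
  -- be continuous in x.
  have he : ∀ x, ∃ e : p ⁻¹' {x}, lab e.1 = 1 := by
    intro x
    obtain ⟨e, rfl⟩ := hp.surjective x
    exact ⟨⟨(lab e)⁻¹ • e, hp.map_smul _⟩, by rw [hlab, inv_mul_cancel]⟩
  choose e he using he
  let Φ : ∀ {x y : W}, Path.Homotopic.Quotient x y → H := fun {x y} γ => lab (cov.monodromy γ (e x)).1
  -- Monodromy commutes with the action, so it multiplies every label on the right by `Φ γ`; this is
  -- what makes Φ multiplicative on paths.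
  have hΦ : ∀ {x y : W} (γ : Path.Homotopic.Quotient x y) (e' : p ⁻¹' {x}),
      lab (cov.monodromy γ e').1 = lab e'.1 * Φ γ := by
    intro x y γ e'
    obtain ⟨g, rfl⟩ := hp.exists_toPermFiber_eq (e x) e'
    have h1 := congrArg Subtype.val (hp.monodromy_toPermFiber (g := g) (γ := γ) (e := e x))
    change (cov.monodromy γ _).1 = g • (cov.monodromy γ (e x)).1 at h1
    rw [h1, hlab]
    change _ = lab (g • (e x).1) * _
    rw [hlab, he, mul_one]
  have htrans : ∀ {x y z : W} (γ : Path.Homotopic.Quotient x y) (γ' : Path.Homotopic.Quotient y z),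
      Φ (γ.trans γ') = Φ γ * Φ γ' := by
    intro x y z γ γ'
    change lab (cov.monodromy (γ.trans γ') (e x)).1 = _
    rw [cov.monodromy_trans_apply, hΦ]
  have hsymm : ∀ {x y : W} (γ : Path.Homotopic.Quotient x y), Φ γ.symm = (Φ γ)⁻¹ := by
    intro x y γ
    have h1 : Φ (Path.Homotopic.Quotient.refl x) = 1 := by
      change lab (cov.monodromy _ (e x)).1 = 1
      rw [cov.monodromy_refl]
      exact he x
    rw [eq_inv_iff_mul_eq_one, ← htrans, Path.Homotopic.Quotient.symm_trans]
    change lab (cov.monodromy _ (e y)).1 = 1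
    rw [cov.monodromy_refl]
    exact he y
  -- A path in the triangle t lifts into its sheet 1, where the labels of points are values of
  -- `fromZero`.
  have hline : ∀ t x y, Φ (S.lineClass t x y)
      = (OrientedGluing.fromZero f t (OrientedGluing.firstVertex x))⁻¹
        * OrientedGluing.fromZero f t (OrientedGluing.firstVertex y) := by
    intro t x y
    let c : C(stdSimplex ℝ (Fin 3), (S.gluing.cover f).Realization) :=
      (S.gluing.cover f).charMap (t, 1)
    have hc : (⟨p, cov.continuous⟩ : C(_, W)).comp c = S.simplex t := rfl
    let γ := Path.Homotopic.Quotient.mk (PathConnectedSpace.somePath x y)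
    have h1 : cov.monodromy (S.lineClass t x y) ⟨c x, rfl⟩ = ⟨c y, rfl⟩ :=
      cov.monodromy_eq_of_map_eq (γ.map c) (by
        rw [← Path.Homotopic.Quotient.map_comp]
        rfl)
    have h2 := hΦ (S.lineClass t x y) ⟨c x, rfl⟩
    rw [h1] at h2
    have h3 : ∀ z, lab (c z) = OrientedGluing.fromZero f t (OrientedGluing.firstVertex z) :=
      fun z => one_mul _
    simp only [h3] at h2
    rw [h2, inv_mul_cancel_left]
  -- The inverse compensates for the order of multiplication in the fundamental group, in which `a *
  -- b` runs through b first.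
  let φ : FundamentalGroup W w →* H :=
    { toFun := fun a => (Φ (FundamentalGroup.toPath a))⁻¹
      map_one' := by
        change (Φ (Path.Homotopic.Quotient.refl w))⁻¹ = 1
        have := htrans (Path.Homotopic.Quotient.refl w) (Path.Homotopic.Quotient.refl w)
        rw [Path.Homotopic.Quotient.refl_trans] at this
        rw [mul_eq_left.1 this.symm, inv_one]
      map_mul' := fun a b => by
        change (Φ (Path.Homotopic.Quotient.trans _ _))⁻¹ = _
        rw [htrans, mul_inv_rev] }
  let τ : ∀ x, Path.Homotopic.Quotient w x := fun x =>
    Path.Homotopic.Quotient.mk (PathConnectedSpace.somePath w x)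
  have hφ : ∀ {x y : W} (γ : Path.Homotopic.Quotient x y),
      φ (loop w γ) = Φ (τ x) * Φ γ * (Φ (τ y))⁻¹ := by
    intro x y γ
    unfold loop
    rw [map_inv]
    change ((Φ ((τ x).trans (γ.trans (τ y).symm)))⁻¹)⁻¹ = _
    rw [inv_inv, htrans, htrans, hsymm, mul_assoc]
  refine ⟨φ, fun x => Φ (τ x), fun s => ?_⟩
  rw [edgeLabel_eq, lineLoop, hφ, hline, OrientedGluing.firstVertex_vertex,
    OrientedGluing.firstVertex_vertex, ← hf.fromZero_mul s]
  simp only [corner]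
  group

end ClosedOrientedSurface
end LiftCount
end

noncomputable section
namespace LiftCount

/-! ### Lifts of homomorphisms and lifts of edge labelings -/

namespace OrientedGluing

variable {T : Type*} (K : OrientedGluing T)

instance [Finite T] : Finite K.Vertex := inferInstanceAs (Finite (Quot _))

/-- The vertex at the corner `i` of the triangle `t`. -/
def vertex (t : T) (i : Fin 3) : K.Vertex := Quot.mk _ (t, i)

theorem vertex_glue (s : T × Fin 3) (k : Fin 2) :
    K.vertex (K.glue s).1 ((K.glue s).2.succAbove k) = K.vertex s.1 (s.2.succAbove k) :=
  (Quot.sound ⟨s, k, rfl, rfl⟩).symm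

theorem vertex_induction {motive : K.Vertex → Prop} (h : ∀ t i, motive (K.vertex t i))
    (v : K.Vertex) : motive v := by
  obtain ⟨⟨t, i⟩⟩ := v
  exact h t i

/-- Functions on the vertices from compatible functions on the corners. -/
def vertexLift {X : Type*} (k : T → Fin 3 → X)
    (h : ∀ s i, k (K.glue s).1 ((K.glue s).2.succAbove i) = k s.1 (s.2.succAbove i)) :
    K.Vertex → X :=
  Quot.lift (fun a => k a.1 a.2) (by
    rintro _ _ ⟨s, i, rfl, rfl⟩
    exact (h s i).symm)

/-- The flat labelings with values in `G'` over a given labeling with values in `G`. -/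
def FlatLifts {G G' : Type*} [Group G] [Group G'] (q : G' →* G) (a : T × Fin 3 → G) : Type _ :=
  {f : T × Fin 3 → G' // K.IsFlat f ∧ ∀ s, q (f s) = a s}

end OrientedGluing

/-- The conjugate of a homomorphism by an element of the target. -/
def conjHom {π H : Type*} [Group π] [Group H] (c : H) (φ : π →* H) : π →* H :=
  (MulAut.conj c).toMonoidHom.comp φ

theorem conjHom_apply {π H : Type*} [Group π] [Group H] (c : H) (φ : π →* H) (a : π) :
    conjHom c φ a = c * φ a * c⁻¹ := rfl

/-- The action of `π` on `H` by `φ` on the left and `ψ` on the right. -/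
def biaction {π H : Type*} [Group π] [Group H] (φ ψ : π →* H) : π →* Equiv.Perm H where
  toFun a := (Equiv.mulLeft (φ a)).trans (Equiv.mulRight (ψ a)⁻¹)
  map_one' := by ext; simp
  map_mul' a b := by ext; simp [mul_assoc]

theorem biaction_apply {π H : Type*} [Group π] [Group H] (φ ψ : π →* H) (a : π) (h : H) :
    biaction φ ψ a h = φ a * h * (ψ a)⁻¹ := rfl

namespace ClosedOrientedSurface

open OrientedGluing

variable {W : Type*} [TopologicalSpace W] (S : ClosedOrientedSurface W) [ConnectedSpace W]
  [PathConnectedSpace W] (w : W)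

/-- A gauge transformation between the labelings of two homomorphisms is constant and
conjugates the homomorphisms. -/
theorem exists_conj_of_gauge {H : Type*} [Group H] (φ ψ : FundamentalGroup W w →* H)
    (k : S.gluing.Vertex → H)
    (hk : ∀ s : S.T × Fin 3, k (S.gluing.vertex s.1 (s.2.succAbove 0)) * ψ (S.edgeLabel w s)
      = φ (S.edgeLabel w s) * k (S.gluing.vertex s.1 (s.2.succAbove 1))) :
    ∃ c, φ = conjHom c ψ ∧ ∀ v, k v = c := by
  -- The gauge relation says that k is transported along edges by `biaction φ ψ`, whose fixed
  -- elements are those conjugating ψ to φ.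
  obtain ⟨c, hc, hkc⟩ := S.exists_fixed_of_corners w (biaction φ ψ)
    (fun t i => k (S.gluing.vertex t i)) (fun s i => by rw [S.gluing.vertex_glue]) (fun s => by
      rw [biaction_apply, ← hk, mul_inv_cancel_right])
  refine ⟨c, MonoidHom.ext fun a => ?_, S.gluing.vertex_induction hkc⟩
  have := hc a
  rw [biaction_apply, mul_inv_eq_iff_eq_mul] at this
  rw [conjHom_apply, ← this, mul_inv_cancel_right]

variable {G G' : Type*} [Group G] [Group G'] (q : G' →* G) (g : FundamentalGroup W w →* G)

/-- The flat labeling obtained from a lift and a gauge transformation in the kernel. -/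
def gaugeLabel (φ : Lifts q g) (k : S.gluing.Vertex → q.ker) :
    S.gluing.FlatLifts q (fun s => g (S.edgeLabel w s)) :=
  ⟨fun s => (k (S.gluing.vertex s.1 (s.2.succAbove 0)) : G')⁻¹ * φ.1 (S.edgeLabel w s)
      * k (S.gluing.vertex s.1 (s.2.succAbove 1)), {
    glue := fun s => by
      rw [S.gluing.vertex_glue, S.gluing.vertex_glue, edgeLabel_glue]
    mul := fun t => by
      rw [← S.edgeLabel_mul w t, map_mul]
      change (k (S.gluing.vertex t 0) : G')⁻¹ * _ * k (S.gluing.vertex t 1)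
        * ((k (S.gluing.vertex t 1) : G')⁻¹ * _ * k (S.gluing.vertex t 2))
        = (k (S.gluing.vertex t 0) : G')⁻¹ * _ * k (S.gluing.vertex t 2)
      group }, fun s => by
    have h : ∀ x : q.ker, q x = 1 := fun x => x.2
    rw [map_mul, map_mul, map_inv, h, h, inv_one, one_mul, mul_one]
    exact DFunLike.congr_fun φ.2 _⟩

/-- Two pairs give the same labeling exactly when they differ by a constant of the kernel that
conjugates the lift and multiplies the gauge function. Recording the value at v₀ removes this
freedom. -/
theorem gaugeLabel_bijective (v₀ : S.gluing.Vertex) :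
    Function.Bijective fun p : Lifts q g × (S.gluing.Vertex → q.ker) =>
      (S.gaugeLabel w q g p.1 p.2, p.2 v₀) := by
  constructor
  · rintro ⟨φ₁, k₁⟩ ⟨φ₂, k₂⟩ h
    have h1 := congrArg Prod.fst h
    have h2 : k₁ v₀ = k₂ v₀ := congrArg Prod.snd h
    obtain ⟨c, hc, hk⟩ := S.exists_conj_of_gauge w φ₂.1 φ₁.1
      (fun v => (k₂ v : G') * (k₁ v : G')⁻¹) (fun s => by
        have : (k₁ (S.gluing.vertex s.1 (s.2.succAbove 0)) : G')⁻¹ * φ₁.1 (S.edgeLabel w s)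
            * k₁ (S.gluing.vertex s.1 (s.2.succAbove 1))
            = (k₂ (S.gluing.vertex s.1 (s.2.succAbove 0)) : G')⁻¹ * φ₂.1 (S.edgeLabel w s)
            * k₂ (S.gluing.vertex s.1 (s.2.succAbove 1)) := congrFun (congrArg Subtype.val h1) s
        have e1 : φ₁.1 (S.edgeLabel w s) = k₁ (S.gluing.vertex s.1 (s.2.succAbove 0))
            * ((k₁ (S.gluing.vertex s.1 (s.2.succAbove 0)) : G')⁻¹ * φ₁.1 (S.edgeLabel w s)
            * k₁ (S.gluing.vertex s.1 (s.2.succAbove 1)))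
            * (k₁ (S.gluing.vertex s.1 (s.2.succAbove 1)) : G')⁻¹ := by group
        rw [e1, this]
        group)
    have hc1 : c = 1 := by rw [← hk v₀, h2, mul_inv_cancel]
    subst hc1
    have hφ : φ₁ = φ₂ := Subtype.ext (by rw [hc]; ext a; simp [conjHom_apply])
    have hkk : k₁ = k₂ := funext fun v => Subtype.ext (mul_inv_eq_one.1 (hk v)).symm
    rw [hφ, hkk]
  · rintro ⟨f, x⟩
    obtain ⟨φ, k', hk'⟩ := S.exists_hom_of_isFlat w f.2.1
    let k : S.gluing.Vertex → G' := S.gluing.vertexLift (fun t i => k' (S.corner t i))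
      (fun s i => by rw [S.corner_glue])
    have hk : ∀ s, f.1 s = (k (S.gluing.vertex s.1 (s.2.succAbove 0)))⁻¹ * φ (S.edgeLabel w s)
        * k (S.gluing.vertex s.1 (s.2.succAbove 1)) := hk'
    obtain ⟨c, hc, hkc⟩ := S.exists_conj_of_gauge w (q.comp φ) g (fun v => q (k v)) (fun s => by
      have e : q (f.1 s) = g (S.edgeLabel w s) := f.2.2 s
      rw [← e, hk s, map_mul, map_mul, map_inv]
      simp only [MonoidHom.comp_apply]
      group)
    -- The homomorphism found covers g only up to conjugation by c. This preimage of c corrects it,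
    -- and is normalised so that the new gauge function takes the value x at v₀.
    let c' : G' := k v₀ * (x : G')⁻¹
    have hxq : q (x : G') = 1 := x.2
    have hc' : q c' = c := by
      simp only [c', map_mul, map_inv, hxq, inv_one, mul_one]
      exact hkc v₀
    let φ' : Lifts q g := ⟨conjHom c'⁻¹ φ, by
      ext a
      have h1 : q (φ a) = c * g a * c⁻¹ := by
        have := DFunLike.congr_fun hc a
        rwa [conjHom_apply] at this
      simp only [MonoidHom.comp_apply, conjHom_apply, map_mul, map_inv, hc', h1]
      group⟩
    let k'' : S.gluing.Vertex → q.ker := fun v => ⟨c'⁻¹ * k v, by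
      rw [MonoidHom.mem_ker, map_mul, map_inv, hc']
      exact (congrArg (c⁻¹ * ·) (hkc v)).trans (inv_mul_cancel c)⟩
    refine ⟨(φ', k''), Prod.ext (Subtype.ext (funext fun s => ?_)) (Subtype.ext ?_)⟩
    · change (c'⁻¹ * _)⁻¹ * (c'⁻¹ * φ (S.edgeLabel w s) * (c'⁻¹)⁻¹) * (c'⁻¹ * _) = f.1 s
      rw [hk s]
      group
    · change c'⁻¹ * k v₀ = x
      simp [c']

/-- A lift is determined by its values on the finitely many edge labels, by rigidity for the trivial
gauge function, and each value lies in a coset of the finite kernel. -/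
theorem finite_lifts (S : ClosedOrientedSurface W) [Finite q.ker] : Finite (Lifts q g) := by
  have hfin : Finite (S.gluing.FlatLifts q (fun s => g (S.edgeLabel w s))) := by
    have hfib : ∀ s : S.T × Fin 3, Finite {x : G' // q x = g (S.edgeLabel w s)} := by
      intro s
      by_cases h : Nonempty {x : G' // q x = g (S.edgeLabel w s)}
      · obtain ⟨x₀, hx₀⟩ := h
        refine Finite.of_injective (β := q.ker) (fun x => ⟨x₀⁻¹ * x.1, by
          rw [MonoidHom.mem_ker, map_mul, map_inv, hx₀, x.2, inv_mul_cancel]⟩) fun x y h => ?_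
        exact Subtype.ext (mul_left_cancel (congrArg Subtype.val h))
      · rw [not_nonempty_iff] at h
        infer_instance
    refine Finite.of_injective (β := ∀ s : S.T × Fin 3, {x : G' // q x = g (S.edgeLabel w s)})
      (fun f s => ⟨f.1 s, f.2.2 s⟩) fun f f' h => Subtype.ext (funext fun s => ?_)
    exact congrArg Subtype.val (congrFun h s)
  obtain ⟨a, -⟩ := S.proj_surjective w
  refine Finite.of_injective (fun φ : Lifts q g => S.gaugeLabel w q g φ 1) fun φ₁ φ₂ h => ?_
  obtain ⟨c, hc, hk⟩ := S.exists_conj_of_gauge w φ₂.1 φ₁.1 1 (fun s => by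
    have := congrFun (congrArg Subtype.val h) s
    simpa [gaugeLabel] using this)
  have hc1 : c = 1 := (hk (S.gluing.vertex a.1 0)).symm
  subst hc1
  exact Subtype.ext (by rw [hc]; ext a; simp [conjHom_apply])

theorem card_lifts [Finite q.ker] :
    Nat.card (Lifts q g) * Nat.card q.ker ^ Nat.card S.gluing.Vertex
      = Nat.card (S.gluing.FlatLifts q (fun s => g (S.edgeLabel w s))) * Nat.card q.ker := by
  obtain ⟨a, -⟩ := S.proj_surjective w
  have h := Nat.card_congr
    (Equiv.ofBijective _ (S.gaugeLabel_bijective w q g (S.gluing.vertex a.1 0)))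
  rwa [Nat.card_prod, Nat.card_prod, Nat.card_fun] at h

end ClosedOrientedSurface
end LiftCount
end

noncomputable section
namespace LiftCount

/-! ### Irreducible matrix representations of a finite group -/

open Matrix

section SchurOrthogonality

variable {Γ : Type*} [Group Γ]

theorem IrrRep.map_mul_val (ρ : IrrRep Γ) (g h : Γ) :
    (ρ.toHom (g * h)).1 = (ρ.toHom g).1 * (ρ.toHom h).1 := by
  rw [map_mul, Units.val_mul]

theorem IrrRep.map_one_val (ρ : IrrRep Γ) : (ρ.toHom 1).1 = 1 := by
  rw [map_one, Units.val_one]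

theorem IrrRep.Equivalent.exists_matrix {σ ρ : IrrRep Γ} (h : σ.Equivalent ρ) :
    ∃ (A : Matrix (Fin ρ.dim) (Fin σ.dim) ℂ) (B : Matrix (Fin σ.dim) (Fin ρ.dim) ℂ),
      A * B = 1 ∧ B * A = 1 ∧ ∀ g, A * (σ.toHom g).1 = (ρ.toHom g).1 * A := by
  obtain ⟨n, hn, σ, hσ⟩ := σ
  obtain ⟨m, hm, ρ, hρ⟩ := ρ
  obtain ⟨e, M, hM⟩ := h
  dsimp only at e
  subst e
  refine ⟨M.1, (M⁻¹).1, ?_, ?_, fun g => ?_⟩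
  · rw [← Units.val_mul, mul_inv_cancel, Units.val_one]
  · rw [← Units.val_mul, inv_mul_cancel, Units.val_one]
  · have h1 : σ g = M⁻¹ * ρ g * M := hM g
    change M.1 * (σ g).1 = (ρ g).1 * M.1
    rw [h1, ← Units.val_mul, ← Units.val_mul]
    congr 1
    group

/-- Schur's lemma: a nonzero intertwiner is an equivalence. -/
theorem IrrRep.eq_zero_or_equivalent (σ ρ : IrrRep Γ) (X : Matrix (Fin σ.dim) (Fin ρ.dim) ℂ)
    (hX : ∀ g, (σ.toHom g).1 * X = X * (ρ.toHom g).1) : X = 0 ∨ σ.Equivalent ρ := by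
  by_cases h0 : X = 0
  · exact Or.inl h0
  right
  have hne : X.mulVecLin ≠ 0 := fun h => h0 (by
    ext i j
    have := congrFun (LinearMap.congr_fun h (Pi.single j 1)) i
    simpa using this)
  have hker : LinearMap.ker X.mulVecLin = ⊥ := by
    refine (ρ.irreducible _ fun g v hv => ?_).resolve_right fun h => hne (LinearMap.ker_eq_top.1 h)
    rw [LinearMap.mem_ker, Matrix.mulVecLin_apply] at hv ⊢
    rw [Matrix.mulVec_mulVec, ← hX, ← Matrix.mulVec_mulVec, hv, Matrix.mulVec_zero]
  have hrange : LinearMap.range X.mulVecLin = ⊤ := by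
    refine (σ.irreducible _ ?_).resolve_left fun h => hne (LinearMap.range_eq_bot.1 h)
    rintro g _ ⟨v, rfl⟩
    refine ⟨(ρ.toHom g).1.mulVec v, ?_⟩
    simp only [Matrix.mulVecLin_apply, Matrix.mulVec_mulVec, hX]
  have hdim : σ.dim = ρ.dim := by
    have e := LinearEquiv.ofBijective X.mulVecLin
      ⟨LinearMap.ker_eq_bot.1 hker, LinearMap.range_eq_top.1 hrange⟩
    simpa using e.finrank_eq.symm
  obtain ⟨n, hn, σ, hσ⟩ := σ
  obtain ⟨m, hm, ρ, hρ⟩ := ρ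
  dsimp only at hdim
  subst hdim
  have hunit : IsUnit X := Matrix.mulVec_injective_iff_isUnit.1 (LinearMap.ker_eq_bot.1 hker)
  obtain ⟨M, rfl⟩ := hunit
  refine ⟨rfl, M⁻¹, fun g => ?_⟩
  have h1 : σ g * M = M * ρ g := Units.ext (hX g)
  change σ g = (M⁻¹)⁻¹ * ρ g * M⁻¹
  rw [inv_inv, ← h1, mul_inv_cancel_right]

/-- Schur's lemma: a self-intertwiner is a scalar. -/
theorem IrrRep.exists_eq_smul_one (ρ : IrrRep Γ) (X : Matrix (Fin ρ.dim) (Fin ρ.dim) ℂ)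
    (hX : ∀ g, (ρ.toHom g).1 * X = X * (ρ.toHom g).1) : ∃ z : ℂ, X = z • 1 := by
  have : Nonempty (Fin ρ.dim) := ⟨⟨0, ρ.dim_pos⟩⟩
  obtain ⟨μ, hμ⟩ := Module.End.exists_eigenvalue (Matrix.toLin' X)
  have hV := ρ.irreducible (Module.End.eigenspace (Matrix.toLin' X) μ) (by
    intro h v hv
    rw [Module.End.mem_eigenspace_iff, Matrix.toLin'_apply] at hv ⊢
    rw [Matrix.mulVec_mulVec, ← hX, ← Matrix.mulVec_mulVec, hv, Matrix.mulVec_smul])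
  have htop := hV.resolve_left hμ
  refine ⟨μ, Matrix.toLin'.injective (LinearMap.ext fun v => ?_)⟩
  have hv : v ∈ Module.End.eigenspace (Matrix.toLin' X) μ := by rw [htop]; trivial
  rw [Module.End.mem_eigenspace_iff] at hv
  rw [hv]
  simp

variable [Fintype Γ]

/-- The average of a matrix over the group. -/
def average (σ ρ : IrrRep Γ) (j : Fin σ.dim) (k : Fin ρ.dim) :
    Matrix (Fin σ.dim) (Fin ρ.dim) ℂ :=
  ∑ h, (σ.toHom h).1 * Matrix.single j k (1 : ℂ) * (ρ.toHom h⁻¹).1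

theorem average_apply (σ ρ : IrrRep Γ) (i j : Fin σ.dim) (k l : Fin ρ.dim) :
    average σ ρ j k i l = ∑ h, (σ.toHom h).1 i j * (ρ.toHom h⁻¹).1 k l := by
  rw [average, Matrix.sum_apply]
  refine Finset.sum_congr rfl fun h _ => ?_
  rw [Matrix.mul_apply, Finset.sum_eq_single k]
  · rw [Matrix.mul_single_apply_same, mul_one]
  · intro b _ hb
    rw [Matrix.mul_single_apply_of_ne _ _ _ _ _ hb, zero_mul]
  · simp

theorem average_intertwines (σ ρ : IrrRep Γ) (j : Fin σ.dim) (k : Fin ρ.dim) (g : Γ) :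
    (σ.toHom g).1 * average σ ρ j k = average σ ρ j k * (ρ.toHom g).1 := by
  rw [average, Matrix.mul_sum, Matrix.sum_mul]
  refine Fintype.sum_equiv (Equiv.mulLeft g) _ _ fun h => ?_
  rw [Equiv.coe_mulLeft, σ.map_mul_val, Matrix.mul_assoc _ (ρ.toHom (g * h)⁻¹).1,
    ← ρ.map_mul_val]
  simp [Matrix.mul_assoc]

theorem sum_mul_eq_zero {σ ρ : IrrRep Γ} (h : ¬ σ.Equivalent ρ) (i j : Fin σ.dim)
    (k l : Fin ρ.dim) : ∑ h, (σ.toHom h).1 i j * (ρ.toHom h⁻¹).1 k l = 0 := by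
  rw [← average_apply, (σ.eq_zero_or_equivalent ρ _ (average_intertwines σ ρ j k)).resolve_right h,
    Matrix.zero_apply]

/-- The average of an elementary matrix is a scalar matrix by Schur's lemma; comparing traces
determines the scalar. -/
theorem sum_mul_self (ρ : IrrRep Γ) (i j k l : Fin ρ.dim) :
    ∑ h, (ρ.toHom h).1 i j * (ρ.toHom h⁻¹).1 k l
      = if i = l ∧ j = k then (Fintype.card Γ : ℂ) / ρ.dim else 0 := by
  obtain ⟨z, hz⟩ := ρ.exists_eq_smul_one _ (average_intertwines ρ ρ j k)
  have hd : (ρ.dim : ℂ) ≠ 0 := Nat.cast_ne_zero.2 ρ.dim_pos.ne'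
  have htr := congrArg Matrix.trace hz
  have h1 : ∀ h, ((ρ.toHom h).1 * Matrix.single j k (1 : ℂ) * (ρ.toHom h⁻¹).1).trace
      = if j = k then (1 : ℂ) else 0 := by
    intro h
    rw [Matrix.mul_assoc, Matrix.trace_mul_comm, Matrix.mul_assoc, ← ρ.map_mul_val, inv_mul_cancel,
      ρ.map_one_val, Matrix.mul_one]
    split_ifs with hjk
    · subst hjk; simp
    · exact Matrix.trace_single_eq_of_ne _ _ _ hjk
  rw [average, Matrix.trace_sum, Finset.sum_congr rfl fun h _ => h1 h, Finset.sum_const,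
    Finset.card_univ, Matrix.trace_smul, Matrix.trace_one, Fintype.card_fin, smul_eq_mul,
    nsmul_eq_mul] at htr
  have hz' : z = if j = k then (Fintype.card Γ : ℂ) / ρ.dim else 0 := by
    rw [eq_div_of_mul_eq hd htr.symm]
    split_ifs <;> simp
  rw [← average_apply, hz, hz', Matrix.smul_apply, Matrix.one_apply, smul_eq_mul]
  by_cases h1 : i = l <;> by_cases h2 : j = k <;> simp [h1, h2]

end SchurOrthogonality

/-! ### Finiteness of the set of irreducible classes, and the regular character -/

section Completeness

variable {Γ : Type*} [Group Γ]

theorem Irr.eq_of_equivalent {c c' : Irr Γ} (h : c.rep.Equivalent c'.rep) : c = c' :=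
  Quotient.out_equiv_out.1 h

/-- The class of an irreducible representation. -/
def Irr.mk (ρ : IrrRep Γ) : Irr Γ := Quotient.mk (irrSetoid Γ) ρ

theorem Irr.rep_mk (ρ : IrrRep Γ) : (Irr.mk ρ).rep.Equivalent ρ :=
  Quotient.exact (s := irrSetoid Γ) (Quotient.out_eq (Irr.mk ρ))

theorem Irr.mk_eq_iff {σ ρ : IrrRep Γ} : Irr.mk σ = Irr.mk ρ ↔ σ.Equivalent ρ :=
  Quotient.eq (r := irrSetoid Γ)

theorem Irr.mk_rep (c : Irr Γ) : Irr.mk c.rep = c := Quotient.out_eq c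

/-- By orthogonality, one diagonal coefficient from each class gives a linearly independent family
in the finite-dimensional space of functions on Γ. -/
instance finite_irr [Finite Γ] : Finite (Irr Γ) := by
  have := Fintype.ofFinite Γ
  let z : ∀ c : Irr Γ, Fin c.rep.dim := fun c => ⟨0, c.rep.dim_pos⟩
  let u : Irr Γ → Γ → ℂ := fun c h => (c.rep.toHom h).1 (z c) (z c)
  have hu : LinearIndependent ℂ u := by
    rw [linearIndependent_iff']
    intro s a hs c hc
    have h1 := congrArg (fun f : Γ → ℂ => ∑ h, f h * (c.rep.toHom h⁻¹).1 (z c) (z c)) hs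
    simp only [Finset.sum_apply, Pi.smul_apply, smul_eq_mul, Pi.zero_apply, zero_mul,
      Finset.sum_const_zero, Finset.sum_mul] at h1
    rw [Finset.sum_comm, Finset.sum_eq_single c] at h1
    · simp only [u, mul_assoc, ← Finset.mul_sum] at h1
      rw [sum_mul_self] at h1
      have hd : (c.rep.dim : ℂ) ≠ 0 := Nat.cast_ne_zero.2 c.rep.dim_pos.ne'
      have hG : (Fintype.card Γ : ℂ) ≠ 0 := Nat.cast_ne_zero.2 Fintype.card_ne_zero
      simpa [hd, hG] using h1
    · intro c' _ hne
      simp only [u, mul_assoc, ← Finset.mul_sum]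
      rw [sum_mul_eq_zero (fun h => hne (Irr.eq_of_equivalent h)), mul_zero]
    · exact fun h => absurd hc h
  exact hu.finite

/-- The irreducible representation afforded by a simple module over the group algebra. -/
theorem exists_irrRep_of_simple [Finite Γ] (Q : Type*) [AddCommGroup Q] [Module ℂ Q]
    [Module (MonoidAlgebra ℂ Γ) Q] [IsScalarTower ℂ (MonoidAlgebra ℂ Γ) Q]
    [FiniteDimensional ℂ Q] [IsSimpleModule (MonoidAlgebra ℂ Γ) Q] :
    ∃ (ρ : IrrRep Γ) (e : Q ≃ₗ[ℂ] (Fin ρ.dim → ℂ)), ∀ (h : Γ) (v : Q),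
      e (MonoidAlgebra.of ℂ Γ h • v) = (ρ.toHom h).1.mulVec (e v) := by
  have : Nontrivial Q := IsSimpleModule.nontrivial (MonoidAlgebra ℂ Γ) Q
  let b := Module.finBasis ℂ Q
  let r : Γ →* Matrix (Fin (Module.finrank ℂ Q)) (Fin (Module.finrank ℂ Q)) ℂ :=
    ((LinearMap.toMatrixAlgEquiv b).toAlgHom.comp
      (Algebra.lsmul ℂ ℂ Q : MonoidAlgebra ℂ Γ →ₐ[ℂ] _)).toMonoidHom.comp (MonoidAlgebra.of ℂ Γ)
  have hr : ∀ h v, b.equivFun (MonoidAlgebra.of ℂ Γ h • v) = (r h).mulVec (b.equivFun v) := by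
    intro h v
    exact (LinearMap.toMatrix_mulVec_repr b b (Algebra.lsmul ℂ ℂ Q (MonoidAlgebra.of ℂ Γ h)) v).symm
  refine ⟨⟨Module.finrank ℂ Q, Module.finrank_pos, r.toHomUnits, fun V hV => ?_⟩, b.equivFun, hr⟩
  let N : Submodule (MonoidAlgebra ℂ Γ) Q :=
    { carrier := {v | b.equivFun v ∈ V}
      add_mem' := fun {x y} hx hy => by
        simp only [Set.mem_ofPred_eq, map_add] at *
        exact V.add_mem hx hy
      zero_mem' := by simp
      smul_mem' := fun a v hv => by
        simp only [Set.mem_ofPred_eq] at *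
        induction a using MonoidAlgebra.induction_on with
        | of h =>
          rw [hr]
          exact hV h _ hv
        | add x y hx hy =>
          rw [add_smul, map_add]
          exact V.add_mem hx hy
        | smul z x hx =>
          rw [smul_assoc, map_smul]
          exact V.smul_mem _ hx }
  rcases eq_bot_or_eq_top N with h | h
  · left
    rw [eq_bot_iff]
    intro v hv
    have h1 : b.equivFun.symm v ∈ N := by
      change b.equivFun (b.equivFun.symm v) ∈ V
      rwa [LinearEquiv.apply_symm_apply]
    rw [h, Submodule.mem_bot, LinearEquiv.map_eq_zero_iff] at h1
    exact h1
  · right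
    rw [eq_top_iff]
    intro v _
    have h1 : b.equivFun.symm v ∈ N := h ▸ Submodule.mem_top
    have h2 : b.equivFun (b.equivFun.symm v) ∈ V := h1
    rwa [LinearEquiv.apply_symm_apply] at h2

/-- An element of the group algebra that vanishes in all irreducible representations is zero. -/
theorem eq_zero_of_irrRep [Fintype Γ] (φ : Γ → ℂ)
    (hφ : ∀ ρ : IrrRep Γ, ∑ h, φ h • (ρ.toHom h).1 = 0) : φ = 0 := by
  let a : MonoidAlgebra ℂ Γ := ∑ h, φ h • MonoidAlgebra.of ℂ Γ h
  have : NeZero (Nat.card Γ : ℂ) := ⟨Nat.cast_ne_zero.2 Nat.card_pos.ne'⟩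
  have hfin : Module.Finite ℂ (MonoidAlgebra ℂ Γ) := inferInstance
  -- The quotient by a maximal left ideal is a simple module, so it comes from an irreducible
  -- representation and is killed by a. Hence a lies in every such ideal; by Maschke's theorem the
  -- radical vanishes.
  have ha : a ∈ Ring.jacobson (MonoidAlgebra ℂ Γ) := by
    change a ∈ sInf _
    rw [Submodule.mem_sInf]
    intro m hm
    have hs : IsSimpleModule (MonoidAlgebra ℂ Γ) (MonoidAlgebra ℂ Γ ⧸ m) :=
      isSimpleModule_iff_isCoatom.2 hm
    have hf : FiniteDimensional ℂ (MonoidAlgebra ℂ Γ ⧸ m) :=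
      Module.Finite.of_surjective (m.mkQ.restrictScalars ℂ) m.mkQ_surjective
    obtain ⟨ρ, e, he⟩ := exists_irrRep_of_simple (Γ := Γ) (MonoidAlgebra ℂ Γ ⧸ m)
    have h1 : ∀ v : MonoidAlgebra ℂ Γ ⧸ m, a • v = 0 := by
      intro v
      apply e.injective
      have : e (a • v) = (∑ h, φ h • (ρ.toHom h).1).mulVec (e v) := by
        simp only [a, Finset.sum_smul, map_sum, smul_assoc, map_smul, he, Matrix.sum_mulVec,
          Matrix.smul_mulVec]
      rw [this, hφ, Matrix.zero_mulVec, map_zero]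
    have h2 := h1 (Submodule.Quotient.mk (1 : MonoidAlgebra ℂ Γ))
    rw [← Submodule.Quotient.mk_smul, smul_eq_mul, mul_one, Submodule.Quotient.mk_eq_zero] at h2
    exact h2
  rw [IsSemisimpleRing.jacobson_eq_bot] at ha
  have ha0 : a = 0 := ha
  funext g
  have := congrArg (fun x : MonoidAlgebra ℂ Γ => x.coeff g) ha0
  classical
  simpa [a, MonoidAlgebra.of_apply, Finsupp.single_apply] using this

open Classical in
/-- The regular character is the sum of the irreducible characters times their degrees. -/
theorem sum_dim_mul_trace [Fintype Γ] [Fintype (Irr Γ)] (g : Γ) :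
    ∑ c : Irr Γ, (c.rep.dim : ℂ) * (c.rep.toHom g).1.trace
      = if g = 1 then (Fintype.card Γ : ℂ) else 0 := by
  have hG : (Fintype.card Γ : ℂ) ≠ 0 := Nat.cast_ne_zero.2 Fintype.card_ne_zero
  let χ : Γ → ℂ := fun g => ∑ c : Irr Γ, (c.rep.dim : ℂ) * (c.rep.toHom g).1.trace
  -- Orthogonality shows that the element with coefficients `χ h⁻¹` acts on every irreducible
  -- representation as |Γ|, exactly as |Γ| times the identity of the group does.
  have hirr : ∀ c : Irr Γ, ∑ h, χ h⁻¹ • (c.rep.toHom h).1 = (Fintype.card Γ : ℂ) • 1 := by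
    intro c
    have hd : (c.rep.dim : ℂ) ≠ 0 := Nat.cast_ne_zero.2 c.rep.dim_pos.ne'
    ext i j
    simp only [Matrix.sum_apply, Matrix.smul_apply, smul_eq_mul, χ, Finset.sum_mul]
    rw [Finset.sum_comm, Finset.sum_eq_single c]
    · have : ∀ h, (c.rep.dim : ℂ) * (c.rep.toHom h⁻¹).1.trace * (c.rep.toHom h).1 i j
          = ∑ k, (c.rep.dim : ℂ) * ((c.rep.toHom h).1 i j * (c.rep.toHom h⁻¹).1 k k) := by
        intro h
        rw [Matrix.trace, Finset.mul_sum, Finset.sum_mul]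
        exact Finset.sum_congr rfl fun k _ => by rw [Matrix.diag_apply]; ring
      simp only [this]
      rw [Finset.sum_comm]
      simp only [← Finset.mul_sum, sum_mul_self]
      rw [Matrix.one_apply]
      by_cases hij : i = j
      · subst hij
        simp [Finset.sum_ite_eq, hd, mul_div_cancel₀]
      · have : ∀ k, ¬ (i = k ∧ j = k) := fun k h => hij (h.1.trans h.2.symm)
        simp [this, hij]
    · intro c' _ hne
      have : ∀ h, (c'.rep.dim : ℂ) * (c'.rep.toHom h⁻¹).1.trace * (c.rep.toHom h).1 i j
          = ∑ k, (c'.rep.dim : ℂ) * ((c.rep.toHom h).1 i j * (c'.rep.toHom h⁻¹).1 k k) := by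
        intro h
        rw [Matrix.trace, Finset.mul_sum, Finset.sum_mul]
        exact Finset.sum_congr rfl fun k _ => by rw [Matrix.diag_apply]; ring
      simp only [this]
      rw [Finset.sum_comm]
      simp only [← Finset.mul_sum,
        sum_mul_eq_zero (fun h => hne (Irr.eq_of_equivalent h).symm), mul_zero,
        Finset.sum_const_zero]
    · exact fun h => absurd (Finset.mem_univ c) h
  have hzero : (fun h : Γ => χ h⁻¹ - if h = 1 then (Fintype.card Γ : ℂ) else 0) = 0 := by
    refine eq_zero_of_irrRep _ fun ρ => ?_
    let c : Irr Γ := Irr.mk ρ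
    obtain ⟨A, B, hAB, -, hA⟩ := (Irr.rep_mk ρ).exists_matrix
    have hρ : ∀ h, (ρ.toHom h).1 = A * (c.rep.toHom h).1 * B := by
      intro h
      rw [hA h, Matrix.mul_assoc, hAB, Matrix.mul_one]
    have h1 : ∑ h, χ h⁻¹ • (ρ.toHom h).1 = (Fintype.card Γ : ℂ) • 1 := by
      have : ∑ h, χ h⁻¹ • (ρ.toHom h).1 = A * (∑ h, χ h⁻¹ • (c.rep.toHom h).1) * B := by
        rw [Matrix.mul_sum, Matrix.sum_mul]
        exact Finset.sum_congr rfl fun h _ => by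
          rw [hρ h, Matrix.mul_smul, Matrix.smul_mul]
      rw [this, hirr c, Matrix.mul_smul, Matrix.smul_mul, Matrix.mul_one, hAB]
    simp only [sub_smul, Finset.sum_sub_distrib, h1, ite_smul, zero_smul,
      Finset.sum_ite_eq', Finset.mem_univ, if_true, ρ.map_one_val, sub_self]
  have := congrFun hzero g⁻¹
  simp only [inv_inv, inv_eq_one, Pi.zero_apply, sub_eq_zero] at this
  exact this

end Completeness
end LiftCount
end

/-! ### Orthogonality and commutant for the sum of all irreducible representations -/

noncomputable section
namespace LiftCount

open Matrix

section RegularMatrix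

variable {Γ : Type*} [Group Γ]

instance : DecidableEq (Irr Γ) := Classical.decEq _

instance [Finite Γ] : Fintype (Irr Γ) := Fintype.ofFinite _

/-- The coordinates of the sum of all irreducible representations. -/
abbrev IrrIndex (Γ : Type*) [Group Γ] : Type _ := (c : Irr Γ) × Fin c.rep.dim

/-- The sum of all irreducible representations. -/
def sumRep (h : Γ) : Matrix (IrrIndex Γ) (IrrIndex Γ) ℂ :=
  Matrix.blockDiagonal' fun c => (c.rep.toHom h).1

theorem sumRep_same (h : Γ) (c : Irr Γ) (i j : Fin c.rep.dim) :
    sumRep h ⟨c, i⟩ ⟨c, j⟩ = (c.rep.toHom h).1 i j := Matrix.blockDiagonal'_apply_eq _ _ _ _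

theorem sumRep_of_ne (h : Γ) {i j : IrrIndex Γ} (hij : i.1 ≠ j.1) : sumRep h i j = 0 :=
  Matrix.blockDiagonal'_apply_ne _ _ _ hij

theorem sumRep_one : sumRep (1 : Γ) = 1 := by
  rw [sumRep, ← Matrix.blockDiagonal'_one]
  exact congrArg _ (funext fun c => c.rep.map_one_val)

theorem sum_sumRep_mul [Fintype Γ] (i j k l : IrrIndex Γ) :
    ∑ h : Γ, sumRep h i j * sumRep h⁻¹ k l
      = if i = l ∧ j = k ∧ i.1 = j.1 then (Fintype.card Γ : ℂ) / j.1.rep.dim else 0 := by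
  by_cases hij : i.1 = j.1
  swap
  · rw [if_neg (fun h => hij h.2.2)]
    exact Finset.sum_eq_zero fun h _ => by rw [sumRep_of_ne h hij, zero_mul]
  by_cases hkl : k.1 = l.1
  swap
  · rw [if_neg (fun h => hkl (by rw [← h.1, ← h.2.1, hij]))]
    exact Finset.sum_eq_zero fun h _ => by rw [sumRep_of_ne h⁻¹ hkl, mul_zero]
  obtain ⟨c, i⟩ := i
  obtain ⟨c₁, j⟩ := j
  obtain ⟨d, k⟩ := k
  obtain ⟨d₁, l⟩ := l
  dsimp only at hij hkl
  subst hij hkl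
  simp only [sumRep_same]
  by_cases hcd : c = d
  · subst hcd
    rw [sum_mul_self]
    simp
  · rw [sum_mul_eq_zero (fun h => hcd (Irr.eq_of_equivalent h)), if_neg]
    exact fun h => hcd (congrArg Sigma.fst h.1)

variable [Finite Γ]

theorem sumRep_mul (g h : Γ) : sumRep (g * h) = sumRep g * sumRep h := by
  rw [sumRep, sumRep, sumRep, ← Matrix.blockDiagonal'_mul]
  exact congrArg _ (funext fun c => c.rep.map_mul_val g h)

theorem sumRep_mul_inv (h : Γ) : sumRep h * sumRep h⁻¹ = 1 := by
  rw [← sumRep_mul, mul_inv_cancel, sumRep_one]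

theorem mul_sumRep_apply (X : Matrix (IrrIndex Γ) (IrrIndex Γ) ℂ) (h : Γ) (i : IrrIndex Γ)
    (c : Irr Γ) (k : Fin c.rep.dim) :
    (X * sumRep h) i ⟨c, k⟩ = ∑ m, X i ⟨c, m⟩ * (c.rep.toHom h).1 m k := by
  rw [Matrix.mul_apply, Fintype.sum_sigma, Finset.sum_eq_single c]
  · simp only [sumRep_same]
  · intro c' _ hne
    exact Finset.sum_eq_zero fun m _ => by rw [sumRep_of_ne h hne, mul_zero]
  · exact fun h => absurd (Finset.mem_univ c) h

theorem sumRep_mul_apply (X : Matrix (IrrIndex Γ) (IrrIndex Γ) ℂ) (h : Γ) (j : IrrIndex Γ)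
    (c : Irr Γ) (k : Fin c.rep.dim) :
    (sumRep h * X) ⟨c, k⟩ j = ∑ m, (c.rep.toHom h).1 k m * X ⟨c, m⟩ j := by
  rw [Matrix.mul_apply, Fintype.sum_sigma, Finset.sum_eq_single c]
  · simp only [sumRep_same]
  · intro c' _ hne
    exact Finset.sum_eq_zero fun m _ => by rw [sumRep_of_ne h (Ne.symm hne), zero_mul]
  · exact fun h => absurd (Finset.mem_univ c) h

/-- The commutant of the sum of all irreducible representations consists of the matrices that
are scalar on each of them. -/
theorem exists_eq_diagonal (X : Matrix (IrrIndex Γ) (IrrIndex Γ) ℂ)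
    (hX : ∀ h : Γ, sumRep h * X = X * sumRep h) :
    ∃ z : Irr Γ → ℂ, X = Matrix.diagonal fun i => z i.1 := by
  -- Each block intertwines two irreducible representations, so it is zero off the diagonal and
  -- scalar on it.
  have hblock : ∀ (c c' : Irr Γ) (h : Γ), (c.rep.toHom h).1 * (Matrix.of fun i j => X ⟨c, i⟩ ⟨c', j⟩)
      = (Matrix.of fun i j => X ⟨c, i⟩ ⟨c', j⟩) * (c'.rep.toHom h).1 := by
    intro c c' h
    ext i j
    have := congrFun (congrFun (hX h) ⟨c, i⟩) ⟨c', j⟩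
    rw [mul_sumRep_apply, sumRep_mul_apply] at this
    simpa only [Matrix.mul_apply, Matrix.of_apply] using this
  choose z hz using fun c : Irr Γ => c.rep.exists_eq_smul_one _ (hblock c c)
  refine ⟨z, ?_⟩
  ext ⟨c, i⟩ ⟨c', j⟩
  by_cases hc : c = c'
  · subst hc
    have h1 := congrFun (congrFun (hz c) i) j
    rw [Matrix.of_apply, Matrix.smul_apply, Matrix.one_apply, smul_eq_mul] at h1
    rw [h1, Matrix.diagonal_apply]
    by_cases hij : i = j
    · subst hij; simp
    · have : (⟨c, i⟩ : IrrIndex Γ) ≠ ⟨c, j⟩ := fun h => hij (eq_of_heq (Sigma.mk.inj h).2)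
      simp [hij]
  · have h1 := (c.rep.eq_zero_or_equivalent c'.rep _ (hblock c c')).resolve_right
      fun h => hc (Irr.eq_of_equivalent h)
    have h2 := congrFun (congrFun h1 i) j
    rw [Matrix.of_apply] at h2
    rw [h2, Matrix.diagonal_apply_ne _ (fun h => hc (congrArg Sigma.fst h)), Matrix.zero_apply]

open Classical in
theorem sum_dim_mul_sumRep [Fintype Γ] (h : Γ) :
    ∑ i : IrrIndex Γ, (i.1.rep.dim : ℂ) * sumRep h i i
      = if h = 1 then (Fintype.card Γ : ℂ) else 0 := by
  rw [← sum_dim_mul_trace, Fintype.sum_sigma]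
  refine Finset.sum_congr rfl fun c _ => ?_
  rw [Matrix.trace, Finset.mul_sum]
  exact Finset.sum_congr rfl fun i _ => by rw [sumRep_same, Matrix.diag_apply]

end RegularMatrix

/-! ### The action of G on the irreducible classes of the kernel -/

section Action

variable {G G' : Type*} [Group G] [Group G'] (q : G' →* G)

/-- The irreducible representation `h ↦ ρ(x⁻¹ h x)`. -/
def IrrRep.twist (ρ : IrrRep q.ker) (x : G') : IrrRep q.ker where
  dim := ρ.dim
  dim_pos := ρ.dim_pos
  toHom := LiftCount.twist q ρ.toHom x
  irreducible V hV := ρ.irreducible V fun h v hv => by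
    have := hV (MulAut.conjNormal x h) v hv
    simpa [LiftCount.twist] using this

variable {q}

theorem IrrRep.Equivalent.twist {σ ρ : IrrRep q.ker} (h : σ.Equivalent ρ) (x : G') :
    (σ.twist q x).Equivalent (ρ.twist q x) := by
  obtain ⟨n, hn, σ, hσ⟩ := σ
  obtain ⟨m, hm, ρ, hρ⟩ := ρ
  obtain ⟨e, h⟩ := h
  dsimp only at e
  subst e
  exact ⟨rfl, MatEquiv.twist h x⟩

variable (q)

/-- The class of the twist of a representation. -/
def Irr.twist (x : G') (c : Irr q.ker) : Irr q.ker := Irr.mk (c.rep.twist q x)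

theorem Irr.twist_twist (x y : G') (c : Irr q.ker) :
    Irr.twist q x (Irr.twist q y c) = Irr.twist q (x * y) c := by
  have h1 : Irr.twist q x (Irr.twist q y c) = Irr.mk ((c.rep.twist q y).twist q x) :=
    Irr.mk_eq_iff.2 ((Irr.rep_mk _).twist x)
  rw [h1, Irr.twist]
  congr 1
  simp only [IrrRep.twist, LiftCount.twist_twist]

theorem Irr.twist_eq_self_iff (x : G') (c : Irr q.ker) :
    Irr.twist q x c = c ↔ MatEquiv (LiftCount.twist q c.rep.toHom x) c.rep.toHom := by
  have h : Irr.twist q x c = c ↔ (c.rep.twist q x).Equivalent c.rep := by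
    rw [← Irr.mk_eq_iff, Irr.mk_rep, Irr.twist]
  rw [h]
  exact ⟨fun ⟨_, h⟩ => h, fun h => ⟨rfl, h⟩⟩

/-- Twisting by an element x of the kernel is conjugation by the matrix ρ(x). Hence the action of G'
on classes factors through G. -/
theorem Irr.twist_ker (x : q.ker) (c : Irr q.ker) : Irr.twist q x c = c := by
  rw [Irr.twist_eq_self_iff]
  refine ⟨c.rep.toHom x, fun h => ?_⟩
  rw [← map_inv, ← map_mul, ← map_mul]
  change c.rep.toHom _ = _
  congr 1
  ext
  simp

/-- The twists as permutations. -/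
def Irr.twistHom : G' →* Equiv.Perm (Irr q.ker) where
  toFun x :=
    { toFun := Irr.twist q x
      invFun := Irr.twist q x⁻¹
      left_inv := fun c => by
        rw [Irr.twist_twist, inv_mul_cancel]
        exact Irr.twist_ker q 1 c
      right_inv := fun c => by
        rw [Irr.twist_twist, mul_inv_cancel]
        exact Irr.twist_ker q 1 c }
  map_one' := Equiv.ext fun c => Irr.twist_ker q 1 c
  map_mul' x y := Equiv.ext fun c => (Irr.twist_twist q x y c).symm

variable {q} (hq : Function.Surjective q)

/-- The action of `G` on the irreducible representations of the kernel. -/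
def irrAction : G →* Equiv.Perm (Irr q.ker) :=
  q.liftOfSurjective hq ⟨Irr.twistHom q, fun x hx =>
    Equiv.ext fun c => Irr.twist_ker q ⟨x, hx⟩ c⟩

theorem irrAction_apply (x : G') (c : Irr q.ker) : irrAction hq (q x) c = Irr.twist q x c := by
  have := q.liftOfRightInverse_comp_apply _ (Function.rightInverse_surjInv hq)
    ⟨Irr.twistHom q, fun x hx => Equiv.ext fun c => Irr.twist_ker q ⟨x, hx⟩ c⟩ x
  exact DFunLike.congr_fun this c

theorem mem_stab_iff (a : G) (c : Irr q.ker) : a ∈ stab q c.rep ↔ irrAction hq a c = c := by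
  constructor
  · rintro ⟨x, rfl, hx⟩
    rw [irrAction_apply, Irr.twist_eq_self_iff]
    exact hx
  · intro h
    obtain ⟨x, rfl⟩ := hq a
    rw [irrAction_apply, Irr.twist_eq_self_iff] at h
    exact ⟨x, rfl, h⟩

end Action
end LiftCount
end

/-! ### The projective action of G' on the sum of the irreducible representations -/

noncomputable section
namespace LiftCount

open Matrix

section Blocks

variable {G G' : Type*} [Group G] [Group G'] {q : G' →* G} (hq : Function.Surjective q)

/-- The element `x⁻¹ h x` of the kernel. -/
def conjKer (x : G') (h : q.ker) : q.ker := MulAut.conjNormal x⁻¹ h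

theorem conjKer_val (x : G') (h : q.ker) : (conjKer x h : G') = x⁻¹ * h * x := by
  simp [conjKer]

theorem mul_conjKer (x : G') (h : q.ker) : x * (conjKer x h : G') = h * x := by
  rw [conjKer_val]; group

/-- The element `y⁻¹ x` of the kernel, for `x`, `y` with the same image. -/
def divKer {x y : G'} (h : q x = q y) : q.ker :=
  ⟨y⁻¹ * x, by rw [MonoidHom.mem_ker, map_mul, map_inv, h, inv_mul_cancel]⟩

/-- The matrix `M_α ρ(α̃⁻¹ x)` for `x` over `α`. -/
def stabMat (q : G' →* G) (ρ : IrrRep q.ker) (a : stab q ρ) (x : G') (hx : q x = a) :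
    Matrix (Fin ρ.dim) (Fin ρ.dim) ℂ :=
  (mat q ρ a).1 * (ρ.toHom (divKer (x := x) (hx.trans (q_lift q ρ a).symm))).1

/-- Between different classes any equivalence will do. Over a fixed class the block is prescribed by
the chosen `mat` and `lift`, so that the resulting scalars equal ζ itself and not merely a
cohomologous cocycle. -/
theorem exists_block (x : G') (c c' : Irr q.ker) (hc : irrAction hq (q x) c' = c) :
    ∃ (A : Matrix (Fin c.rep.dim) (Fin c'.rep.dim) ℂ) (B : Matrix (Fin c'.rep.dim) (Fin c.rep.dim) ℂ),
      A * B = 1 ∧ (∀ h, A * (c'.rep.toHom (conjKer x h)).1 = (c.rep.toHom h).1 * A) ∧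
      ∀ (e : c = c') (a : stab q c'.rep) (hx : q x = a),
        A = Matrix.of fun i j => stabMat q c'.rep a x hx (Fin.cast (by rw [e]) i) j := by
  by_cases e : c = c'
  · subst e
    have hx : q x ∈ stab q c.rep := (mem_stab_iff hq _ _).2 hc
    let M := mat q c.rep ⟨q x, hx⟩ * c.rep.toHom (divKer (x := x) (q_lift q c.rep ⟨q x, hx⟩).symm)
    refine ⟨M.1, (M⁻¹).1, ?_, fun h => ?_, fun _ a ha => ?_⟩
    · rw [← Units.val_mul, mul_inv_cancel, Units.val_one]
    · rw [← Units.val_mul, ← Units.val_mul]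
      congr 1
      simp only [M]
      have h1 := mat_spec q c.rep ⟨q x, hx⟩ h
      have h2 : divKer (x := x) (q_lift q c.rep ⟨q x, hx⟩).symm * conjKer x h
          = MulAut.conjNormal (lift q c.rep ⟨q x, hx⟩)⁻¹ h
            * divKer (x := x) (q_lift q c.rep ⟨q x, hx⟩).symm := by
        ext
        simp [divKer, conjKer_val, mul_assoc]
      rw [mul_assoc, ← map_mul, h2, map_mul, h1]
      group
    · obtain rfl : a = ⟨q x, hx⟩ := Subtype.ext ha.symm
      rfl
  · rw [irrAction_apply] at hc
    have h1 : (c'.rep.twist q x).Equivalent c.rep := by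
      rw [← Irr.mk_eq_iff, Irr.mk_rep]
      exact hc
    obtain ⟨A, B, hAB, -, hA⟩ := h1.exists_matrix
    exact ⟨A, B, hAB, hA, fun e' => absurd e' e⟩

variable [Finite q.ker]

theorem exists_intertwiner (x : G') :
    ∃ M N : Matrix (IrrIndex q.ker) (IrrIndex q.ker) ℂ, M * N = 1 ∧
      (∀ h, M * sumRep (conjKer x h) = sumRep h * M) ∧
      (∀ i j, irrAction hq (q x) j.1 ≠ i.1 → M i j = 0) ∧
      ∀ (c : Irr q.ker) (a : stab q c.rep) (hx : q x = a) (i j : Fin c.rep.dim),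
        M ⟨c, i⟩ ⟨c, j⟩ = stabMat q c.rep a x hx i j := by
  choose A B hAB hA hst using exists_block hq x
  let M : Matrix (IrrIndex q.ker) (IrrIndex q.ker) ℂ := fun i j =>
    if h : irrAction hq (q x) j.1 = i.1 then A i.1 j.1 h i.2 j.2 else 0
  let N : Matrix (IrrIndex q.ker) (IrrIndex q.ker) ℂ := fun i j =>
    if h : irrAction hq (q x) i.1 = j.1 then B j.1 i.1 h i.2 j.2 else 0
  refine ⟨M, N, ?_, fun h => ?_, fun i j h => dif_neg h, fun c a hx i j => ?_⟩
  · ext ⟨c, i⟩ ⟨c', j⟩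
    have hd : irrAction hq (q x) ((irrAction hq (q x)).symm c) = c := Equiv.apply_symm_apply _ _
    rw [Matrix.mul_apply, Fintype.sum_sigma, Finset.sum_eq_single ((irrAction hq (q x)).symm c)]
    · by_cases hc : c = c'
      · subst hc
        simp only [M, N, dif_pos hd]
        have := congrFun (congrFun (hAB _ _ hd) i) j
        rw [Matrix.mul_apply] at this
        rw [this, Matrix.one_apply, Matrix.one_apply]
        simp
      · rw [Matrix.one_apply_ne (fun h => hc (congrArg Sigma.fst h))]
        refine Finset.sum_eq_zero fun m _ => ?_
        simp only [N]
        rw [dif_neg (fun h => hc (hd.symm.trans h)), mul_zero]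
    · intro d _ hne
      refine Finset.sum_eq_zero fun m _ => ?_
      simp only [M]
      rw [dif_neg (fun h => hne (by rw [← h, Equiv.symm_apply_apply])), zero_mul]
    · exact fun h => absurd (Finset.mem_univ _) h
  · ext ⟨c, i⟩ ⟨c', j⟩
    rw [mul_sumRep_apply, sumRep_mul_apply]
    by_cases hc : irrAction hq (q x) c' = c
    · simp only [M, dif_pos hc]
      have := congrFun (congrFun (hA _ _ hc h) i) j
      rwa [Matrix.mul_apply, Matrix.mul_apply] at this
    · simp only [M, dif_neg hc, mul_zero, zero_mul, Finset.sum_const_zero]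
  · have h : irrAction hq (q x) c = c := (mem_stab_iff hq _ _).1 (by rw [hx]; exact a.2)
    simp only [M, dif_pos h]
    rw [hst c c h rfl a hx]
    rfl

end Blocks

/-- Matrices by which `G'` acts projectively on the sum of the irreducible representations of the
kernel. -/
structure ProjectiveAction {G G' : Type*} [Group G] [Group G'] {q : G' →* G}
    (hq : Function.Surjective q) [Finite q.ker] where
  P : G' → Matrix (IrrIndex q.ker) (IrrIndex q.ker) ℂ
  Q : G' → Matrix (IrrIndex q.ker) (IrrIndex q.ker) ℂ
  P_mul_Q : ∀ x, P x * Q x = 1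
  P_mul : ∀ x (h : q.ker), P (x * h) = P x * sumRep h
  mul_P : ∀ (h : q.ker) x, P (h * x) = sumRep h * P x
  support : ∀ x i j, irrAction hq (q x) j.1 ≠ i.1 → P x i j = 0
  stab_block : ∀ x (c : Irr q.ker) (a : stab q c.rep) (hx : q x = a) (i j : Fin c.rep.dim),
    P x ⟨c, i⟩ ⟨c, j⟩ = stabMat q c.rep a x hx i j

variable {G G' : Type*} [Group G] [Group G'] {q : G' →* G} (hq : Function.Surjective q)
  [Finite q.ker]

/-- Intertwiners are chosen for one representative of each coset of the kernel and extended by right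
multiplication with `sumRep`. Left equivariance is then the intertwining relation. -/
theorem nonempty_projectiveAction : Nonempty (ProjectiveAction hq) := by
  let r : G → G' := Function.surjInv hq
  have hr : ∀ a, q (r a) = a := Function.surjInv_eq hq
  choose M N hMN hM hsupp hst using fun a : G => exists_intertwiner hq (r a)
  let k : G' → q.ker := fun x => divKer (x := x) (hr (q x)).symm
  have hk : ∀ x, r (q x) * (k x : G') = x := fun x => mul_inv_cancel_left _ _
  have hq1 : ∀ h : q.ker, q (h : G') = 1 := fun h => h.2
  refine ⟨⟨fun x => M (q x) * sumRep (k x), fun x => sumRep (k x)⁻¹ * N (q x), fun x => ?_,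
    fun x h => ?_, fun h x => ?_, fun x i j hij => ?_, fun x c a hx i j => ?_⟩⟩
  · rw [Matrix.mul_assoc, ← Matrix.mul_assoc (sumRep (k x)), sumRep_mul_inv, Matrix.one_mul, hMN]
  · have h1 : q (x * (h : G')) = q x := by rw [map_mul, hq1, mul_one]
    have h2 : k (x * h) = k x * h := by
      ext
      have := hk (x * h)
      rw [h1] at this
      apply mul_left_cancel (a := r (q x))
      rw [this, Subgroup.coe_mul, ← mul_assoc, hk]
    rw [h1, h2, sumRep_mul, Matrix.mul_assoc]
  · have h1 : q ((h : G') * x) = q x := by rw [map_mul, hq1, one_mul]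
    have h2 : k (h * x) = conjKer (r (q x)) h * k x := by
      ext
      have := hk (h * x)
      rw [h1] at this
      apply mul_left_cancel (a := r (q x))
      rw [this, Subgroup.coe_mul, ← mul_assoc, mul_conjKer, mul_assoc, hk]
    rw [h1, h2, sumRep_mul, ← Matrix.mul_assoc, hM, Matrix.mul_assoc]
  · obtain ⟨c, j⟩ := j
    rw [mul_sumRep_apply]
    refine Finset.sum_eq_zero fun m _ => ?_
    rw [hsupp (q x) i ⟨c, m⟩ (by rw [hr]; exact hij), zero_mul]
  · have hra : q (r (q x)) = a := (hr _).trans hx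
    have key : stabMat q c.rep a x hx
        = stabMat q c.rep a (r (q x)) hra * (c.rep.toHom (k x)).1 := by
      unfold stabMat
      rw [Matrix.mul_assoc, ← IrrRep.map_mul_val]
      congr 3
      ext
      simp [divKer, k, mul_assoc]
    rw [mul_sumRep_apply, key, Matrix.mul_apply]
    exact Finset.sum_congr rfl fun m _ => by rw [hst (q x) c a hra]

namespace ProjectiveAction

variable {hq} (D : ProjectiveAction hq)

theorem Q_mul_P (x : G') : D.Q x * D.P x = 1 := mul_eq_one_comm.1 (D.P_mul_Q x)

theorem Q_mul (x : G') (h : q.ker) : D.Q (x * h) = sumRep h⁻¹ * D.Q x := by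
  have h1 : D.P (x * h) * (sumRep h⁻¹ * D.Q x) = 1 := by
    rw [D.P_mul, Matrix.mul_assoc, ← Matrix.mul_assoc (sumRep h), sumRep_mul_inv, Matrix.one_mul,
      D.P_mul_Q]
  calc D.Q (x * h) = D.Q (x * h) * (D.P (x * h) * (sumRep h⁻¹ * D.Q x)) := by
        rw [h1, Matrix.mul_one]
    _ = _ := by rw [← Matrix.mul_assoc, D.Q_mul_P, Matrix.one_mul]

theorem P_mul_sumRep_conj (x : G') (h : q.ker) :
    D.P x * sumRep (conjKer x h) = sumRep h * D.P x := by
  rw [← D.P_mul, ← D.mul_P, mul_conjKer]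

theorem Q_mul_sumRep (x : G') (h : q.ker) :
    D.Q x * sumRep h = sumRep (conjKer x h) * D.Q x := by
  calc D.Q x * sumRep h = D.Q x * (sumRep h * D.P x) * D.Q x := by
        rw [Matrix.mul_assoc, Matrix.mul_assoc, D.P_mul_Q, Matrix.mul_one]
    _ = _ := by
        rw [← D.P_mul_sumRep_conj, ← Matrix.mul_assoc, D.Q_mul_P, Matrix.one_mul]

-- With x = x₀h the coset sum becomes Schur orthogonality over h in the kernel. The support of `P
-- x₀` turns equality of the inner classes into the condition on the action, and `P x₀ * Q x₀ = 1`
-- removes the remaining inner sum.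
open Classical in
theorem sum_P_mul_Q [Fintype q.ker] (a : G) [Fintype {x : G' // q x = a}]
    (i j k l : IrrIndex q.ker) :
    ∑ x : {x : G' // q x = a}, D.P x i j * D.Q x k l
      = if j = k ∧ i = l ∧ irrAction hq a j.1 = i.1
        then (Fintype.card q.ker : ℂ) / j.1.rep.dim else 0 := by
  obtain ⟨x₀, rfl⟩ := hq a
  let e : q.ker ≃ {x : G' // q x = q x₀} :=
    { toFun := fun h => ⟨x₀ * h, by rw [map_mul, show q (h : G') = 1 from h.2, mul_one]⟩
      invFun := fun x => divKer (x := x) x.2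
      left_inv := fun h => Subtype.ext (inv_mul_cancel_left _ _)
      right_inv := fun x => Subtype.ext (mul_inv_cancel_left _ _) }
  rw [← e.sum_comp]
  have h1 : ∀ h : q.ker, D.P (e h) i j * D.Q (e h) k l
      = ∑ m, ∑ n, D.P x₀ i m * D.Q x₀ n l * (sumRep h m j * sumRep h⁻¹ k n) := by
    intro h
    change D.P (x₀ * h) i j * D.Q (x₀ * h) k l = _
    rw [D.P_mul, D.Q_mul, Matrix.mul_apply, Matrix.mul_apply, Finset.sum_mul_sum]
    exact Finset.sum_congr rfl fun m _ => Finset.sum_congr rfl fun n _ => by ring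
  rw [Finset.sum_congr rfl fun h _ => h1 h, Finset.sum_comm]
  simp only [Finset.sum_comm (s := (Finset.univ : Finset q.ker)), ← Finset.mul_sum,
    sum_sumRep_mul]
  have h2 : ∀ m, ∑ n, D.P x₀ i m * D.Q x₀ n l *
      (if m = n ∧ j = k ∧ m.1 = j.1 then (Fintype.card q.ker : ℂ) / j.1.rep.dim else 0)
      = (if j = k ∧ irrAction hq (q x₀) j.1 = i.1
          then (Fintype.card q.ker : ℂ) / j.1.rep.dim else 0) * (D.P x₀ i m * D.Q x₀ m l) := by
    intro m
    rw [Finset.sum_eq_single m]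
    · by_cases hP : irrAction hq (q x₀) m.1 = i.1
      · have : m.1 = j.1 ↔ irrAction hq (q x₀) j.1 = i.1 := by
          rw [← hP]
          exact ⟨fun h => by rw [h], fun h => ((irrAction hq (q x₀)).injective h).symm⟩
        simp only [true_and, this]
        ring
      · rw [D.support _ _ _ hP]
        ring
    · intro n _ hn
      rw [if_neg (fun h => hn h.1.symm), mul_zero]
    · exact fun h => absurd (Finset.mem_univ _) h
  rw [Finset.sum_congr rfl fun m _ => h2 m, ← Finset.mul_sum, ← Matrix.mul_apply, D.P_mul_Q,
    Matrix.one_apply]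
  by_cases h3 : i = l <;> by_cases h4 : j = k ∧ irrAction hq (q x₀) j.1 = i.1 <;>
    simp [h3, h4]

end ProjectiveAction
end LiftCount
end

/-! ### Comparison scalars and the weight of a triangle -/

noncomputable section
namespace LiftCount

open Matrix

namespace ProjectiveAction

variable {G G' : Type*} [Group G] [Group G'] {q : G' →* G} {hq : Function.Surjective q}
  [Finite q.ker] (D : ProjectiveAction hq)

/-- Both `P (x * y)` and `P x * P y` intertwine conjugation by xy, so their quotient lies in the
commutant and is scalar on each irreducible summand. -/
theorem sumRep_mul_comparison (x y : G') (h : q.ker) :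
    sumRep h * (D.P (x * y) * D.Q y * D.Q x) = D.P (x * y) * D.Q y * D.Q x * sumRep h := by
  have h1 : conjKer (x * y) h = conjKer y (conjKer x h) := by
    ext
    simp [conjKer_val, mul_assoc]
  calc sumRep h * (D.P (x * y) * D.Q y * D.Q x)
      = sumRep h * D.P (x * y) * D.Q y * D.Q x := by simp only [Matrix.mul_assoc]
    _ = D.P (x * y) * (sumRep (conjKer y (conjKer x h)) * D.Q y) * D.Q x := by
        rw [← D.P_mul_sumRep_conj, h1, Matrix.mul_assoc (D.P (x * y))]
    _ = D.P (x * y) * D.Q y * (sumRep (conjKer x h) * D.Q x) := by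
        rw [← D.Q_mul_sumRep]
        simp only [Matrix.mul_assoc]
    _ = _ := by rw [← D.Q_mul_sumRep, Matrix.mul_assoc _ (D.Q x)]

/-- Changing x and y by kernel elements inserts factors `sumRep` that cancel, so the scalars depend
only on the images in G. -/
theorem comparison_eq_of_eq {x y x' y' : G'} (hx : q x' = q x) (hy : q y' = q y) :
    D.P (x' * y') * D.Q y' * D.Q x' = D.P (x * y) * D.Q y * D.Q x := by
  obtain ⟨h, rfl⟩ : ∃ h : q.ker, x' = x * h := ⟨divKer hx, (mul_inv_cancel_left _ _).symm⟩
  obtain ⟨k, rfl⟩ : ∃ k : q.ker, y' = y * k := ⟨divKer hy, (mul_inv_cancel_left _ _).symm⟩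
  have h1 : x * (h : G') * (y * k) = x * y * ((conjKer y h * k : q.ker) : G') := by
    rw [Subgroup.coe_mul, conjKer_val]
    group
  rw [h1, D.P_mul, D.Q_mul, D.Q_mul, sumRep_mul]
  calc D.P (x * y) * (sumRep (conjKer y h) * sumRep k) * (sumRep k⁻¹ * D.Q y)
        * (sumRep h⁻¹ * D.Q x)
      = D.P (x * y) * (sumRep (conjKer y h) * (sumRep k * sumRep k⁻¹) * D.Q y)
        * (sumRep h⁻¹ * D.Q x) := by simp only [Matrix.mul_assoc]
    _ = D.P (x * y) * D.Q y * (sumRep h * sumRep h⁻¹) * D.Q x := by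
        rw [sumRep_mul_inv, Matrix.mul_one, ← D.Q_mul_sumRep]
        simp only [Matrix.mul_assoc]
    _ = _ := by rw [sumRep_mul_inv, Matrix.mul_one]

theorem exists_scalar : ∃ z : G → G → Irr q.ker → ℂ, ∀ x y,
    D.P (x * y) = Matrix.diagonal (fun i => z (q x) (q y) i.1) * (D.P x * D.P y) := by
  let r : G → G' := Function.surjInv hq
  have hr : ∀ a, q (r a) = a := Function.surjInv_eq hq
  choose z hz using fun a b => exists_eq_diagonal _ (D.sumRep_mul_comparison (r a) (r b))
  refine ⟨z, fun x y => ?_⟩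
  rw [← hz, ← D.comparison_eq_of_eq (hr (q x)).symm (hr (q y)).symm]
  calc D.P (x * y) = D.P (x * y) * (D.Q y * (D.Q x * D.P x) * D.P y) := by
        rw [D.Q_mul_P, Matrix.mul_one, D.Q_mul_P, Matrix.mul_one]
    _ = _ := by simp only [Matrix.mul_assoc]

/-- The scalars that measure the failure of multiplicativity. -/
def scalar : G → G → Irr q.ker → ℂ := D.exists_scalar.choose

theorem P_mul_eq (x y : G') :
    D.P (x * y) = Matrix.diagonal (fun i => D.scalar (q x) (q y) i.1) * (D.P x * D.P y) :=
  D.exists_scalar.choose_spec x y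

theorem scalar_ne_zero (a b : G) (c : Irr q.ker) : D.scalar a b c ≠ 0 := by
  obtain ⟨x, rfl⟩ := hq a
  obtain ⟨y, rfl⟩ := hq b
  intro h
  have h1 := D.P_mul_Q (x * y)
  rw [D.P_mul_eq, Matrix.mul_assoc] at h1
  have h2 := congrFun (congrFun h1 ⟨c, ⟨0, c.rep.dim_pos⟩⟩) ⟨c, ⟨0, c.rep.dim_pos⟩⟩
  rw [Matrix.diagonal_mul, Matrix.one_apply_eq, h, zero_mul] at h2
  exact zero_ne_one h2

/-- Evaluate the product rule at the chosen lifts of α and β. On the block of c the support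
condition leaves only `M_α M_β`, while the left side is `M_{αβ}` times ρ of the defect; this is the
equation that defines ζ. -/
theorem scalar_eq_zeta (c : Irr q.ker) (α β : stab q c.rep) :
    D.scalar α β c = zeta q c.rep α β := by
  have hne : (mat q c.rep α).1 * (mat q c.rep β).1 ≠ 0 := by
    have : Nonempty (Fin c.rep.dim) := ⟨⟨0, c.rep.dim_pos⟩⟩
    rw [← Units.val_mul]
    exact Units.ne_zero _
  have hdiv : ∀ x : G', divKer (q := q) (x := x) (y := x) rfl = 1 := fun x =>
    Subtype.ext (inv_mul_cancel x)
  have hst : ∀ γ : stab q c.rep,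
      stabMat q c.rep γ (lift q c.rep γ) (q_lift q c.rep γ) = (mat q c.rep γ).1 := by
    intro γ
    rw [stabMat, hdiv, IrrRep.map_one_val, Matrix.mul_one]
  refine smul_left_injective ℂ hne ?_
  change D.scalar α β c • _ = (zeta q c.rep α β : ℂ) • _
  rw [zeta_spec]
  ext i j
  have hqxy : q (lift q c.rep α * lift q c.rep β) = ((α * β : stab q c.rep) : G) := by
    rw [map_mul, q_lift, q_lift, Subgroup.coe_mul]
  have h1 := D.stab_block _ c (α * β) hqxy i j
  have hβ : irrAction hq (q (lift q c.rep β)) c = c :=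
    (mem_stab_iff hq _ _).1 (by rw [q_lift]; exact β.2)
  rw [D.P_mul_eq, Matrix.diagonal_mul, Matrix.mul_apply, Fintype.sum_sigma,
    Finset.sum_eq_single c, q_lift, q_lift] at h1
  · rw [Matrix.smul_apply, smul_eq_mul, Matrix.mul_apply, ← hst α, ← hst β]
    refine Eq.trans (congrArg _ (Finset.sum_congr rfl fun m _ => ?_)) (h1.trans ?_)
    · rw [D.stab_block _ c α (q_lift q c.rep α), D.stab_block _ c β (q_lift q c.rep β)]
    · have h2 : divKer (x := lift q c.rep α * lift q c.rep β)
          (hqxy.trans (q_lift q c.rep (α * β)).symm) = defect q c.rep α β := by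
        ext
        simp [divKer, defect, mul_assoc]
      rw [stabMat, h2]
  · intro d _ hd
    refine Finset.sum_eq_zero fun m _ => ?_
    rw [D.support (lift q c.rep β) ⟨d, m⟩ ⟨c, j⟩ (fun h => hd (h.symm.trans hβ)), mul_zero]
  · exact fun h => absurd (Finset.mem_univ c) h

theorem Q_mul_Q (x y : G') :
    D.Q y * D.Q x = D.Q (x * y) * Matrix.diagonal (fun i => D.scalar (q x) (q y) i.1) := by
  have h1 : D.Q (x * y) * Matrix.diagonal (fun i => D.scalar (q x) (q y) i.1)
      * (D.P x * D.P y) = 1 := by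
    rw [Matrix.mul_assoc, ← D.P_mul_eq, D.Q_mul_P]
  calc D.Q y * D.Q x = D.Q (x * y) * Matrix.diagonal (fun i => D.scalar (q x) (q y) i.1)
        * (D.P x * D.P y) * (D.Q y * D.Q x) := by rw [h1, Matrix.one_mul]
    _ = D.Q (x * y) * Matrix.diagonal (fun i => D.scalar (q x) (q y) i.1)
        * (D.P x * (D.P y * D.Q y) * D.Q x) := by simp only [Matrix.mul_assoc]
    _ = _ := by rw [D.P_mul_Q, Matrix.mul_one, D.P_mul_Q, Matrix.mul_one]

-- Writing x = ky with k in the kernel, `P x * Q y` is `sumRep k`, and the sum is the regular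
-- character at k.
open Classical in
theorem sum_dim_mul_P_mul_Q {x y : G'} (h : q x = q y) :
    ∑ i : IrrIndex q.ker, (i.1.rep.dim : ℂ) * (D.P x * D.Q y) i i
      = if x = y then (Nat.card q.ker : ℂ) else 0 := by
  have : Fintype q.ker := Fintype.ofFinite _
  let k : q.ker := ⟨x * y⁻¹, by rw [MonoidHom.mem_ker, map_mul, map_inv, h, mul_inv_cancel]⟩
  have hx : x = k * y := (inv_mul_cancel_right x y).symm
  have hk : k = 1 ↔ x = y := by
    rw [Subtype.ext_iff]
    exact mul_inv_eq_one
  rw [hx, D.mul_P, Matrix.mul_assoc, D.P_mul_Q, Matrix.mul_one, sum_dim_mul_sumRep, ← hx,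
    Nat.card_eq_fintype_card]
  simp only [hk]

/-- The weight of a side of a triangle, according to its sign. -/
def side (ε : ℤˣ) (x : G') (i j : IrrIndex q.ker) : ℂ := if ε = 1 then D.P x i j else D.Q x j i

end ProjectiveAction

theorem sum_fin_three {I M : Type*} [Fintype I] [AddCommMonoid M] (F : I → I → I → M) :
    ∑ c : Fin 3 → I, F (c 0) (c 1) (c 2) = ∑ i, ∑ j, ∑ k, F i j k := by
  let e : I × I × I ≃ (Fin 3 → I) :=
    { toFun := fun p => ![p.1, p.2.1, p.2.2]
      invFun := fun c => (c 0, c 1, c 2)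
      left_inv := fun _ => rfl
      right_inv := fun c => by ext i; fin_cases i <;> rfl }
  rw [← e.sum_comp, Fintype.sum_prod_type]
  exact Finset.sum_congr rfl fun i _ => Fintype.sum_prod_type _

namespace ProjectiveAction

variable {G G' : Type*} [Group G] [Group G'] {q : G' →* G} {hq : Function.Surjective q}
  [Finite q.ker] (D : ProjectiveAction hq)

open Classical in
/-- The condition that a labeling is flat on a triangle, as a sum over colorings of its corners. -/
theorem sum_triangle (ε : ℤˣ) (f : Fin 3 → G') (hf : q (f 2) * q (f 0) = q (f 1)) :
    ∑ c : Fin 3 → IrrIndex q.ker,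
      ((c 0).1.rep.dim * D.scalar (q (f 2)) (q (f 0)) (c 0).1 ^ (ε : ℤ)) *
        ∏ i : Fin 3, D.side (ε * (-1) ^ (i : ℕ)) (f i) (c (i.succAbove 0)) (c (i.succAbove 1))
      = if f 2 * f 0 = f 1 then (Nat.card q.ker : ℂ) else 0 := by
  have h20 : q (f 2 * f 0) = q (f 1) := by rw [map_mul, hf]
  have hs : ∀ i : Fin 3, ∀ c : Fin 3 → IrrIndex q.ker, c (i.succAbove 0) = ![c 1, c 0, c 0] i ∧
      c (i.succAbove 1) = ![c 2, c 2, c 1] i := by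
    intro i c; fin_cases i <;> exact ⟨rfl, rfl⟩
  simp only [hs]
  have hneg : ¬ ((-1 : ℤˣ) = 1) := by decide
  rcases Int.units_eq_one_or ε with rfl | rfl
  -- Positive triangle: sides 0 and 2 give entries of P and side 1 an entry of Q, and the sum
  -- expands the diagonal entries of P(f₂f₀)Q(f₁).
  · rw [← D.sum_dim_mul_P_mul_Q h20]
    simp only [side, Fin.prod_univ_three, Fin.val_zero, Fin.val_one, Fin.val_two, pow_zero,
      pow_one, one_mul, even_two.neg_pow, one_pow, if_true, hneg, if_false,
      Units.val_one, zpow_one, Matrix.cons_val]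
    rw [sum_fin_three fun i j k => ((i.1.rep.dim : ℂ) * D.scalar (q (f 2)) (q (f 0)) i.1)
      * (D.P (f 0) j k * D.Q (f 1) k i * D.P (f 2) i j)]
    refine Finset.sum_congr rfl fun i _ => ?_
    rw [D.P_mul_eq, Matrix.mul_assoc, Matrix.diagonal_mul, Matrix.mul_assoc, Matrix.mul_apply,
      Finset.mul_sum, Finset.mul_sum]
    refine Finset.sum_congr rfl fun j _ => ?_
    rw [Matrix.mul_apply, Finset.mul_sum, Finset.mul_sum, Finset.mul_sum]
    exact Finset.sum_congr rfl fun k _ => by ring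
  -- Negative triangle: the roles of P and Q are exchanged, so P(f₁)Q(f₂f₀) is expanded and the
  -- scalar appears inverted.
  · have : (if f 2 * f 0 = f 1 then (Nat.card q.ker : ℂ) else 0)
        = if f 1 = f 2 * f 0 then (Nat.card q.ker : ℂ) else 0 := by simp only [eq_comm]
    rw [this, ← D.sum_dim_mul_P_mul_Q h20.symm]
    simp only [side, Fin.prod_univ_three, Fin.val_zero, Fin.val_one, Fin.val_two, pow_zero,
      pow_one, mul_one, even_two.neg_pow, one_pow, if_true, hneg, if_false,
      Units.val_neg, Units.val_one, _root_.zpow_neg, zpow_one, Matrix.cons_val, mul_neg, neg_neg]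
    rw [sum_fin_three fun i j k => ((i.1.rep.dim : ℂ) * (D.scalar (q (f 2)) (q (f 0)) i.1)⁻¹)
      * (D.Q (f 0) k j * D.P (f 1) i k * D.Q (f 2) j i)]
    refine Finset.sum_congr rfl fun i _ => ?_
    have h1 : (D.P (f 1) * D.Q (f 2 * f 0)) i i
        = (D.scalar (q (f 2)) (q (f 0)) i.1)⁻¹ * (D.P (f 1) * (D.Q (f 0) * D.Q (f 2))) i i := by
      rw [D.Q_mul_Q, ← Matrix.mul_assoc, Matrix.mul_diagonal, mul_comm _ (D.scalar _ _ _),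
        inv_mul_cancel_left₀ (D.scalar_ne_zero _ _ _)]
    rw [h1, ← Matrix.mul_assoc, Matrix.mul_apply, Finset.mul_sum, Finset.mul_sum]
    refine Finset.sum_congr rfl fun j _ => ?_
    rw [Matrix.mul_apply, Finset.sum_mul, Finset.mul_sum, Finset.mul_sum]
    exact Finset.sum_congr rfl fun k _ => by ring

end ProjectiveAction
end LiftCount
end

/-! ### The state sum over colorings of the corners -/

noncomputable section
namespace LiftCount

namespace OrientedGluing

variable {T : Type*} (K : OrientedGluing T)

/-- The sign of a side in the boundary of the oriented triangles. -/
def sideSign (s : T × Fin 3) : ℤˣ := K.sgn s.1 * (-1) ^ (s.2 : ℕ)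

theorem sideSign_glue (s : T × Fin 3) : K.sideSign (K.glue s) = -K.sideSign s := K.sgn_glue s

/-- The sides with positive sign. -/
abbrev PosSide : Type _ := {s : T × Fin 3 // K.sideSign s = 1}

theorem sideSign_glue_eq_one_iff (s : T × Fin 3) :
    K.sideSign (K.glue s) = 1 ↔ ¬ K.sideSign s = 1 := by
  rw [sideSign_glue]
  rcases Int.units_eq_one_or (K.sideSign s) with h | h <;> rw [h] <;> decide

/-- The positive one among a side and the side glued to it. -/
def posSide (s : T × Fin 3) : K.PosSide :=
  if h : K.sideSign s = 1 then ⟨s, h⟩ else ⟨K.glue s, (K.sideSign_glue_eq_one_iff s).2 h⟩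

theorem posSide_coe (p : K.PosSide) : K.posSide p.1 = p := dif_pos p.2

theorem posSide_glue (s : T × Fin 3) : K.posSide (K.glue s) = K.posSide s := by
  by_cases h : K.sideSign s = 1
  · rw [posSide, dif_neg (fun h' => (K.sideSign_glue_eq_one_iff s).1 h' h), posSide, dif_pos h]
    exact Subtype.ext (K.glue_glue s)
  · rw [posSide, dif_pos ((K.sideSign_glue_eq_one_iff s).2 h), posSide, dif_neg h]

theorem apply_posSide {X : Type*} (f : T × Fin 3 → X) (hf : ∀ s, f (K.glue s) = f s)
    (s : T × Fin 3) : f (K.posSide s).1 = f s := by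
  by_cases h : K.sideSign s = 1
  · rw [posSide, dif_pos h]
  · rw [posSide, dif_neg h, hf]

/-- Each edge is the class of exactly one positive side. -/
def edgeEquiv : K.Edge ≃ K.PosSide where
  toFun := Quot.lift K.posSide (by rintro a _ rfl; exact (K.posSide_glue a).symm)
  invFun p := Quot.mk _ p.1
  left_inv e := by
    obtain ⟨s⟩ := e
    exact K.apply_posSide (Quot.mk fun a b => b = K.glue a)
      (fun s => (Quot.sound (r := fun a b => b = K.glue a) rfl).symm) s
  right_inv p := K.posSide_coe p

theorem prod_sides [Fintype T] [Fintype K.PosSide] {M : Type*} [CommMonoid M]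
    (F : T × Fin 3 → M) :
    ∏ s, F s = ∏ p : K.PosSide, F p.1 * F (K.glue p.1) := by
  classical
  obtain rfl : ‹Fintype K.PosSide› = Subtype.fintype _ := Subsingleton.elim _ _
  let e : K.PosSide ≃ {s : T × Fin 3 // ¬ K.sideSign s = 1} :=
    { toFun := fun p => ⟨K.glue p.1, fun h => (K.sideSign_glue_eq_one_iff _).1 h p.2⟩
      invFun := fun p => ⟨K.glue p.1, (K.sideSign_glue_eq_one_iff _).2 p.2⟩
      left_inv := fun p => Subtype.ext (K.glue_glue _)
      right_inv := fun p => Subtype.ext (K.glue_glue _) }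
  rw [← Fintype.prod_subtype_mul_prod_subtype (fun s => K.sideSign s = 1), ← e.prod_comp,
    Finset.prod_mul_distrib]
  rfl

section Fibre

variable {G G' : Type*} [Group G] [Group G'] (q : G' →* G) (a : T × Fin 3 → G)

/-- The side labeling with given values over the positive sides. -/
def extendLabel (y : ∀ p : K.PosSide, {x : G' // q x = a p.1}) (s : T × Fin 3) : G' :=
  (y (K.posSide s)).1

variable {K q a}

theorem map_extendLabel (ha : ∀ s, a (K.glue s) = a s)
    (y : ∀ p : K.PosSide, {x : G' // q x = a p.1}) (s : T × Fin 3) :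
    q (K.extendLabel q a y s) = a s :=
  (y (K.posSide s)).2.trans (K.apply_posSide a ha s)

/-- Flat lifts in terms of their values on the positive sides. -/
def flatLiftsEquiv (ha : ∀ s, a (K.glue s) = a s) :
    K.FlatLifts q a ≃ {y : ∀ p : K.PosSide, {x : G' // q x = a p.1} //
      ∀ t, K.extendLabel q a y (t, 2) * K.extendLabel q a y (t, 0) = K.extendLabel q a y (t, 1)} where
  toFun f := ⟨fun p => ⟨f.1 p.1, f.2.2 p.1⟩, fun t => by
    simp only [extendLabel, K.apply_posSide f.1 f.2.1.glue]
    exact f.2.1.mul t⟩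
  invFun y := ⟨K.extendLabel q a y.1,
    ⟨fun s => by rw [extendLabel, posSide_glue, extendLabel], y.2⟩, map_extendLabel ha y.1⟩
  left_inv f := Subtype.ext (funext fun s => K.apply_posSide f.1 f.2.1.glue s)
  right_inv y := Subtype.ext (funext fun p => Subtype.ext (by
    change (y.1 (K.posSide p.1)).1 = _
    rw [posSide_coe]))

end Fibre

variable {K}

/-- The colorings of the corners that contribute to the state sum. -/
def IsColoring (K : OrientedGluing T) {G G' : Type*} [Group G] [Group G'] {q : G' →* G}
    (hq : Function.Surjective q) (a : T × Fin 3 → G) (C : T → Fin 3 → IrrIndex q.ker) : Prop :=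
  ∀ p : K.PosSide,
    C p.1.1 (p.1.2.succAbove 1) = C (K.glue p.1).1 ((K.glue p.1).2.succAbove 1) ∧
    C p.1.1 (p.1.2.succAbove 0) = C (K.glue p.1).1 ((K.glue p.1).2.succAbove 0) ∧
    irrAction hq (a p.1) (C p.1.1 (p.1.2.succAbove 1)).1 = (C p.1.1 (p.1.2.succAbove 0)).1

theorem finite_fibre {G G' : Type*} [Group G] [Group G'] (q : G' →* G) [Finite q.ker] (a : G) :
    Finite {x : G' // q x = a} := by
  by_cases h : Nonempty {x : G' // q x = a}
  · obtain ⟨y, hy⟩ := h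
    refine Finite.of_injective (fun x => divKer (x := x.1) (x.2.trans hy.symm)) fun x x' h => ?_
    exact Subtype.ext (mul_left_cancel (congrArg Subtype.val h))
  · have := not_nonempty_iff.1 h
    infer_instance

variable [Fintype T] {G G' : Type*} [Group G] [Group G'] {q : G' →* G}
  {hq : Function.Surjective q} [Finite q.ker] (D : ProjectiveAction hq) {a : T × Fin 3 → G}

open Classical in
/-- The number of flat lifts as a state sum. -/
theorem card_flatLifts_eq_sum [Fintype K.PosSide] (ha : K.IsFlat a) :
    (Nat.card q.ker : ℂ) ^ Fintype.card T * Nat.card (K.FlatLifts q a)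
      = ∑ C : T → Fin 3 → IrrIndex q.ker,
        (∏ t, (C t 0).1.rep.dim * D.scalar (a (t, 2)) (a (t, 0)) (C t 0).1 ^ (K.sgn t : ℤ)) *
          if K.IsColoring hq a C then
            ∏ p : K.PosSide, (Nat.card q.ker : ℂ) / (C p.1.1 (p.1.2.succAbove 1)).1.rep.dim
          else 0 := by
  have : Fintype q.ker := Fintype.ofFinite _
  have : ∀ b : G, Fintype {x : G' // q x = b} := fun b =>
    have := finite_fibre q b
    Fintype.ofFinite _
  let Y := ∀ p : K.PosSide, {x : G' // q x = a p.1}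
  -- Labels on the positive sides are arbitrary in their cosets; the product over triangles is |Γ|^T
  -- when the labeling is flat and 0 otherwise.
  have hcard : (Nat.card q.ker : ℂ) ^ Fintype.card T * Nat.card (K.FlatLifts q a)
      = ∑ y : Y, ∏ t, if K.extendLabel q a y (t, 2) * K.extendLabel q a y (t, 0)
          = K.extendLabel q a y (t, 1) then (Nat.card q.ker : ℂ) else 0 := by
    simp only [Finset.prod_ite_zero, Finset.prod_const, Finset.card_univ, Finset.mem_univ,
      true_imp_iff]
    rw [← Finset.sum_filter, Finset.sum_const, nsmul_eq_mul, mul_comm,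
      Nat.card_congr (flatLiftsEquiv ha.glue), Nat.card_eq_fintype_card, Fintype.card_subtype]
  have hstate : ∀ y : Y, (∏ t, if K.extendLabel q a y (t, 2) * K.extendLabel q a y (t, 0)
          = K.extendLabel q a y (t, 1) then (Nat.card q.ker : ℂ) else 0)
      = ∑ C : T → Fin 3 → IrrIndex q.ker,
        (∏ t, (C t 0).1.rep.dim * D.scalar (a (t, 2)) (a (t, 0)) (C t 0).1 ^ (K.sgn t : ℤ)) *
          ∏ p : K.PosSide,
            D.P (y p).1 (C p.1.1 (p.1.2.succAbove 0)) (C p.1.1 (p.1.2.succAbove 1)) *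
            D.Q (y p).1 (C (K.glue p.1).1 ((K.glue p.1).2.succAbove 1))
              (C (K.glue p.1).1 ((K.glue p.1).2.succAbove 0)) := by
    intro y
    have hy := map_extendLabel ha.glue y
    have h1 : ∀ t, (if K.extendLabel q a y (t, 2) * K.extendLabel q a y (t, 0)
          = K.extendLabel q a y (t, 1) then (Nat.card q.ker : ℂ) else 0) = _ := fun t =>
      (D.sum_triangle (K.sgn t) (fun i => K.extendLabel q a y (t, i))
        (by rw [hy, hy, hy, ha.mul])).symm
    simp only [h1, hy]
    -- The product over triangles of sums over corner colorings becomes one sum over all corner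
    -- colorings.
    rw [Finset.prod_univ_sum, Fintype.piFinset_univ]
    refine Finset.sum_congr rfl fun C _ => ?_
    rw [Finset.prod_mul_distrib]
    congr 1
    rw [← Fintype.prod_prod_type' (fun t i => D.side (K.sgn t * (-1) ^ ((i : Fin 3) : ℕ))
      (K.extendLabel q a y (t, i)) (C t (i.succAbove 0)) (C t (i.succAbove 1))), K.prod_sides]
    refine Finset.prod_congr rfl fun p _ => ?_
    have e1 : K.extendLabel q a y p.1 = (y p).1 := by rw [extendLabel, posSide_coe]
    have e2 : K.extendLabel q a y (K.glue p.1) = (y p).1 := by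
      rw [extendLabel, posSide_glue, posSide_coe]
    have e3 : ¬ K.sgn (K.glue p.1).1 * (-1) ^ ((K.glue p.1).2 : ℕ) = 1 := fun h =>
      (K.sideSign_glue_eq_one_iff p.1).1 h p.2
    congr 1
    · rw [ProjectiveAction.side, if_pos (show K.sgn p.1.1 * (-1) ^ (p.1.2 : ℕ) = 1 from p.2)]
      exact congrArg (fun x => D.P x _ _) e1
    · rw [ProjectiveAction.side, if_neg e3]
      exact congrArg (fun x => D.Q x _ _) e2
  rw [hcard, Finset.sum_congr rfl fun y _ => hstate y, Finset.sum_comm]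
  refine Finset.sum_congr rfl fun C _ => ?_
  rw [← Finset.mul_sum]
  congr 1
  -- For a fixed coloring the labels of different edges are independent, so the sum over labelings
  -- is a product over edges of coset sums.
  have h2 := Finset.prod_univ_sum (fun p : K.PosSide => (Finset.univ : Finset {x // q x = a p.1}))
    (fun p x => D.P x.1 (C p.1.1 (p.1.2.succAbove 0)) (C p.1.1 (p.1.2.succAbove 1)) *
            D.Q x.1 (C (K.glue p.1).1 ((K.glue p.1).2.succAbove 1))
              (C (K.glue p.1).1 ((K.glue p.1).2.succAbove 0)))
  rw [Fintype.piFinset_univ] at h2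
  rw [← h2]
  simp only [D.sum_P_mul_Q, Finset.prod_ite_zero, Finset.mem_univ, true_imp_iff, IsColoring,
    Nat.card_eq_fintype_card]

/-- The state sum when only constant colors occur. -/
theorem card_flatLifts_eq_sum_const [Nonempty T] [Fintype K.PosSide] (ha : K.IsFlat a)
    (F : Finset (Irr q.ker)) (hF : ∀ c ∈ F, ∀ s, irrAction hq (a s) c = c)
    (hconst : ∀ k : T → Fin 3 → Irr q.ker,
      (∀ s i, k (K.glue s).1 ((K.glue s).2.succAbove i) = k s.1 (s.2.succAbove i)) →
      (∀ s, k s.1 (s.2.succAbove 0) = irrAction hq (a s) (k s.1 (s.2.succAbove 1))) →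
      ∃ c ∈ F, ∀ t i, k t i = c) :
    (Nat.card q.ker : ℂ) ^ Fintype.card T * Nat.card (K.FlatLifts q a)
      = ∑ c ∈ F, (c.rep.dim : ℂ) ^ Nat.card K.Vertex *
          ((∏ t, (c.rep.dim : ℂ) * D.scalar (a (t, 2)) (a (t, 0)) c ^ (K.sgn t : ℤ)) *
            ((Nat.card q.ker : ℂ) / c.rep.dim) ^ Fintype.card K.PosSide) := by
  classical
  have : Fintype K.Vertex := Fintype.ofFinite _
  rw [card_flatLifts_eq_sum D ha]
  -- The factor dim^V counts the choices of a basis index at each vertex.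
  have h1 : ∀ c ∈ F, (c.rep.dim : ℂ) ^ Nat.card K.Vertex *
          ((∏ t, (c.rep.dim : ℂ) * D.scalar (a (t, 2)) (a (t, 0)) c ^ (K.sgn t : ℤ)) *
            ((Nat.card q.ker : ℂ) / c.rep.dim) ^ Fintype.card K.PosSide)
      = ∑ _k : K.Vertex → Fin c.rep.dim,
        (∏ t, (c.rep.dim : ℂ) * D.scalar (a (t, 2)) (a (t, 0)) c ^ (K.sgn t : ℤ)) *
            ((Nat.card q.ker : ℂ) / c.rep.dim) ^ Fintype.card K.PosSide := by
    intro c _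
    rw [Finset.sum_const, Finset.card_univ, nsmul_eq_mul, Fintype.card_fun, Fintype.card_fin,
      Nat.card_eq_fintype_card, Nat.cast_pow]
  rw [Finset.sum_congr rfl h1, Finset.sum_sigma']
  symm
  -- A coloring with nonzero weight agrees across all glued sides, hence lives on vertices, and its
  -- class is constant by `hconst`. So it is a class in F with a basis index at each vertex.
  refine Finset.sum_of_injOn
    (fun (x : (c : Irr q.ker) × (K.Vertex → Fin c.rep.dim)) t i => ⟨x.1, x.2 (K.vertex t i)⟩)
    ?_ (fun _ _ => Finset.mem_coe.2 (Finset.mem_univ _)) ?_ ?_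
  · rintro ⟨c, k⟩ - ⟨c', k'⟩ - h
    obtain ⟨t₀⟩ := ‹Nonempty T›
    obtain rfl : c = c' := congrArg Sigma.fst (congrFun (congrFun h t₀) 0)
    have : k = k' := funext (K.vertex_induction fun t i =>
      eq_of_heq (Sigma.mk.inj (congrFun (congrFun h t) i)).2)
    rw [this]
  · intro C _ hC
    by_cases hcol : K.IsColoring hq a C
    swap
    · rw [if_neg hcol, mul_zero]
    refine absurd ?_ hC
    have hglue : ∀ s i, C (K.glue s).1 ((K.glue s).2.succAbove i) = C s.1 (s.2.succAbove i) := by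
      intro s i
      by_cases h : K.sideSign s = 1
      · have := hcol ⟨s, h⟩
        fin_cases i
        · exact this.2.1.symm
        · exact this.1.symm
      · have := hcol ⟨K.glue s, (K.sideSign_glue_eq_one_iff s).2 h⟩
        simp only [K.glue_glue] at this
        fin_cases i
        · exact this.2.1
        · exact this.1
    have hact : ∀ s, (C s.1 (s.2.succAbove 0)).1
        = irrAction hq (a s) (C s.1 (s.2.succAbove 1)).1 := by
      intro s
      by_cases h : K.sideSign s = 1
      · exact (hcol ⟨s, h⟩).2.2.symm
      · have := (hcol ⟨K.glue s, (K.sideSign_glue_eq_one_iff s).2 h⟩).2.2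
        simp only [hglue, ha.glue] at this
        exact this.symm
    obtain ⟨c, hc, hk⟩ := hconst (fun t i => (C t i).1) (fun s i => by rw [hglue]) hact
    have hex : ∀ v : K.Vertex, ∃ j : Fin c.rep.dim, K.vertexLift C hglue v = ⟨c, j⟩ := by
      refine K.vertex_induction fun t i => ?_
      change ∃ j, C t i = ⟨c, j⟩
      have h := hk t i
      generalize C t i = x at h
      obtain ⟨d, j⟩ := x
      obtain rfl : d = c := h
      exact ⟨j, rfl⟩
    choose j hj using hex
    refine ⟨⟨c, j⟩, by simp [hc], ?_⟩
    funext t i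
    exact (hj (K.vertex t i)).symm
  · rintro ⟨c, k⟩ hc
    have hcF : c ∈ F := (Finset.mem_sigma.1 hc).1
    have hcol : K.IsColoring hq a (fun t i => ⟨c, k (K.vertex t i)⟩) := fun p => by
      refine ⟨?_, ?_, hF c hcF p.1⟩ <;> simp only [K.vertex_glue]
    simp only
    rw [if_pos hcol, Finset.prod_const, Finset.card_univ]

end OrientedGluing
end LiftCount
end

/-! ### Evaluation on the fundamental class and the final count -/

noncomputable section
namespace LiftCount

namespace ClosedOrientedSurface

variable {W : Type*} [TopologicalSpace W] (S : ClosedOrientedSurface W)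

theorem nonempty_triangles (w : W) : Nonempty S.T := by
  obtain ⟨⟨t, -⟩, -⟩ := S.proj_surjective w
  exact ⟨t⟩

variable [PathConnectedSpace W] (w : W) {G G' : Type*} [Group G] [Group G'] {q : G' →* G}
  (g : FundamentalGroup W w →* G)

theorem isFlat_edgeLabel : S.gluing.IsFlat (fun s => g (S.edgeLabel w s)) where
  glue s := by rw [S.edgeLabel_glue]
  mul t := by rw [← map_mul, S.edgeLabel_mul]

variable [ConnectedSpace W] {hq : Function.Surjective q} [Finite q.ker] (D : ProjectiveAction hq)

/-- The fundamental chain is the signed sum of the cells `[ℓ₀₁|ℓ₁₂]`, whose entries are the labels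
of sides 2 and 0. These are the arguments of the triangle scalars, and the signs are the exponents.
-/
theorem zetaEval_fundamentalClass (c : Irr q.ker) (hc : g.range ≤ stab q c.rep) :
    (zetaEval q g c.rep hc (S.fundamentalClass w) : ℂ)
      = ∏ t, D.scalar (g (S.edgeLabel w (t, 2))) (g (S.edgeLabel w (t, 0))) c
          ^ (S.gluing.sgn t : ℤ) := by
  let g' : FundamentalGroup W w →* stab q c.rep :=
    g.codRestrict (stab q c.rep) fun x => hc ⟨x, rfl⟩
  have h1 : zetaEval q g c.rep hc (S.fundamentalClass w)
      = ∏ t, zeta q c.rep (g' (S.edgeLabel w (t, 2))) (g' (S.edgeLabel w (t, 0)))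
          ^ (S.gluing.sgn t : ℤ) := by
    change Additive.toMul (evalChain (FundamentalGroup W w)
      (fun p => Additive.ofMul (zeta q c.rep (g' p.1) (g' p.2))) (S.fundamentalChain w)) = _
    rw [fundamentalChain, map_sum, toMul_sum]
    refine Finset.prod_congr rfl fun t _ => ?_
    rw [barCell, map_zsmul, evalChain_single, one_smul]
    rfl
  rw [h1, Units.coe_prod]
  refine Finset.prod_congr rfl fun t _ => ?_
  rw [Units.val_zpow_eq_zpow_val, ← D.scalar_eq_zeta]
  rfl

-- The classes in a contributing coloring are transported along edges by the action of π through g,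
-- so they are constant with value fixed by g(π), that is, with g(π) in the stabilizer.
open Classical in
theorem card_flatLifts :
    (Nat.card q.ker : ℂ) ^ Fintype.card S.T *
        Nat.card (S.gluing.FlatLifts q fun s => g (S.edgeLabel w s))
      = ∑ c : Irr q.ker with g.range ≤ stab q c.rep, (c.rep.dim : ℂ) ^ Nat.card S.gluing.Vertex *
          ((∏ t, (c.rep.dim : ℂ) * D.scalar (g (S.edgeLabel w (t, 2))) (g (S.edgeLabel w (t, 0))) c
              ^ (S.gluing.sgn t : ℤ)) *
            ((Nat.card q.ker : ℂ) / c.rep.dim) ^ Nat.card S.gluing.Edge) := by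
  have := S.nonempty_triangles w
  have : Fintype S.gluing.PosSide := Fintype.ofFinite _
  rw [Nat.card_congr S.gluing.edgeEquiv, Nat.card_eq_fintype_card (α := S.gluing.PosSide)]
  refine OrientedGluing.card_flatLifts_eq_sum_const D (S.isFlat_edgeLabel w g) _ ?_ ?_
  · intro c hc s
    exact (mem_stab_iff hq _ _).1 ((Finset.mem_filter.1 hc).2 ⟨_, rfl⟩)
  · intro k hglue hk
    obtain ⟨c, hc, hkc⟩ := S.exists_fixed_of_corners w ((irrAction hq).comp g) k hglue hk
    refine ⟨c, Finset.mem_filter.2 ⟨Finset.mem_univ _, ?_⟩, hkc⟩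
    rintro _ ⟨x, rfl⟩
    exact (mem_stab_iff hq _ _).2 (hc x)

theorem card_lifts_eq_finsum (hq : Function.Surjective q) :
    (Nat.card (Lifts q g) : ℂ) = (Nat.card q.ker : ℂ) *
      ∑ᶠ c : {c : Irr q.ker // g.range ≤ stab q c.rep},
        ((Nat.card q.ker : ℂ) / (c.1.rep.dim : ℂ)) ^ (-S.eulerChar) *
          (zetaEval q g c.1.rep c.2 (S.fundamentalClass w) : ℂ) := by
  classical
  obtain ⟨D⟩ := nonempty_projectiveAction hq
  have hN : (Nat.card q.ker : ℂ) ≠ 0 := Nat.cast_ne_zero.2 Nat.card_pos.ne'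
  have h1 : (Nat.card (Lifts q g) : ℂ) * (Nat.card q.ker : ℂ) ^ Nat.card S.gluing.Vertex
      = Nat.card (S.gluing.FlatLifts q fun s => g (S.edgeLabel w s)) * Nat.card q.ker := by
    exact_mod_cast S.card_lifts w q g
  have h2 := S.card_flatLifts w g D
  -- With N = |Γ| and d = dim, N^(V+T) (N/d)^(E-V-T) = d^(V+T) (N/d)^E: the powers from the gauge
  -- group, the triangles and the edges combine to the exponent -χ.
  have h3 : ∀ c : Irr q.ker, (Nat.card q.ker : ℂ) ^ Nat.card S.gluing.Vertex *
      (Nat.card q.ker : ℂ) ^ Fintype.card S.T *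
        (((Nat.card q.ker : ℂ) / (c.rep.dim : ℂ)) ^ (-S.eulerChar) *
          ∏ t, D.scalar (g (S.edgeLabel w (t, 2))) (g (S.edgeLabel w (t, 0))) c
              ^ (S.gluing.sgn t : ℤ))
      = (c.rep.dim : ℂ) ^ Nat.card S.gluing.Vertex *
          ((∏ t, (c.rep.dim : ℂ) * D.scalar (g (S.edgeLabel w (t, 2))) (g (S.edgeLabel w (t, 0))) c
              ^ (S.gluing.sgn t : ℤ)) *
            ((Nat.card q.ker : ℂ) / c.rep.dim) ^ Nat.card S.gluing.Edge) := by
    intro c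
    have hd : (c.rep.dim : ℂ) ≠ 0 := Nat.cast_ne_zero.2 c.rep.dim_pos.ne'
    have hNd := div_ne_zero hN hd
    have he : -S.eulerChar = (Nat.card S.gluing.Edge : ℤ)
        - ((Nat.card S.gluing.Vertex + Fintype.card S.T : ℕ) : ℤ) := by
      rw [eulerChar]
      push_cast
      ring
    rw [he, zpow_sub₀ hNd, zpow_natCast, zpow_natCast, Finset.prod_mul_distrib, Finset.prod_const,
      Finset.card_univ, pow_add, div_pow _ _ (Nat.card S.gluing.Vertex),
      div_pow _ _ (Fintype.card S.T)]
    field_simp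
  rw [finsum_eq_sum_of_fintype]
  simp only [S.zetaEval_fundamentalClass w g D]
  rw [← Finset.sum_subtype (Finset.univ.filter fun c : Irr q.ker => g.range ≤ stab q c.rep)
    (fun c => by simp) (fun c : Irr q.ker =>
      ((Nat.card q.ker : ℂ) / (c.rep.dim : ℂ)) ^ (-S.eulerChar) *
          ∏ t, D.scalar (g (S.edgeLabel w (t, 2))) (g (S.edgeLabel w (t, 0))) c
              ^ (S.gluing.sgn t : ℤ))]
  apply mul_left_cancel₀ (mul_ne_zero (pow_ne_zero (Nat.card S.gluing.Vertex) hN)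
    (pow_ne_zero (Fintype.card S.T) hN))
  rw [mul_left_comm, Finset.mul_sum, Finset.sum_congr rfl fun c _ => h3 c, ← h2]
  linear_combination (Nat.card q.ker : ℂ) ^ Fintype.card S.T * h1

end ClosedOrientedSurface
end LiftCount
end

theorem theoremt1 {G G' W : Type*} [Group G] [Group G'] (q : G' →* G)
    (hq : Function.Surjective q) [Finite q.ker]
    [TopologicalSpace W] [ConnectedSpace W] (S : LiftCount.ClosedOrientedSurface W)
    (hS : 0 < S.genus) (w : W) (g : FundamentalGroup W w →* G) :
    Finite (LiftCount.Irr q.ker) ∧ Finite (LiftCount.Lifts q g) ∧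
      (Nat.card (LiftCount.Lifts q g) : ℂ) =
        (Nat.card q.ker : ℂ) *
          ∑ᶠ c : {c : LiftCount.Irr q.ker // g.range ≤ LiftCount.stab q c.rep},
            ((Nat.card q.ker : ℂ) / (c.1.rep.dim : ℂ)) ^ (-S.eulerChar) *
              (LiftCount.zetaEval q g c.1.rep c.2 (S.fundamentalClass w) : ℂ) := by
  have := S.pathConnectedSpace
  exact ⟨inferInstance, S.finite_lifts w q g, S.card_lifts_eq_finsum w g hq⟩
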